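/- Let $n$ be even and let $\Theta$ be a real skew-symmetric $n\times n$ matrix. Let $\mathscr A$ be the universal $C^*$-algebra generated by unitaries $U_1,\dots,U_n$ with $U_jU_\ell=e^{2\pi i\Theta_{\ell j}}U_\ell U_j$, let $\mathbb T^n$ act on it by $\alpha_{z}(U_j)=z_jU_j$, and let the noncommutative $n$-torus $\mathcal A_\Theta$ be the $*$-subalgebra of all $a\in\mathscr A$ for which $z\mapsto\alpha_z(a)$ is smooth. Let $\partial_j$ be the derivations of $\mathcal A_\Theta$ given by the standard basis of $\mathrm{Lie}(\mathbb T^n)$, so that $\partial_jU_\ell=i\delta_{j\ell}U_\ell$. *Definitions.* Let $\mathcal A$ be a unital $*$-algebra represented faithfully by bounded operators on a separable Hilbert space $\mathcal H$. A tuple $(\mathcal A,\mathcal H,d,\gamma,\star)$ is a set of *$N=(1,1)$ spectral data* if $d$ is a densely defined closed operator with $d^2=0$; $[d,a]$ extends to a bounded operator for all $a\in\mathcal A$; $\exp(-\varepsilon(dd^*+d^*d))$ is trace class for all $\varepsilon>0$; $\gamma$ is a self-adjoint unitary commuting with $\mathcal A$ with $\gamma d=-d\gamma$; and $\star$ is a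 unitary commuting with $\mathcal A$ with $\star d=\zeta d^*\star$ for some $\zeta\in\mathbb C$, $|\zeta|=1$. A tuple $(\mathcal A,\mathcal H,\partial,\overline\partial,T,\overline T,\gamma,\star)$ is a set of *$N=(2,2)$ Kähler spectral data* if $\partial,\overline\partial$ are densely defined closed operators and $T,\overline T$ are bounded self-adjoint operators such that 1. $(\mathcal A,\mathcal H,d,\gamma,\star)$ is a set of $N=(1,1)$ spectral data, where $d$ is the closure of $\partial+\overline\partial$; 2. $\partial^2=\overline\partial^2=0$, $\{\partial,\overline\partial\}=0$, $[T,\overline T]=0$, $[T,\partial]=\partial$, $[T,\overline\partial]=0$, $[\overline T,\partial]=0$, $[\overline T,\overline\partial]=\overline\partial$; 3. $T$ and $\overline T$ commute with $\mathcal A$, and $[\partial,a]$, $[\overline\partial,a]$, $\{\partial,[\overline\partial,a]\}$ extend to bounded operators for all $a\in\mathcal A$; 4. $\gamma$ anticommutes with $\partial,\overline\partial$ and commutes with $T,\overline T$; 5. $\star\partial=\zeta\overline\partial^*\star$ and $\star\overline\partial=\zeta\partial^*\star$ for some $\zeta\in\mathbb C$, $|\zeta|=1$; 6. $\{\partial,\overline\partial^*\}=\{\overline\partial,\partial^*\}=0$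 and $\{\partial,\partial^*\}=\{\overline\partial,\overline\partial^*\}$. A *Kähler structure* on $N=(1,1)$ data $(\mathcal A,\mathcal H,d,\gamma,\star)$ is a choice of $\partial,\overline\partial,T,\overline T$ such that $(\mathcal A,\mathcal H,\partial,\overline\partial,T,\overline T,\gamma,\star)$ is a set of $N=(2,2)$ Kähler spectral data and $d$ is the closure of $\partial+\overline\partial$. Two Kähler structures are identified if some unitary of $\mathcal H$ commuting with $\mathcal A$ conjugates $\partial$ to $\partial$ and $\overline\partial$ to $\overline\partial$. *Statement.* There is a unique $\mathbb T^n$-invariant faithful tracial state $\tau$ on $\mathscr A$. With $N=2^{n/2}$, there are matrices $\gamma_1,\dots,\gamma_n,\sigma\in M_N(\mathbb C)$ with $\gamma_j^*=-\gamma_j$, $\gamma_j\gamma_k+\gamma_k\gamma_j=-2\delta_{jk}$, $\sigma^*=\sigma$, $\sigma^2=1$, $\sigma\gamma_j=-\gamma_j\sigma$. For every choice of such matrices, let $\mathcal A_\Theta$ act on the first factor of $\mathcal H=L^2(\mathscr A,\tau)\otimes\mathbb C^N\otimes\mathbb C^N$ by left multiplication (GNS representation), let $d$ be the closure of $$\tfrac12\sum_{j=1}^n\left(\partial_j\otimes1\otimes\gamma_j+i\,\partial_j\otimes\gamma_j\otimes\sigma\right)\quad\text{on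 }\mathcal A_\Theta\otimes\mathbb C^N\otimes\mathbb C^N,$$ and let $\gamma=1\otimes\sigma\otimes\sigma$, $\star=1\otimes1\otimes\sigma$. Then $(\mathcal A_\Theta,\mathcal H,d,\gamma,\star)$ is a set of $N=(1,1)$ spectral data, it extends to $N=(2,2)$ Kähler spectral data (so $\mathcal A_\Theta$ is a noncommutative Kähler manifold), and there are at least $\prod_{1\le j\le n,\ j\text{ odd}}(n-j)$ Kähler structures on it that are pairwise not unitarily equivalent in the above sense. -/

import Mathlib

open scoped CStarAlgebra ENNReal ContDiff Kronecker InnerProductSpace Topology ComplexOrder Matrix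

noncomputable section

/-! ## Unbounded operators on a Hilbert space -/

section Operators

universe u

variable {H : Type u} [NormedAddCommGroup H] [InnerProductSpace ℂ H] [CompleteSpace H]

/-- The composition `A ∘ B` of unbounded operators on its natural domain
`{x ∈ dom B | B x ∈ dom A}`. -/
def pcomp (A B : H →ₗ.[ℂ] H) : H →ₗ.[ℂ] H :=
  A.comp (B.domRestrict ((A.domain.comap B.toFun).map B.domain.subtype)) (fun x => by
    obtain ⟨y, hy, hyx⟩ := x.2.1
    have h : B.domRestrict ((A.domain.comap B.toFun).map B.domain.subtype) x = B y :=
      LinearPMap.domRestrict_apply hyx.symm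
    rw [h]
    exact hy)

/-- The anticommutator `{A, B} = A ∘ B + B ∘ A` on its natural domain. -/
def anticomm (A B : H →ₗ.[ℂ] H) : H →ₗ.[ℂ] H := pcomp A B + pcomp B A

/-- The relation `{A, B} = 0` between unbounded operators: the anticommutator is densely defined
and vanishes on its natural domain. -/
def AnticommZero (A B : H →ₗ.[ℂ] H) : Prop :=
  Dense ((anticomm A B).domain : Set H) ∧ ∀ x, anticomm A B x = 0

/-- The relation `A² = 0`: the operator `A` maps its domain into its kernel. -/
def SqZero (A : H →ₗ.[ℂ] H) : Prop := ∀ x y, (x, y) ∈ A.graph → (y, (0 : H)) ∈ A.graph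

/-- For bounded operators `b`, `C` and an unbounded operator `A`: `b` preserves `dom A` and
`A b - b A = C` on `dom A`, i.e. the commutator `[A, b]` extends to `C`. -/
def CommExtends (A : H →ₗ.[ℂ] H) (b C : H →L[ℂ] H) : Prop :=
  ∀ x y, (x, y) ∈ A.graph → (b x, b y + C x) ∈ A.graph

/-- `b` preserves `dom A` and `A b + b A = C` on `dom A`, i.e. the anticommutator `{A, b}` extends
to the bounded operator `C`. -/
def AnticommExtends (A : H →ₗ.[ℂ] H) (b C : H →L[ℂ] H) : Prop :=
  ∀ x y, (x, y) ∈ A.graph → (b x, C x - b y) ∈ A.graph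

/-- `[T, A] = A` for `T` bounded: `T` preserves `dom A`, and `T A x - A T x = A x` there. -/
def CommEqSelf (T : H →L[ℂ] H) (A : H →ₗ.[ℂ] H) : Prop :=
  ∀ x y, (x, y) ∈ A.graph → (T x, T y - y) ∈ A.graph

/-- `[T, A] = 0` for `T` bounded: `T` preserves `dom A`, and `T A x = A T x` there. -/
def CommZero (T : H →L[ℂ] H) (A : H →ₗ.[ℂ] H) : Prop :=
  ∀ x y, (x, y) ∈ A.graph → (T x, T y) ∈ A.graph

/-- `{g, A} = 0` for `g` bounded: `g` preserves `dom A`, and `g A x = - A g x` there. -/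
def BddAnticommZero (g : H →L[ℂ] H) (A : H →ₗ.[ℂ] H) : Prop :=
  ∀ x y, (x, y) ∈ A.graph → (g x, -(g y)) ∈ A.graph

/-- The equality of unbounded operators `s A = ζ B s` (including domains: `x ∈ dom A` if and only
if `s x ∈ dom B`), for `s` unitary and `ζ ≠ 0`. -/
def HodgeRel (s : H →L[ℂ] H) (ζ : ℂ) (A B : H →ₗ.[ℂ] H) : Prop :=
  ∀ x y, (x, y) ∈ A.graph ↔ (s x, ζ⁻¹ • s y) ∈ B.graph

/-- A `ℤ/2`-grading operator: a self-adjoint unitary. -/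
def IsGrading (g : H →L[ℂ] H) : Prop := IsSelfAdjoint g ∧ g * g = 1

/-- A bounded operator is trace class if `∑ ⟪b i, |S| b i⟫` is finite for an orthonormal basis. -/
def IsTraceClass (S : H →L[ℂ] H) : Prop :=
  ∃ (κ : Type u) (b : HilbertBasis κ ℂ H), Summable fun i => (⟪b i, CFC.abs S (b i)⟫_ℂ).re

/-- `S t = exp (-t A)` for `t ≥ 0`: the strongly continuous one-parameter semigroup with
generator `-A`. (For a positive self-adjoint `A` this is the exponential of the functional
calculus, and in general it is uniquely determined by `A` for `t ≥ 0`.) -/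
structure IsExpNeg (A : H →ₗ.[ℂ] H) (S : ℝ → H →L[ℂ] H) : Prop where
  zero : S 0 = 1
  add : ∀ s t, 0 ≤ s → 0 ≤ t → S (s + t) = S s * S t
  cont : ∀ x, ContinuousOn (fun t => S t x) (Set.Ici 0)
  gen : ∀ x y, (x, y) ∈ A.graph ↔
    Filter.Tendsto (fun t : ℝ => ((t⁻¹ : ℝ) : ℂ) • (S t x - x)) (𝓝[>] 0) (𝓝 (-y))

/-- `exp (-ε A)` is trace class for all `ε > 0`. -/
def ExpTraceClass (A : H →ₗ.[ℂ] H) : Prop :=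
  ∃ S : ℝ → H →L[ℂ] H, IsExpNeg A S ∧ ∀ ε, 0 < ε → IsTraceClass (S ε)

/-! ## `N = (1,1)` and `N = (2,2)` Kähler spectral data -/

variable {𝒜 : Type*} [Ring 𝒜] [StarRing 𝒜] [Algebra ℂ 𝒜]

/-- `(𝒜, H, d, γ, ⋆)` is a set of `N = (1,1)` spectral data; `π` is the representation of `𝒜`. -/
structure IsN11SpectralData (π : 𝒜 →⋆ₐ[ℂ] (H →L[ℂ] H)) (d : H →ₗ.[ℂ] H)
    (γ hodge : H →L[ℂ] H) : Prop where
  separable : TopologicalSpace.SeparableSpace H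
  faithful : Function.Injective π
  dense_d : Dense (d.domain : Set H)
  closed_d : d.IsClosed
  sq_d : SqZero d
  comm_d : ∀ a, ∃ C, CommExtends d (π a) C
  trace : ExpTraceClass (anticomm d d.adjoint)
  grading : IsGrading γ
  grading_comm : ∀ a, γ * π a = π a * γ
  grading_d : BddAnticommZero γ d
  hodge_unitary : hodge ∈ unitary (H →L[ℂ] H)
  hodge_d : ∃ ζ : ℂ, ‖ζ‖ = 1 ∧ HodgeRel hodge ζ d d.adjoint
  hodge_comm : ∀ a, hodge * π a = π a * hodge

/-- `(𝒜, H, δ, δ', T, T', γ, ⋆)` is a set of `N = (2,2)` Kähler spectral data, where `δ = ∂`,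
`δ' = ∂̄` and `T' = T̄`. The sum `∂ + ∂̄`, defined on `dom ∂ ∩ dom ∂̄`, is in general only closable,
and the closed differential `d = ∂ + ∂̄` is its closure. -/
structure IsKahlerSpectralData (π : 𝒜 →⋆ₐ[ℂ] (H →L[ℂ] H)) (δ δ' : H →ₗ.[ℂ] H)
    (T T' γ hodge : H →L[ℂ] H) : Prop where
  n11 : IsN11SpectralData π (δ + δ').closure γ hodge
  selfAdjoint_T : IsSelfAdjoint T
  selfAdjoint_T' : IsSelfAdjoint T'
  dense_δ : Dense (δ.domain : Set H)
  dense_δ' : Dense (δ'.domain : Set H)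
  closed_δ : δ.IsClosed
  closed_δ' : δ'.IsClosed
  sq_δ : SqZero δ
  sq_δ' : SqZero δ'
  anticomm_δ_δ' : AnticommZero δ δ'
  comm_T_T' : T * T' = T' * T
  comm_T_δ : CommEqSelf T δ
  comm_T_δ' : CommZero T δ'
  comm_T'_δ : CommZero T' δ
  comm_T'_δ' : CommEqSelf T' δ'
  comm_T : ∀ a, T * π a = π a * T
  comm_T' : ∀ a, T' * π a = π a * T'
  comm_δ : ∀ a, ∃ C, CommExtends δ (π a) C
  comm_δ' : ∀ a, ∃ C, CommExtends δ' (π a) C ∧ ∃ E, AnticommExtends δ C E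
  grading_δ : BddAnticommZero γ δ
  grading_δ' : BddAnticommZero γ δ'
  grading_T : γ * T = T * γ
  grading_T' : γ * T' = T' * γ
  hodge_rel : ∃ ζ : ℂ, ‖ζ‖ = 1 ∧
    HodgeRel hodge ζ δ δ'.adjoint ∧ HodgeRel hodge ζ δ' δ.adjoint
  kahler_δ_δ' : AnticommZero δ δ'.adjoint
  kahler_δ'_δ : AnticommZero δ' δ.adjoint
  kahler_laplacian : anticomm δ δ.adjoint = anticomm δ' δ'.adjoint

/-- A Kähler structure on the `N = (1,1)` data `(𝒜, H, d, γ, ⋆)`: operators `∂, ∂̄, T, T̄` making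
`(𝒜, H, ∂, ∂̄, T, T̄, γ, ⋆)` a set of `N = (2,2)` Kähler spectral data with `d = ∂ + ∂̄`. -/
structure KahlerStructure (π : 𝒜 →⋆ₐ[ℂ] (H →L[ℂ] H)) (d : H →ₗ.[ℂ] H)
    (γ hodge : H →L[ℂ] H) where
  δ : H →ₗ.[ℂ] H
  δ' : H →ₗ.[ℂ] H
  T : H →L[ℂ] H
  T' : H →L[ℂ] H
  isKahler : IsKahlerSpectralData π δ δ' T T' γ hodge
  sum_eq : (δ + δ').closure = d

/-- Two Kähler structures are unitarily equivalent if a unitary operator commuting with the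
algebra conjugates `∂` into `∂` and `∂̄` into `∂̄` (as unbounded operators, with their domains). -/
def KahlerStructure.UnitarilyEquiv {π : 𝒜 →⋆ₐ[ℂ] (H →L[ℂ] H)} {d : H →ₗ.[ℂ] H}
    {γ hodge : H →L[ℂ] H} (K K' : KahlerStructure π d γ hodge) : Prop :=
  ∃ V : H ≃ₗᵢ[ℂ] H, (∀ a x, V (π a x) = π a (V x)) ∧
    (∀ x y, (x, y) ∈ K.δ.graph ↔ (V x, V y) ∈ K'.δ.graph) ∧
    (∀ x y, (x, y) ∈ K.δ'.graph ↔ (V x, V y) ∈ K'.δ'.graph)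

end Operators

/-! ## The noncommutative torus -/

section Torus

variable {n : ℕ}

/-- The defining relations of the noncommutative torus: the `V j` are unitaries with
`V j V l = exp (2 π i Θ l j) V l V j`. -/
structure IsTorusFamily (Θ : Matrix (Fin n) (Fin n) ℝ) {B : Type*} [CStarAlgebra B]
    (V : Fin n → B) : Prop where
  unitary : ∀ j, V j ∈ unitary B
  rel : ∀ j l, V j * V l = Complex.exp (2 * Real.pi * Complex.I * (Θ l j : ℂ)) • (V l * V j)

/-- A (nonzero) `C*`-algebra with a family of unitaries satisfying the relations. -/
structure TorusModel (Θ : Matrix (Fin n) (Fin n) ℝ) where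
  carrier : Type
  [alg : CStarAlgebra carrier]
  [nontriv : Nontrivial carrier]
  gen : Fin n → carrier
  isFamily : IsTorusFamily Θ gen

attribute [instance] TorusModel.alg TorusModel.nontriv

variable (Θ : Matrix (Fin n) (Fin n) ℝ)

/-- The `C*`-algebra of bounded families of elements of all models. -/
def TorusAmbient : Type 1 := lp (fun m : TorusModel Θ => m.carrier) ∞

/-- The structure of a `C*`-algebra, with the norm `‖x‖ = sup_m ‖x m‖`. -/
def torusAmbientCStar : CStarAlgebra (TorusAmbient Θ) where
  toNormedRing := lp.inftyNormedRing (B := fun m : TorusModel Θ => m.carrier)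
  toStarRing := lp.inftyStarRing (B := fun m : TorusModel Θ => m.carrier)
  toCompleteSpace :=
    inferInstanceAs (CompleteSpace (lp (fun m : TorusModel Θ => m.carrier) ∞))
  toCStarRing := lp.inftyCStarRing (B := fun m : TorusModel Θ => m.carrier)
  toNormedAlgebra :=
    lp.inftyNormedAlgebra (𝕜 := ℂ) (B := fun m : TorusModel Θ => m.carrier)
  toStarModule := inferInstanceAs (StarModule ℂ (lp (fun m : TorusModel Θ => m.carrier) ∞))

instance : CStarAlgebra (TorusAmbient Θ) := torusAmbientCStar Θ

variable {Θ}

/-- The generating unitary `U j`, the family of all `m.gen j`. -/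
def ambientGen (j : Fin n) : TorusAmbient Θ :=
  ⟨fun m => m.gen j, memℓp_infty ⟨1, by
    rintro _ ⟨m, rfl⟩
    exact CStarRing.norm_of_mem_unitary (m.isFamily.unitary j) |>.le⟩⟩

variable (Θ)

/-- The `*`-algebra generated by the `U j`. -/
def torusPoly : StarSubalgebra ℂ (TorusAmbient Θ) :=
  StarAlgebra.adjoin ℂ (Set.range (ambientGen (Θ := Θ)))

/-- The universal `C*`-algebra generated by unitaries `U 0, …, U (n-1)` subject to
`U j U l = exp (2 π i Θ l j) U l U j`: the closure of the `*`-algebra they generate in the norm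
`‖x‖ = sup_m ‖x m‖` over all models. Its universal property is `torus_universal` below. (A `C*`-algebra generated by
`n` elements is separable, hence isomorphic to one in `Type`, so models in `Type` suffice.) -/
def NCTorus : Type 1 := (torusPoly Θ).topologicalClosure

/-- The structure of a `C*`-algebra inherited from the ambient algebra. -/
def torusCStar : CStarAlgebra (NCTorus Θ) :=
  haveI : IsClosed ((torusPoly Θ).topologicalClosure : Set (TorusAmbient Θ)) :=
    (torusPoly Θ).isClosed_topologicalClosure
  StarSubalgebra.cstarAlgebra (torusPoly Θ).topologicalClosure

instance : CStarAlgebra (NCTorus Θ) := torusCStar Θ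

/-- The usual order on a `C*`-algebra: `a ≤ b` if and only if `b - a` is positive. -/
instance : PartialOrder (NCTorus Θ) := CStarAlgebra.spectralOrder _

instance : StarOrderedRing (NCTorus Θ) := CStarAlgebra.spectralOrderedRing _

variable {Θ}

theorem ambientGen_mem (j : Fin n) : ambientGen (Θ := Θ) j ∈ (torusPoly Θ).topologicalClosure :=
  (torusPoly Θ).le_topologicalClosure (StarAlgebra.subset_adjoin ℂ _ ⟨j, rfl⟩)

/-- The generator `U j` of the noncommutative torus. -/
def torusGen (j : Fin n) : NCTorus Θ := ⟨ambientGen j, ambientGen_mem j⟩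

/-- Evaluation at a model. -/
def ambientEval (m : TorusModel Θ) : TorusAmbient Θ →⋆ₐ[ℂ] m.carrier where
  toFun x := x.1 m
  map_one' := rfl
  map_mul' _ _ := rfl
  map_zero' := rfl
  map_add' _ _ := rfl
  commutes' _ := rfl
  map_star' _ := rfl

theorem ambient_ext {x y : TorusAmbient Θ} (h : ∀ m, ambientEval m x = ambientEval m y) : x = y :=
  Subtype.ext (funext h)

/-- The inclusion of the torus into the ambient algebra. -/
def torusIncl : NCTorus Θ →⋆ₐ[ℂ] TorusAmbient Θ := (torusPoly Θ).topologicalClosure.subtype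

theorem ambient_isTorusFamily : IsTorusFamily Θ (ambientGen (Θ := Θ)) where
  unitary j := by
    rw [Unitary.mem_iff]
    constructor <;> refine ambient_ext fun m => ?_
    · rw [map_mul, map_star, map_one]
      exact Unitary.star_mul_self_of_mem (m.isFamily.unitary j)
    · rw [map_mul, map_star, map_one]
      exact Unitary.mul_star_self_of_mem (m.isFamily.unitary j)
  rel j l := ambient_ext fun m => by
    rw [map_smul, map_mul, map_mul]
    exact m.isFamily.rel j l

theorem torusGen_isTorusFamily : IsTorusFamily Θ (torusGen (Θ := Θ)) where
  unitary j := by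
    have h := Unitary.mem_iff.1 ((ambient_isTorusFamily (Θ := Θ)).unitary j)
    exact Unitary.mem_iff.2 ⟨Subtype.ext h.1, Subtype.ext h.2⟩
  rel j l := Subtype.ext ((ambient_isTorusFamily (Θ := Θ)).rel j l)

/-- Two `*`-homomorphisms on the torus that agree on the generators are equal. -/
theorem torus_hom_ext {B : Type*} [CStarAlgebra B] {φ ψ : NCTorus Θ →⋆ₐ[ℂ] B}
    (h : ∀ j, φ (torusGen j) = ψ (torusGen j)) : φ = ψ := by
  have hφ : Continuous φ := map_continuous φ
  have hψ : Continuous ψ := map_continuous ψ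
  refine StarAlgHom.ext_topologicalClosure (S := torusPoly Θ) hφ hψ ?_
  refine StarAlgHom.ext_adjoin (s := Set.range (ambientGen (Θ := Θ))) ?_
  rintro ⟨_, _⟩ ⟨j, rfl⟩
  exact h j

/-- The universal property. -/
theorem torus_universal {B : Type} [CStarAlgebra B] (V : Fin n → B) (hV : IsTorusFamily Θ V) :
    ∃! φ : NCTorus Θ →⋆ₐ[ℂ] B, ∀ j, φ (torusGen j) = V j := by
  refine existsUnique_of_exists_of_unique ?_ fun φ ψ hφ hψ =>
    torus_hom_ext fun j => (hφ j).trans (hψ j).symm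
  rcases subsingleton_or_nontrivial B with hB | hB
  · exact ⟨{ toFun := fun _ => 0
             map_one' := Subsingleton.elim _ _
             map_mul' := fun _ _ => Subsingleton.elim _ _
             map_zero' := Subsingleton.elim _ _
             map_add' := fun _ _ => Subsingleton.elim _ _
             commutes' := fun _ => Subsingleton.elim _ _
             map_star' := fun _ => Subsingleton.elim _ _ }, fun _ => Subsingleton.elim _ _⟩
  · exact ⟨(ambientEval (Θ := Θ) ⟨B, V, hV⟩).comp torusIncl, fun j => rfl⟩

/-! ### The action of the torus group, smooth elements, derivations -/

/-- The model with the same carrier and generators `z j • m.gen j`. -/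
def TorusModel.rotate (z : Fin n → Circle) (m : TorusModel Θ) : TorusModel Θ where
  carrier := m.carrier
  gen j := (z j : ℂ) • m.gen j
  isFamily :=
    { unitary := fun j => by
        have h := Unitary.mem_iff.1 (m.isFamily.unitary j)
        have hz : starRingEnd ℂ (z j : ℂ) * (z j : ℂ) = 1 := by
          rw [Complex.conj_mul', Circle.norm_coe]; norm_num
        have hz' : (z j : ℂ) * starRingEnd ℂ (z j : ℂ) = 1 := by rw [mul_comm]; exact hz
        rw [Unitary.mem_iff]
        simp only [star_smul, smul_mul_smul_comm, h.1, h.2, RCLike.star_def, hz, hz', one_smul,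
          and_self]
      rel := fun j l => by
        simp only [smul_mul_smul_comm]
        rw [m.isFamily.rel j l, smul_smul, smul_smul, mul_comm (z l : ℂ), mul_comm] }

/-- The `*`-endomorphism `(x m)_m ↦ (x (m.rotate z))_m` of the ambient algebra. -/
def ambientRotate (z : Fin n → Circle) : TorusAmbient Θ →⋆ₐ[ℂ] TorusAmbient Θ where
  toFun x := ⟨fun m => x.1 (m.rotate z), by
    refine memℓp_infty ?_
    obtain ⟨C, hC⟩ := memℓp_infty_iff.1 x.2
    refine ⟨C, ?_⟩
    rintro _ ⟨m, rfl⟩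
    exact hC ⟨m.rotate z, rfl⟩⟩
  map_one' := rfl
  map_mul' _ _ := rfl
  map_zero' := rfl
  map_add' _ _ := rfl
  commutes' _ := rfl
  map_star' _ := rfl

theorem ambientRotate_mem (z : Fin n → Circle) (x : TorusAmbient Θ)
    (hx : x ∈ (torusPoly Θ).topologicalClosure) :
    ambientRotate z x ∈ (torusPoly Θ).topologicalClosure := by
  have hc : Continuous (ambientRotate (Θ := Θ) z) := map_continuous _
  have h : torusPoly Θ ≤ (torusPoly Θ).topologicalClosure.comap (ambientRotate z) := by
    refine StarAlgebra.adjoin_le ?_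
    rintro _ ⟨j, rfl⟩
    exact (torusPoly Θ).topologicalClosure.smul_mem (ambientGen_mem j) (z j : ℂ)
  exact StarSubalgebra.topologicalClosure_minimal h
    ((torusPoly Θ).isClosed_topologicalClosure.preimage hc) hx

/-- The action `α z` of `z ∈ 𝕋ⁿ` on the torus, determined by `α z (U j) = z j U j`. -/
def torusAction (z : Fin n → Circle) : NCTorus Θ →⋆ₐ[ℂ] NCTorus Θ :=
  ((ambientRotate z).comp torusIncl).codRestrict (torusPoly Θ).topologicalClosure
    (fun x => ambientRotate_mem z _ x.2)

theorem torusAction_gen (z : Fin n → Circle) (j : Fin n) :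
    torusAction z (torusGen (Θ := Θ) j) = (z j : ℂ) • torusGen j := rfl

variable (Θ) in
/-- The smooth subalgebra `𝒜_Θ`: all `a` for which `z ↦ α z a` is smooth on `𝕋ⁿ`, i.e. smooth in
the coordinates `t ↦ (exp (i t 0), …, exp (i t (n-1)))`. -/
def smoothTorus : StarSubalgebra ℂ (NCTorus Θ) where
  carrier := {a | ContDiff ℝ ∞ fun t : Fin n → ℝ => torusAction (fun j => Circle.exp (t j)) a}
  mul_mem' {a b} ha hb := by
    simp only [Set.mem_ofPred_eq, map_mul] at *
    exact ha.mul hb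
  add_mem' {a b} ha hb := by
    simp only [Set.mem_ofPred_eq, map_add] at *
    exact ha.add hb
  algebraMap_mem' r := by
    simp only [Set.mem_ofPred_eq, AlgHomClass.commutes]
    exact contDiff_const
  star_mem' {a} ha := by
    simp only [Set.mem_ofPred_eq, map_star] at *
    exact (starL' ℝ (A := NCTorus Θ)).contDiff.comp ha

/-- The curve `s ↦ α (exp (s X j)) a` for the standard basis `X j` of the Lie algebra of `𝕋ⁿ`. -/
def torusCurve (j : Fin n) (a : NCTorus Θ) (s : ℝ) : NCTorus Θ :=
  torusAction (Pi.mulSingle j (Circle.exp s)) a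

theorem differentiable_torusCurve (j : Fin n) (a : smoothTorus Θ) :
    Differentiable ℝ (torusCurve j (a : NCTorus Θ)) := by
  have h0 : ContDiff ℝ ∞
      fun t : Fin n → ℝ => torusAction (fun i => Circle.exp (t i)) (a : NCTorus Θ) := a.2
  have h1 : Differentiable ℝ
      fun t : Fin n → ℝ => torusAction (fun i => Circle.exp (t i)) (a : NCTorus Θ) :=
    h0.differentiable (by simp)
  have h2 : Differentiable ℝ fun s : ℝ => (Pi.single j s : Fin n → ℝ) :=
    (ContinuousLinearMap.single ℝ (fun _ : Fin n => ℝ) j).differentiable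
  have h3 : torusCurve j (a : NCTorus Θ) =
      (fun t : Fin n → ℝ => torusAction (fun i => Circle.exp (t i)) (a : NCTorus Θ)) ∘
        fun s : ℝ => (Pi.single j s : Fin n → ℝ) := by
    funext s
    simp only [torusCurve, Function.comp]
    congr 1
    congr 1
    funext i
    by_cases hi : i = j
    · subst hi; simp
    · simp [hi]
  rw [h3]
  exact h1.comp h2

theorem deriv_smul_curve {A : Type*} [CStarAlgebra A] (c : ℂ) {f : ℝ → A}
    (hf : DifferentiableAt ℝ f 0) : deriv (c • f) 0 = c • deriv f 0 :=
  deriv_const_smul c hf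

/-- The derivation `∂ j a = d/ds α (exp (s X j)) a` at `s = 0` on smooth elements. -/
def torusDeriv (j : Fin n) : smoothTorus Θ →ₗ[ℂ] NCTorus Θ where
  toFun a := deriv (torusCurve j (a : NCTorus Θ)) 0
  map_add' a b := by
    have h : torusCurve j ((a + b : smoothTorus Θ) : NCTorus Θ) =
        torusCurve j (a : NCTorus Θ) + torusCurve j (b : NCTorus Θ) := by
      funext s
      exact map_add _ _ _
    rw [h]
    exact deriv_add (differentiable_torusCurve j a 0) (differentiable_torusCurve j b 0)
  map_smul' c a := by
    have h : torusCurve j ((c • a : smoothTorus Θ) : NCTorus Θ) =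
        c • torusCurve j (a : NCTorus Θ) := by
      funext s
      exact map_smul (torusAction (Pi.mulSingle j (Circle.exp s))) c (a : NCTorus Θ)
    rw [h]
    exact deriv_smul_curve c (differentiable_torusCurve j a 0)

/-! ### The canonical trace and the operators on `L²(𝒜_Θ, τ) ⊗ ℂ^ι` -/

/-- `τ` is a faithful tracial state invariant under the action of `𝕋ⁿ`. -/
structure IsInvariantTrace (τ : NCTorus Θ →ₚ[ℂ] ℂ) : Prop where
  one : τ 1 = 1
  invariant : ∀ z a, τ (torusAction z a) = τ a
  tracial : ∀ a b, τ (a * b) = τ (b * a)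
  faithful : ∀ a, τ (star a * a) = 0 → a = 0

section Amplification

variable {E : Type*} [NormedAddCommGroup E] [InnerProductSpace ℂ E]
variable {ι : Type*} [Fintype ι]

/-- The operator `1 ⊗ M` on `E ⊗ ℂ^ι = E^ι`, for a matrix `M`. -/
def matrixOp (M : Matrix ι ι ℂ) : PiLp 2 (fun _ : ι => E) →L[ℂ] PiLp 2 (fun _ : ι => E) :=
  (PiLp.continuousLinearEquiv 2 ℂ (fun _ : ι => E)).symm.toContinuousLinearMap ∘L
    (ContinuousLinearMap.pi fun s => ∑ t, M s t • ContinuousLinearMap.proj t) ∘L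
    (PiLp.continuousLinearEquiv 2 ℂ (fun _ : ι => E)).toContinuousLinearMap

/-- The operator `b ⊗ 1` on `E ⊗ ℂ^ι = E^ι`. -/
def diagOp (b : E →L[ℂ] E) : PiLp 2 (fun _ : ι => E) →L[ℂ] PiLp 2 (fun _ : ι => E) :=
  (PiLp.continuousLinearEquiv 2 ℂ (fun _ : ι => E)).symm.toContinuousLinearMap ∘L
    (ContinuousLinearMap.pi fun s => b ∘L ContinuousLinearMap.proj s) ∘L
    (PiLp.continuousLinearEquiv 2 ℂ (fun _ : ι => E)).toContinuousLinearMap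

variable [CompleteSpace E]

variable (E ι) in
/-- The amplification `b ↦ b ⊗ 1`. -/
def amplify :
    (E →L[ℂ] E) →⋆ₐ[ℂ] (PiLp 2 (fun _ : ι => E) →L[ℂ] PiLp 2 (fun _ : ι => E)) where
  toFun := diagOp
  map_one' := rfl
  map_mul' _ _ := rfl
  map_zero' := rfl
  map_add' _ _ := rfl
  commutes' _ := rfl
  map_star' b := by
    rw [ContinuousLinearMap.star_eq_adjoint, ContinuousLinearMap.star_eq_adjoint,
      ContinuousLinearMap.eq_adjoint_iff]
    intro x y
    simp only [PiLp.inner_apply]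
    exact Finset.sum_congr rfl fun i _ => ContinuousLinearMap.adjoint_inner_left b (y i) (x i)

end Amplification

variable (τ : NCTorus Θ →ₚ[ℂ] ℂ) (ι : Type) [Fintype ι]

/-- The Hilbert space `L²(𝒜_Θ, τ) ⊗ ℂ^ι`, with the GNS space as `L²(𝒜_Θ, τ)`. -/
abbrev TorusHilbert : Type 1 := PiLp 2 (fun _ : ι => τ.GNS)

/-- The representation `a ↦ a ⊗ 1` of `𝒜_Θ` on `L²(𝒜_Θ, τ) ⊗ ℂ^ι` by left multiplication. -/
def torusRep : smoothTorus Θ →⋆ₐ[ℂ] (TorusHilbert τ ι →L[ℂ] TorusHilbert τ ι) :=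
  ((amplify τ.GNS ι).comp τ.gnsStarAlgHom).comp (smoothTorus Θ).subtype

variable {ι}

/-- The vector in `L²(𝒜_Θ, τ) ⊗ ℂ^ι` with coordinates `a t`. -/
def torusVec (a : ι → NCTorus Θ) : TorusHilbert τ ι :=
  WithLp.toLp 2 fun t => ((τ.toPreGNS (a t) : τ.PreGNS) : τ.GNS)

/-- The closed operator `∑ j, ∂ j ⊗ S j` on `L²(𝒜_Θ, τ) ⊗ ℂ^ι`, for matrices `S j`: the closure
of the operator with domain `𝒜_Θ ⊗ ℂ^ι`. -/
def torusOp (S : Fin n → Matrix ι ι ℂ) : TorusHilbert τ ι →ₗ.[ℂ] TorusHilbert τ ι :=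
  (Submodule.toLinearPMap (Submodule.span ℂ (Set.range fun a : ι → smoothTorus Θ =>
    (torusVec τ fun t => (a t : NCTorus Θ),
      ∑ j, matrixOp (S j) (torusVec τ fun t => torusDeriv j (a t)))))).closure

end Torus

/-! ### Clifford matrices and the `N = (1,1)` data of the noncommutative torus -/

/-- Skew-adjoint matrices `γ j` on `ℂ^N`, `N = 2^(n/2)`, with `γ j γ k + γ k γ j = -2 δ j k`, and
a grading `σ` anticommuting with them (an irreducible representation of the complex Clifford
algebra with `n` generators, for `n` even). -/
structure CliffordRep (n : ℕ) where
  γ : Fin n → Matrix (Fin (2 ^ (n / 2))) (Fin (2 ^ (n / 2))) ℂ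
  σ : Matrix (Fin (2 ^ (n / 2))) (Fin (2 ^ (n / 2))) ℂ
  γ_skew : ∀ j, (γ j)ᴴ = -γ j
  γ_anticomm : ∀ j k, γ j * γ k + γ k * γ j = if j = k then -2 else 0
  σ_adj : σᴴ = σ
  σ_sq : σ * σ = 1
  σ_anticomm : ∀ j, σ * γ j = -(γ j * σ)

namespace CliffordRep

variable {n : ℕ} (c : CliffordRep n)

/-- The index set of the standard basis of `ℂ^N ⊗ ℂ^N`. -/
abbrev Idx (_ : CliffordRep n) : Type := Fin (2 ^ (n / 2)) × Fin (2 ^ (n / 2))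

/-- The coefficients of `d = (𝔇 - i 𝔇') / 2`, where `𝔇 = ∑ j, ∂ j ⊗ 1 ⊗ γ j` and
`𝔇' = -∑ j, ∂ j ⊗ γ j ⊗ σ`. -/
def dSymbol (j : Fin n) : Matrix c.Idx c.Idx ℂ :=
  (1 / 2 : ℂ) • ((1 ⊗ₖ c.γ j) - Complex.I • -(c.γ j ⊗ₖ c.σ))

variable {Θ : Matrix (Fin n) (Fin n) ℝ} (τ : NCTorus Θ →ₚ[ℂ] ℂ)

/-- The representation of `𝒜_Θ` on `L²(𝒜_Θ, τ) ⊗ ℂ^N ⊗ ℂ^N`. -/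
abbrev rep : smoothTorus Θ →⋆ₐ[ℂ] (TorusHilbert τ c.Idx →L[ℂ] TorusHilbert τ c.Idx) :=
  torusRep τ c.Idx

/-- The differential `d` on `L²(𝒜_Θ, τ) ⊗ ℂ^N ⊗ ℂ^N`. -/
def d : TorusHilbert τ c.Idx →ₗ.[ℂ] TorusHilbert τ c.Idx := torusOp τ c.dSymbol

/-- The grading `1 ⊗ σ ⊗ σ`. -/
def grading : TorusHilbert τ c.Idx →L[ℂ] TorusHilbert τ c.Idx := matrixOp (c.σ ⊗ₖ c.σ)

/-- The Hodge operator `1 ⊗ 1 ⊗ σ`. -/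
def hodge : TorusHilbert τ c.Idx →L[ℂ] TorusHilbert τ c.Idx := matrixOp (1 ⊗ₖ c.σ)

end CliffordRep

end

set_option linter.unusedSectionVars false

noncomputable section

/-! ### Graphs of sums, products and anticommutators of unbounded operators. -/

section GraphCalculus

universe u

variable {H : Type u} [NormedAddCommGroup H] [InnerProductSpace ℂ H] [CompleteSpace H]

/-! Fourier analysis turns every operator in the statement into multiplication by matrices. The
trace annihilates each monomial U^k with k ≠ 0, so the monomials form an orthonormal basis of L²(𝒜,
τ); they are also eigenvectors of the derivations, ∂_j U^k = i k_j U^k. Hence H becomes ℓ²(ℤⁿ; ℂ^N ⊗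
ℂ^N), and the closure of ∑ ∂_j ⊗ S_j becomes the maximal operator of multiplication by i ∑ k_j S_j
(`isMultiplier_torusOp`). Closedness, adjoints and the relations between operators then reduce to
matrix identities in one fibre. The delicate domain question is that of the Laplacian, settled in
`IsMultiplier.anticomm_adjoint`.

The fibre algebra is that of a fermionic Fock space. The coefficients A_j of d satisfy the canonical
anticommutation relations, so with a(v) = ∑ v_j A_j the differential multiplies by a(ik), d² = 0,
and dd* + d*d multiplies by |k|²; its heat trace is a Gaussian lattice sum. The Hodge operator
carries a(v) to the adjoint of a(v̄), and since ik is purely imaginary, ζ = -1.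

A Kähler structure comes from an orthogonal complex structure J on ℝⁿ. With P = (1 - iJ)/2, a
Hermitian projection satisfying P̄ = 1 - P, let ∂ and ∂̄ multiply by a(P ik) and a((1 - P) ik), and
let T, T̄ be the second quantizations of P and 1 - P. The relation [dΓ(P), a(v)] = a(Pv) gives the
bigrading. The complex conjugation rule for P gives the Hodge relations and makes the two parts of
ik orthogonal and equally long, which gives the Kähler identities and the equality of the two
Laplacians. Commutators with the algebra are bounded by the Leibniz rule.

Distinct P give inequivalent structures. A unitary commuting with the algebra that conjugates ∂ to ∂
also conjugates its commutators with the U_j, hence the coefficient matrices; doing this for ∂ and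
∂̄ and adding, it commutes with every A_j, hence with every a(v), so the coefficient matrices agree
(`eq_of_unitarilyEquiv`). For n ≥ 4 a curve of unit imaginary quaternions supplies infinitely many
P, more than the required number; for n ≤ 2 the product equals 1. -/

theorem mem_graph_add_iff {A B : H →ₗ.[ℂ] H} {x z : H} :
    (x, z) ∈ (A + B).graph ↔ ∃ y y', (x, y) ∈ A.graph ∧ (x, y') ∈ B.graph ∧ z = y + y' := by
  constructor
  · intro h
    obtain ⟨w, hw, hz⟩ := (LinearPMap.mem_graph_iff _).1 h
    dsimp at hw hz
    subst hw
    exact ⟨A ⟨w, w.2.1⟩, B ⟨w, w.2.2⟩, A.mem_graph ⟨w, w.2.1⟩, B.mem_graph ⟨w, w.2.2⟩, hz.symm⟩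
  · rintro ⟨y, y', h, h', rfl⟩
    obtain ⟨⟨w, hw⟩, hwx, rfl⟩ := (LinearPMap.mem_graph_iff _).1 h
    obtain ⟨⟨w', hw'⟩, hwx', rfl⟩ := (LinearPMap.mem_graph_iff _).1 h'
    dsimp at hwx hwx'
    subst hwx
    subst hwx'
    exact (LinearPMap.mem_graph_iff _).2 ⟨⟨w', hw, hw'⟩, rfl, rfl⟩

theorem mem_graph_pcomp_iff {A B : H →ₗ.[ℂ] H} {x z : H} :
    (x, z) ∈ (pcomp A B).graph ↔ ∃ y, (x, y) ∈ B.graph ∧ (y, z) ∈ A.graph := by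
  have key : ∀ w : (pcomp A B).domain, ∃ hB : (w : H) ∈ B.domain, ∃ hA : B ⟨w, hB⟩ ∈ A.domain,
      pcomp A B w = A ⟨B ⟨w, hB⟩, hA⟩ := by
    intro w
    obtain ⟨y, hy, hyw⟩ := w.2.1
    have hB : (w : H) ∈ B.domain := w.2.2
    have hyw' : y = ⟨w, hB⟩ := Subtype.ext hyw
    subst hyw'
    exact ⟨hB, hy, rfl⟩
  constructor
  · intro h
    obtain ⟨w, hw, hz⟩ := (LinearPMap.mem_graph_iff _).1 h
    dsimp at hw hz
    subst hw
    obtain ⟨hB, hA, e⟩ := key w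
    rw [e] at hz
    subst hz
    exact ⟨_, B.mem_graph ⟨w, hB⟩, A.mem_graph ⟨_, hA⟩⟩
  · rintro ⟨y, h, h'⟩
    obtain ⟨⟨w, hw⟩, hwx, rfl⟩ := (LinearPMap.mem_graph_iff _).1 h
    obtain ⟨⟨w', hw'⟩, hwx', rfl⟩ := (LinearPMap.mem_graph_iff _).1 h'
    dsimp at hwx hwx'
    subst hwx
    subst hwx'
    have hd : w ∈ (pcomp A B).domain := ⟨⟨⟨w, hw⟩, hw', rfl⟩, hw⟩
    obtain ⟨_, _, e⟩ := key ⟨w, hd⟩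
    exact (LinearPMap.mem_graph_iff _).2 ⟨⟨w, hd⟩, rfl, e⟩

theorem mem_graph_anticomm_iff {A B : H →ₗ.[ℂ] H} {x z : H} :
    (x, z) ∈ (anticomm A B).graph ↔ ∃ y w y' w', (x, y) ∈ B.graph ∧ (y, w) ∈ A.graph ∧
      (x, y') ∈ A.graph ∧ (y', w') ∈ B.graph ∧ z = w + w' := by
  simp only [anticomm, mem_graph_add_iff, mem_graph_pcomp_iff]
  constructor
  · rintro ⟨w, w', ⟨y, h1, h2⟩, ⟨y', h3, h4⟩, e⟩
    exact ⟨y, w, y', w', h1, h2, h3, h4, e⟩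
  · rintro ⟨y, w, y', w', h1, h2, h3, h4, e⟩
    exact ⟨w, w', ⟨y, h1, h2⟩, ⟨y', h3, h4⟩, e⟩

end GraphCalculus

/-! ### Maximal multiplication operators and their relations. -/

section Multipliers

universe u

variable {H : Type u} [NormedAddCommGroup H] [InnerProductSpace ℂ H] [CompleteSpace H]
variable {K W : Type*} [NormedAddCommGroup W] [InnerProductSpace ℂ W]
variable (F : H ≃ₗᵢ[ℂ] lp (fun _ : K => W) 2)

/-- The unbounded operator `A` is, in the decomposition `F` of the Hilbert space, the maximal
operator of multiplication by the family `M` of bounded operators. -/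
def IsMultiplier (A : H →ₗ.[ℂ] H) (M : K → W →L[ℂ] W) : Prop :=
  ∀ x y, (x, y) ∈ A.graph ↔ ∀ k, F y k = M k (F x k)

/-- The bounded operator `b` is multiplication by the family `M` in the decomposition `F`. -/
def IsBoundedMultiplier (b : H →L[ℂ] H) (M : K → W →L[ℂ] W) : Prop :=
  ∀ x k, F (b x) k = M k (F x k)

open Classical in
/-- The vector with the single nonzero component `w` at `k`. -/
def fiberVec (k : K) (w : W) : H := F.symm (lp.single 2 k w)

open Classical in
theorem fiberVec_apply (k : K) (w : W) (l : K) :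
    F (fiberVec F k w) l = if l = k then w else 0 := by
  rw [fiberVec, LinearIsometryEquiv.apply_symm_apply]
  split_ifs with h
  · subst h; exact lp.single_apply_self (E := fun _ : K => W) 2 l w
  · exact lp.single_apply_ne (E := fun _ : K => W) 2 k w h

theorem hasSum_fiberVec (x : H) : HasSum (fun k => fiberVec F k (F x k)) x := by
  classical
  have h := lp.hasSum_single (p := 2) (by norm_num) (F x)
  have h2 := (F.symm.toContinuousLinearEquiv.hasSum' (x := F x)).2 h
  simpa [fiberVec] using h2

theorem fiber_ext {x y : H} (h : ∀ k, F x k = F y k) : x = y :=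
  F.injective (lp.ext (funext h))

theorem inner_fiberVec_left (k : K) (w : W) (x : H) : ⟪fiberVec F k w, x⟫_ℂ = ⟪w, F x k⟫_ℂ := by
  classical
  rw [← F.inner_map_map, fiberVec, LinearIsometryEquiv.apply_symm_apply, lp.inner_single_left]

theorem continuous_fiber (k : K) : Continuous fun x : H => F x k :=
  (lp.evalCLM ℂ (fun _ : K => W) 2 k).continuous.comp F.continuous

variable {F}

/-- Every vector is the sum of its fibre components, so finite sums of fibre vectors approximate it.
All density claims below reduce to this. -/
theorem dense_of_fiberVec_mem {D : Submodule ℂ H} (h : ∀ k w, fiberVec F k w ∈ D) :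
    Dense (D : Set H) := by
  intro x
  exact mem_closure_of_tendsto (hasSum_fiberVec F x)
    (Filter.Eventually.of_forall fun s => D.sum_mem fun k _ => h k _)

namespace IsMultiplier

variable {A B : H →ₗ.[ℂ] H} {M N : K → W →L[ℂ] W}

theorem eq (hA : IsMultiplier F A M) (hB : IsMultiplier F B M) : A = B := by
  refine LinearPMap.eq_of_eq_graph ?_
  ext ⟨x, y⟩
  rw [hA, hB]

theorem congr (hA : IsMultiplier F A M) (h : ∀ k, M k = N k) : IsMultiplier F A N := by
  rwa [← (funext h : M = N)]

theorem fiberVec_mem (hA : IsMultiplier F A M) (k : K) (w : W) :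
    (fiberVec F k w, fiberVec F k (M k w)) ∈ A.graph := by
  rw [hA]
  intro l
  rw [fiberVec_apply, fiberVec_apply]
  split_ifs with h
  · rw [h]
  · rw [map_zero]

theorem isClosed (hA : IsMultiplier F A M) : A.IsClosed := by
  have : (A.graph : Set (H × H)) = ⋂ k, {p | F p.2 k = M k (F p.1 k)} := by
    ext ⟨x, y⟩
    simp [hA x y]
  rw [LinearPMap.IsClosed, this]
  exact isClosed_iInter fun k => isClosed_eq ((continuous_fiber F k).comp continuous_snd)
    ((M k).continuous.comp ((continuous_fiber F k).comp continuous_fst))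

theorem dense (hA : IsMultiplier F A M) : Dense (A.domain : Set H) :=
  dense_of_fiberVec_mem (F := F) fun k w =>
    LinearPMap.mem_domain_of_mem_graph (hA.fiberVec_mem k w)

theorem sqZero (hA : IsMultiplier F A M) (h : ∀ k, M k * M k = 0) : SqZero A := by
  intro x y hxy
  rw [hA] at hxy ⊢
  intro k
  rw [hxy k, ← mul_apply_eq_comp, h k, map_zero]
  rfl

theorem anticommZero (hA : IsMultiplier F A M) (hB : IsMultiplier F B N)
    (h : ∀ k, M k * N k + N k * M k = 0) : AnticommZero A B := by
  constructor
  · refine dense_of_fiberVec_mem (F := F) fun k w =>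
      LinearPMap.mem_domain_of_mem_graph (y := _) (mem_graph_anticomm_iff.2
        ⟨_, _, _, _, hB.fiberVec_mem k w, hA.fiberVec_mem k _, hA.fiberVec_mem k w,
          hB.fiberVec_mem k _, rfl⟩)
  · intro x
    obtain ⟨y, w, y', w', h1, h2, h3, h4, e⟩ :=
      mem_graph_anticomm_iff.1 ((anticomm A B).mem_graph x)
    rw [hA] at h2 h3
    rw [hB] at h1 h4
    rw [e]
    refine fiber_ext F fun k => ?_
    rw [map_add, map_zero, lp.coeFn_add, Pi.add_apply, h2, h1, h4, h3,
      ← mul_apply_eq_comp, ← mul_apply_eq_comp,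
      ← add_apply, h k]
    rfl

/-- Testing an element of the adjoint graph against a single fibre vector determines its component
there; conversely the fibrewise identities can be summed, because the inner product is the sum of
those of the fibres. No bound uniform in the fibre is needed. -/
theorem adjoint [CompleteSpace W] (hA : IsMultiplier F A M) :
    IsMultiplier F A.adjoint fun k => (M k).adjoint := by
  intro x y
  rw [LinearPMap.adjoint_graph_eq_graph_adjoint hA.dense, Submodule.mem_adjoint_iff]
  constructor
  · intro h k
    refine ext_inner_left ℂ fun w => ?_
    have h1 := h _ _ (hA.fiberVec_mem k w)
    dsimp at h1
    rw [inner_fiberVec_left, inner_fiberVec_left, sub_eq_zero] at h1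
    rw [ContinuousLinearMap.adjoint_inner_right, h1]
  · intro h a b hab
    rw [hA] at hab
    dsimp
    rw [sub_eq_zero, ← F.inner_map_map, ← F.inner_map_map a, lp.inner_eq_tsum, lp.inner_eq_tsum]
    refine tsum_congr fun k => ?_
    rw [hab, h, ContinuousLinearMap.adjoint_inner_right]

/-- An operator between the finitely supported part of a multiplier and the maximal multiplier
closes to the maximal one. -/
theorem of_closure (h1 : ∀ x y, (x, y) ∈ A.graph → ∀ k, F y k = M k (F x k))
    (h2 : ∀ k w, (fiberVec F k w, fiberVec F k (M k w)) ∈ A.graph) :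
    IsMultiplier F A.closure M := by
  have key : ∀ x y, (x, y) ∈ A.graph.topologicalClosure ↔ ∀ k, F y k = M k (F x k) := by
    intro x y
    constructor
    · intro h k
      have hc : IsClosed {p : H × H | F p.2 k = M k (F p.1 k)} :=
        isClosed_eq ((continuous_fiber F k).comp continuous_snd)
          ((M k).continuous.comp ((continuous_fiber F k).comp continuous_fst))
      exact closure_minimal (fun p hp => h1 p.1 p.2 hp k) hc h
    · intro h
      have hs := (hasSum_fiberVec F x).prodMk (hasSum_fiberVec F y)
      refine mem_closure_of_tendsto hs (Filter.Eventually.of_forall fun s =>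
        A.graph.sum_mem fun k _ => ?_)
      rw [h k]
      exact h2 k _
  -- Closability is needed because `closure` defaults to the operator itself for a non-closable
  -- operator.
  have hcl : A.IsClosable := by
    refine ⟨A.graph.topologicalClosure.toLinearPMap, ?_⟩
    rw [Submodule.toLinearPMap_graph_eq]
    rintro ⟨x, y⟩ hxy (rfl : x = 0)
    refine fiber_ext F fun k => ?_
    rw [(key _ _).1 hxy k, map_zero]
    simp
  intro x y
  rw [← hcl.graph_closure_eq_closure_graph, key]

/-- The intersection of the two domains may be smaller than the maximal domain for `M + N`, but it
contains every fibre vector, and this suffices after closing. -/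
theorem add_closure (hA : IsMultiplier F A M) (hB : IsMultiplier F B N) :
    IsMultiplier F (A + B).closure fun k => M k + N k := by
  refine of_closure ?_ ?_
  · intro x y h k
    obtain ⟨z, z', h1, h2, rfl⟩ := mem_graph_add_iff.1 h
    rw [map_add, lp.coeFn_add, Pi.add_apply, (hA _ _).1 h1, (hB _ _).1 h2]
    rfl
  · intro k w
    refine mem_graph_add_iff.2 ⟨_, _, hA.fiberVec_mem k w, hB.fiberVec_mem k w, ?_⟩
    classical
    rw [fiberVec, fiberVec, fiberVec, ← map_add, ← lp.single_add]
    rfl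

/-! ### Relations with bounded multipliers -/

variable {b : H →L[ℂ] H} {m : K → W →L[ℂ] W}

theorem commEqSelf (hA : IsMultiplier F A M) (hb : IsBoundedMultiplier F b m)
    (h : ∀ k, m k * M k = M k * m k + M k) : CommEqSelf b A := by
  intro x y hxy
  rw [hA] at hxy ⊢
  intro k
  rw [map_sub, lp.coeFn_sub, Pi.sub_apply, hb, hb, hxy k, ← mul_apply_eq_comp, h k]
  simp

theorem commZero (hA : IsMultiplier F A M) (hb : IsBoundedMultiplier F b m)
    (h : ∀ k, m k * M k = M k * m k) : CommZero b A := by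
  intro x y hxy
  rw [hA] at hxy ⊢
  intro k
  rw [hb, hb, hxy k, ← mul_apply_eq_comp, h k]
  rfl

theorem bddAnticommZero (hA : IsMultiplier F A M) (hb : IsBoundedMultiplier F b m)
    (h : ∀ k, m k * M k = -(M k * m k)) : BddAnticommZero b A := by
  intro x y hxy
  rw [hA] at hxy ⊢
  intro k
  rw [map_neg, lp.coeFn_neg, Pi.neg_apply, hb, hb, hxy k, ← mul_apply_eq_comp, h k]
  simp

/-- Injectivity of each `m k` makes the fibre conditions equivalent rather than merely implied, so
the domains correspond in both directions. -/
theorem hodgeRel (hA : IsMultiplier F A M) (hB : IsMultiplier F B N)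
    (hb : IsBoundedMultiplier F b m) (hinj : ∀ k, Function.Injective (m k)) {ζ : ℂ} (hζ : ζ ≠ 0)
    (h : ∀ k, m k * M k = ζ • (N k * m k)) : HodgeRel b ζ A B := by
  intro x y
  rw [hA, hB]
  refine forall_congr' fun k => ?_
  rw [map_smul, lp.coeFn_smul, Pi.smul_apply, hb, hb, inv_smul_eq_iff₀ hζ, ← (hinj k).eq_iff,
    ← mul_apply_eq_comp, h k]
  rfl

end IsMultiplier

/-! ### The Laplacian -/

theorem exists_fiber_eq {f : K → W} (x : H) (c : ℝ) (h : ∀ k, ‖f k‖ ≤ c * ‖F x k‖) :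
    ∃ y : H, ∀ k, F y k = f k := by
  have : Memℓp f 2 := by
    refine Memℓp.mono (g := fun k => c * ‖F x k‖) ?_ h
    exact ((lp.memℓp (F x)).norm).const_mul c
  exact ⟨F.symm ⟨f, this⟩, fun k => by rw [LinearIsometryEquiv.apply_symm_apply]⟩

theorem exists_fiber_eq_add {f : K → W} (x z : H) (h : ∀ k, ‖f k‖ ≤ ‖F x k‖ + ‖F z k‖) :
    ∃ y : H, ∀ k, F y k = f k := by
  have : Memℓp f 2 := by
    refine Memℓp.mono (g := fun k => ‖F x k‖ + ‖F z k‖) ?_ h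
    exact ((lp.memℓp (F x)).norm).add ((lp.memℓp (F z)).norm)
  exact ⟨F.symm ⟨f, this⟩, fun k => by rw [LinearIsometryEquiv.apply_symm_apply]⟩

/-- The issue is that the natural domain of AA* + A*A is already the whole maximal domain of λ.
Since M² = 0, the vectors MM*x and M*Mx are orthogonal, so each is dominated by their sum λx.
Moreover ‖Mx‖² = ⟪x, M*Mx⟫ ≤ ‖x‖ ‖M*Mx‖, and likewise for M*. Thus all intermediate fibre families
are square summable as soon as λx is. -/
theorem IsMultiplier.anticomm_adjoint [CompleteSpace W] {A : H →ₗ.[ℂ] H} {M : K → W →L[ℂ] W}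
    (hA : IsMultiplier F A M) (hsq : ∀ k, M k * M k = 0) {lam : K → ℝ}
    (hlam : ∀ k, M k * (M k).adjoint + (M k).adjoint * M k = (lam k : ℂ) • 1) :
    IsMultiplier F (anticomm A A.adjoint) fun k => (lam k : ℂ) • 1 := by
  have hA' := hA.adjoint
  have hsum : ∀ k w, M k ((M k).adjoint w) + (M k).adjoint (M k w) = (lam k : ℂ) • w := by
    intro k w
    have := congrArg (fun T : W →L[ℂ] W => T w) (hlam k)
    simpa using this
  intro x z
  rw [mem_graph_anticomm_iff]
  constructor
  · rintro ⟨y, w, y', w', h1, h2, h3, h4, rfl⟩ k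
    rw [hA] at h2 h3
    rw [hA'] at h1 h4
    rw [map_add, lp.coeFn_add, Pi.add_apply, h2, h1, h4, h3, hsum]
    simp
  · intro h
    have h' : ∀ k, F z k = (lam k : ℂ) • F x k := fun k => by rw [h k]; simp
    have horth : ∀ k w, ⟪M k ((M k).adjoint w), (M k).adjoint (M k w)⟫_ℂ = 0 := by
      intro k w
      rw [ContinuousLinearMap.adjoint_inner_right, ← mul_apply_eq_comp, hsq k]
      simp
    have hle1 : ∀ k, ‖M k ((M k).adjoint (F x k))‖ ≤ 1 * ‖F z k‖ := by
      intro k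
      have := norm_add_sq_eq_norm_sq_add_norm_sq_of_inner_eq_zero _ _ (horth k (F x k))
      rw [hsum, ← h' k] at this
      rw [one_mul]
      refine abs_le_of_sq_le_sq' ?_ (norm_nonneg _) |>.2
      nlinarith [norm_nonneg ((M k).adjoint (M k (F x k)))]
    have hle2 : ∀ k, ‖(M k).adjoint (M k (F x k))‖ ≤ 1 * ‖F z k‖ := by
      intro k
      have := norm_add_sq_eq_norm_sq_add_norm_sq_of_inner_eq_zero _ _ (horth k (F x k))
      rw [hsum, ← h' k] at this
      rw [one_mul]
      refine abs_le_of_sq_le_sq' ?_ (norm_nonneg _) |>.2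
      nlinarith [norm_nonneg (M k ((M k).adjoint (F x k)))]
    have hM : ∀ k, ‖M k (F x k)‖ ^ 2 ≤ ‖F x k‖ * ‖(M k).adjoint (M k (F x k))‖ := by
      intro k
      have := norm_inner_le_norm (𝕜 := ℂ) (F x k) ((M k).adjoint (M k (F x k)))
      rw [ContinuousLinearMap.adjoint_inner_right, inner_self_eq_norm_sq_to_K] at this
      simpa using this
    have hM' : ∀ k, ‖(M k).adjoint (F x k)‖ ^ 2 ≤ ‖F x k‖ * ‖M k ((M k).adjoint (F x k))‖ := by
      intro k
      have := norm_inner_le_norm (𝕜 := ℂ) (F x k) (M k ((M k).adjoint (F x k)))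
      rw [← ContinuousLinearMap.adjoint_inner_left, inner_self_eq_norm_sq_to_K] at this
      simpa using this
    obtain ⟨w, hw⟩ := exists_fiber_eq z 1 hle1
    obtain ⟨w', hw'⟩ := exists_fiber_eq z 1 hle2
    -- For nonnegative s and t, st ≤ (s + t)², so the geometric-mean bound `hM` yields ‖Mx‖ ≤ ‖x‖ +
    -- ‖M*Mx‖ in each fibre.
    obtain ⟨y', hy'⟩ := exists_fiber_eq_add (f := fun k => M k (F x k)) x w' (by
      intro k
      rw [hw' k]
      refine abs_le_of_sq_le_sq' ?_ (by positivity) |>.2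
      nlinarith [hM k, norm_nonneg (F x k), norm_nonneg ((M k).adjoint (M k (F x k)))])
    obtain ⟨y, hy⟩ := exists_fiber_eq_add (f := fun k => (M k).adjoint (F x k)) x w (by
      intro k
      rw [hw k]
      refine abs_le_of_sq_le_sq' ?_ (by positivity) |>.2
      nlinarith [hM' k, norm_nonneg (F x k), norm_nonneg (M k ((M k).adjoint (F x k)))])
    refine ⟨y, w, y', w', (hA' _ _).2 hy, (hA _ _).2 fun k => ?_, (hA _ _).2 hy',
      (hA' _ _).2 fun k => ?_, fiber_ext F fun k => ?_⟩
    · rw [hw, hy]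
    · rw [hw', hy']
    · rw [map_add, lp.coeFn_add, Pi.add_apply, hw, hw', hsum, h']

end Multipliers

/-! ### The heat semigroup of a nonnegative multiplier. -/

section Semigroup

universe u

variable {H : Type u} [NormedAddCommGroup H] [InnerProductSpace ℂ H] [CompleteSpace H]
variable {K W : Type*} [NormedAddCommGroup W] [InnerProductSpace ℂ W]
variable (F : H ≃ₗᵢ[ℂ] lp (fun _ : K => W) 2)

/-- The operator of multiplication by a family of scalars bounded by one. -/
def scalarMul (c : K → ℂ) (hc : ∀ k, ‖c k‖ ≤ 1) : H →L[ℂ] H :=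
  LinearMap.mkContinuous
    { toFun := fun x => F.symm ⟨fun k => c k • F x k,
        Memℓp.mono (lp.memℓp (F x)).norm fun k => by
          rw [norm_smul]
          exact mul_le_of_le_one_left (norm_nonneg _) (hc k)⟩
      map_add' := fun x y => F.injective <| lp.ext <| funext fun k => by simp; rfl
      map_smul' := fun a x => F.injective <| lp.ext <| funext fun k => by
        simp [smul_comm a (c k)] } 1 fun x => by
    rw [one_mul]
    simp only [LinearMap.coe_mk, AddHom.coe_mk, LinearIsometryEquiv.norm_map]
    rw [← F.norm_map x]
    refine lp.norm_mono (by norm_num) fun k => ?_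
    rw [norm_smul]
    exact mul_le_of_le_one_left (norm_nonneg _) (hc k)

theorem scalarMul_apply (c : K → ℂ) (hc : ∀ k, ‖c k‖ ≤ 1) (x : H) (k : K) :
    F (scalarMul F c hc x) k = c k • F x k := by
  simp [scalarMul]

/-- Replacing t by `max t 0` keeps the factor at most one for every real t, so that the semigroup
can be defined on all of ℝ. -/
theorem norm_exp_neg_mul_le {l : ℝ} (hl : 0 ≤ l) (t : ℝ) :
    ‖(Real.exp (-(max t 0 * l)) : ℂ)‖ ≤ 1 := by
  rw [Complex.norm_real, Real.norm_eq_abs, Real.abs_exp, Real.exp_le_one_iff]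
  have := mul_nonneg (le_max_right t 0) hl
  linarith

/-- The semigroup `exp (-t λ)` of multiplication operators (constant for negative `t`). -/
def heatSemigroup (lam : K → ℝ) (h : ∀ k, 0 ≤ lam k) (t : ℝ) : H →L[ℂ] H :=
  scalarMul F (fun k => (Real.exp (-(max t 0 * lam k)) : ℂ)) fun k => norm_exp_neg_mul_le (h k) t

variable {F}

theorem heatSemigroup_apply {lam : K → ℝ} (h : ∀ k, 0 ≤ lam k) {t : ℝ} (ht : 0 ≤ t) (x : H)
    (k : K) : F (heatSemigroup F lam h t x) k = (Real.exp (-(t * lam k)) : ℂ) • F x k := by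
  rw [heatSemigroup, scalarMul_apply, max_eq_left ht]

/-- Dominated convergence for the components of vectors. -/
theorem tendsto_of_fiber_dominated {T : Type*} {l : Filter T} [l.IsCountablyGenerated] (f : T → H) (y : H)
    (x : H) (hb : ∀ᶠ t in l, ∀ k, ‖F (f t) k - F y k‖ ≤ ‖F x k‖)
    (hlim : ∀ k, Filter.Tendsto (fun t => F (f t) k) l (𝓝 (F y k))) :
    Filter.Tendsto f l (𝓝 y) := by
  rw [tendsto_iff_norm_sub_tendsto_zero]
  have h2 : ∀ z : H, ‖z‖ ^ 2 = ∑' k, ‖F z k‖ ^ 2 := by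
    intro z
    have := lp.norm_rpow_eq_tsum (p := 2) (by norm_num) (F z)
    rw [F.norm_map] at this
    simpa using this
  have hs : Summable fun k => ‖F x k‖ ^ 2 := by
    have := (lp.memℓp (F x)).summable (by norm_num)
    simpa using this
  have key : Filter.Tendsto (fun t => ‖f t - y‖ ^ 2) l (𝓝 0) := by
    simp only [h2]
    have := tendsto_tsum_of_dominated_convergence (𝓕 := l)
      (f := fun t k => ‖F (f t - y) k‖ ^ 2) (g := fun _ => 0) hs ?_ ?_
    · simpa using this
    · intro k
      have h3 := ((hlim k).sub_const (F y k)).norm.pow 2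
      simpa using h3
    · filter_upwards [hb] with t ht k
      rw [map_sub, lp.coeFn_sub, Pi.sub_apply, Real.norm_of_nonneg (by positivity)]
      gcongr
      exact ht k
  have := key.sqrt
  simpa [Real.sqrt_sq (norm_nonneg _)] using this

/-- Divided by t, with s = tλ, this bounds the error of the difference quotient by λ uniformly in t,
the domination needed to identify the generator. -/
theorem norm_exp_neg_sub_one_le {s : ℝ} (hs : 0 ≤ s) : |Real.exp (-s) - 1 + s| ≤ s := by
  rw [abs_le]
  constructor
  · have := Real.add_one_le_exp (-s)
    linarith
  · have := Real.exp_le_one_iff.2 (neg_nonpos.2 hs)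
    linarith

theorem tendsto_exp_difference_quotient (l : ℝ) :
    Filter.Tendsto (fun t : ℝ => t⁻¹ * (Real.exp (-(t * l)) - 1)) (𝓝[>] 0) (𝓝 (-l)) := by
  have h : HasDerivAt (fun t : ℝ => Real.exp (-(t * l))) (-l) 0 := by
    have := (((hasDerivAt_id (0 : ℝ)).mul_const l).neg).exp
    simpa using this
  have h2 := h.tendsto_slope_zero_right
  simpa using h2

theorem IsMultiplier.isExpNeg {A : H →ₗ.[ℂ] H} {lam : K → ℝ} (h : ∀ k, 0 ≤ lam k)
    (hA : IsMultiplier F A fun k => (lam k : ℂ) • 1) : IsExpNeg A (heatSemigroup F lam h) where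
  zero := by
    ext x
    refine fiber_ext F fun k => ?_
    simp [heatSemigroup_apply h le_rfl]
  add s t hs ht := by
    ext x
    refine fiber_ext F fun k => ?_
    rw [mul_apply_eq_comp, heatSemigroup_apply h (add_nonneg hs ht),
      heatSemigroup_apply h hs, heatSemigroup_apply h ht, smul_smul, ← Complex.ofReal_mul,
      ← Real.exp_add]
    congr 3
    ring
  cont x t ht := by
    -- Two contractive factors differ by at most 2, hence the dominating vector 2x.
    refine tendsto_of_fiber_dominated (F := F) _ _ ((2 : ℂ) • x) ?_ ?_
    · filter_upwards [self_mem_nhdsWithin] with s hs k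
      rw [heatSemigroup_apply h hs, heatSemigroup_apply h ht, ← sub_smul, norm_smul, map_smul,
        lp.coeFn_smul, Pi.smul_apply, norm_smul]
      gcongr
      have h1 := norm_exp_neg_mul_le (h k) s
      have h2 := norm_exp_neg_mul_le (h k) t
      rw [max_eq_left (Set.mem_Ici.1 hs)] at h1
      rw [max_eq_left (Set.mem_Ici.1 ht)] at h2
      refine (norm_sub_le _ _).trans ?_
      rw [RCLike.norm_ofNat]
      linarith
    · intro k
      rw [heatSemigroup_apply h ht]
      have hc : Continuous fun s : ℝ => (Real.exp (-(s * lam k)) : ℂ) • F x k := by fun_prop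
      refine (hc.continuousWithinAt (s := Set.Ici 0) (x := t)).tendsto.congr' ?_
      filter_upwards [self_mem_nhdsWithin] with s hs
      rw [heatSemigroup_apply h hs]
  gen x y := by
    have hlim : ∀ k, Filter.Tendsto (fun t : ℝ => F (((t⁻¹ : ℝ) : ℂ) •
        (heatSemigroup F lam h t x - x)) k) (𝓝[>] 0) (𝓝 (((-lam k : ℝ) : ℂ) • F x k)) := by
      intro k
      have h1 := (Complex.continuous_ofReal.tendsto _).comp (tendsto_exp_difference_quotient (lam k))
      refine (h1.smul_const (F x k)).congr' ?_
      filter_upwards [self_mem_nhdsWithin] with t ht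
      rw [map_smul, map_sub, lp.coeFn_smul, Pi.smul_apply, lp.coeFn_sub, Pi.sub_apply,
        heatSemigroup_apply h (Set.mem_Ioi.1 ht).le]
      simp only [Function.comp, Complex.ofReal_mul, Complex.ofReal_sub, Complex.ofReal_one,
        mul_smul, sub_smul, one_smul]
    rw [hA]
    constructor
    · intro hxy
      -- The dominating vector is y itself, whose components have norm λ‖x_k‖.
      refine tendsto_of_fiber_dominated (F := F) _ _ y ?_ ?_
      · filter_upwards [self_mem_nhdsWithin] with t ht k
        have ht' : (0 : ℝ) < t := ht
        rw [map_smul, map_sub, lp.coeFn_smul, Pi.smul_apply, lp.coeFn_sub, Pi.sub_apply,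
          heatSemigroup_apply h ht'.le, map_neg, lp.coeFn_neg, Pi.neg_apply, hxy k]
        have e : ((t⁻¹ : ℝ) : ℂ) • ((Real.exp (-(t * lam k)) : ℂ) • F x k - F x k) -
            -(((lam k : ℂ) • (1 : W →L[ℂ] W)) (F x k)) =
            ((t⁻¹ * (Real.exp (-(t * lam k)) - 1 + t * lam k) : ℝ) : ℂ) • F x k := by
          have : t⁻¹ * (Real.exp (-(t * lam k)) - 1 + t * lam k) =
            t⁻¹ * (Real.exp (-(t * lam k)) - 1) + lam k := by field_simp
          rw [this]
          simp only [Complex.ofReal_mul, Complex.ofReal_sub, Complex.ofReal_one, Complex.ofReal_add,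
            mul_smul, sub_smul, one_smul, add_smul, smul_apply, one_apply_eq_self, sub_neg_eq_add]
        rw [e, norm_smul, smul_apply, norm_smul, Complex.norm_real, Complex.norm_real]
        simp only [one_apply_eq_self]
        gcongr
        rw [norm_mul, Real.norm_eq_abs, Real.norm_eq_abs, Real.norm_eq_abs, abs_inv, abs_of_pos ht',
          abs_of_nonneg (h k)]
        have := norm_exp_neg_sub_one_le (mul_nonneg ht'.le (h k))
        rw [inv_mul_le_iff₀ ht']
        exact this
      · intro k
        convert hlim k using 2
        rw [map_neg, lp.coeFn_neg, Pi.neg_apply, hxy k]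
        simp
    · intro hxy k
      -- Conversely, norm convergence of the difference quotients forces fibrewise convergence, and
      -- there the limit is known to be -λx.
      have h1 := ((continuous_fiber F k).tendsto _).comp hxy
      have h2 := tendsto_nhds_unique h1 (hlim k)
      rw [map_neg, lp.coeFn_neg, Pi.neg_apply] at h2
      rw [← neg_inj, h2]
      simp

theorem heatSemigroup_isPositive {lam : K → ℝ} (h : ∀ k, 0 ≤ lam k) {t : ℝ} (ht : 0 ≤ t) :
    (heatSemigroup F lam h t).IsPositive := by
  rw [ContinuousLinearMap.isPositive_iff_complex]
  intro x
  have : ⟪heatSemigroup F lam h t x, x⟫_ℂ =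
      ((∑' k, Real.exp (-(t * lam k)) * ‖F x k‖ ^ 2 : ℝ) : ℂ) := by
    rw [← F.inner_map_map, lp.inner_eq_tsum, Complex.ofReal_tsum]
    refine tsum_congr fun k => ?_
    rw [heatSemigroup_apply h ht, inner_smul_left, Complex.conj_ofReal,
      inner_self_eq_norm_sq_to_K]
    simp
  rw [this]
  refine ⟨by simp, ?_⟩
  simp only [RCLike.re_to_complex, Complex.ofReal_re]
  exact tsum_nonneg fun k => by positivity

end Semigroup

/-! ### Trace class heat operators. -/

section TraceClass

universe u

variable {H : Type u} [NormedAddCommGroup H] [InnerProductSpace ℂ H] [CompleteSpace H]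
variable {K ι : Type} [Fintype ι]
variable {F : H ≃ₗᵢ[ℂ] lp (fun _ : K => EuclideanSpace ℂ ι) 2}

variable (F) in
/-- The orthonormal basis of a Hilbert space adapted to a decomposition into copies of `ℂ^ι`. -/
theorem exists_fiber_hilbertBasis : ∃ b : HilbertBasis (ULift.{u} (K × ι)) ℂ H,
    ∀ p, b p = fiberVec F p.down.1 (EuclideanSpace.basisFun ι ℂ p.down.2) := by
  classical
  -- The lift puts the index set into the universe of H, where `IsTraceClass` requires it.
  have ho : Orthonormal ℂ fun p : ULift.{u} (K × ι) =>
      fiberVec F p.down.1 (EuclideanSpace.basisFun ι ℂ p.down.2) := by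
    rw [orthonormal_iff_ite]
    rintro ⟨k, s⟩ ⟨l, t⟩
    dsimp only
    rw [inner_fiberVec_left, fiberVec_apply]
    by_cases hkl : k = l
    · subst hkl
      rw [if_pos rfl, orthonormal_iff_ite.1 (EuclideanSpace.basisFun ι ℂ).orthonormal s t]
      by_cases hst : s = t <;> simp [hst]
    · rw [if_neg hkl, inner_zero_right, if_neg (by simp [hkl])]
  refine ⟨HilbertBasis.mkOfOrthogonalEqBot ho ?_, fun p => by
    rw [HilbertBasis.coe_mkOfOrthogonalEqBot]⟩
  rw [Submodule.eq_bot_iff]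
  intro x hx
  refine fiber_ext F fun k => ?_
  refine PiLp.ext fun s => ?_
  have := (Submodule.mem_orthogonal _ _).1 hx _ (Submodule.subset_span ⟨⟨(k, s)⟩, rfl⟩)
  rw [inner_fiberVec_left] at this
  simpa [EuclideanSpace.inner_single_left] using this

theorem isTraceClass_of_isPositive {S : H →L[ℂ] H} (hS : S.IsPositive) {κ : Type u}
    (b : HilbertBasis κ ℂ H) (h : Summable fun i => (⟪b i, S (b i)⟫_ℂ).re) : IsTraceClass S := by
  refine ⟨κ, b, ?_⟩
  rw [CFC.abs_of_nonneg S ((ContinuousLinearMap.nonneg_iff_isPositive _).2 hS)]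
  exact h

/-- The heat operator is positive, hence equal to its absolute value, and diagonal in the adapted
basis: exp(-ελ_k) occurs once for each element of `ι`. Finiteness of `ι` reduces the trace to the
scalar sum. -/
theorem IsMultiplier.expTraceClass {A : H →ₗ.[ℂ] H} {lam : K → ℝ} (h : ∀ k, 0 ≤ lam k)
    (hA : IsMultiplier F A fun k => (lam k : ℂ) • 1)
    (hs : ∀ ε, 0 < ε → Summable fun k => Real.exp (-(ε * lam k))) : ExpTraceClass A := by
  refine ⟨heatSemigroup F lam h, hA.isExpNeg h, fun ε hε => ?_⟩
  obtain ⟨b, hb⟩ := exists_fiber_hilbertBasis F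
  refine isTraceClass_of_isPositive (heatSemigroup_isPositive h hε.le) b ?_
  have e : ∀ p : ULift.{u} (K × ι), (⟪b p, heatSemigroup F lam h ε (b p)⟫_ℂ).re =
      Real.exp (-(ε * lam p.down.1)) := by
    intro p
    rw [hb, inner_fiberVec_left, heatSemigroup_apply h hε.le, fiberVec_apply, if_pos rfl,
      inner_smul_right, inner_self_eq_norm_sq_to_K]
    simp
    rw [← Complex.ofReal_mul, ← Complex.ofReal_neg, ← Complex.ofReal_exp, Complex.ofReal_re]
  simp only [e]
  have h1 : Summable fun p : K × ι => Real.exp (-(ε * lam p.1)) := by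
    refine (summable_prod_of_nonneg fun p => (Real.exp_pos _).le).2
      ⟨fun k => Summable.of_finite, ?_⟩
    simp only [tsum_fintype, Finset.sum_const, nsmul_eq_mul]
    exact (hs ε hε).mul_left _
  exact (Equiv.ulift.summable_iff (f := fun p : K × ι => Real.exp (-(ε * lam p.1)))).2 h1

end TraceClass

/-! ### Gaussian sums over the lattice. -/

section Lattice

/-- A finite set of exponents lies in the box of its coordinate projections, and over a box the sum
of products factors. This bounds all partial sums by one constant. -/
theorem summable_prod_of_summable {n : ℕ} {α : Type*} [DecidableEq α] {f : α → ℝ} (hf : Summable f)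
    (h0 : ∀ a, 0 ≤ f a) : Summable fun k : Fin n → α => ∏ j, f (k j) := by
  refine summable_of_sum_le (c := ∏ _j : Fin n, ∑' a, f a)
    (fun k => Finset.prod_nonneg fun j _ => h0 _) fun s => ?_
  calc ∑ k ∈ s, ∏ j, f (k j)
      ≤ ∑ k ∈ Fintype.piFinset fun j => s.image fun k => k j, ∏ j, f (k j) := by
        refine Finset.sum_le_sum_of_subset_of_nonneg (fun k hk => ?_)
          fun k _ _ => Finset.prod_nonneg fun j _ => h0 _
        exact Fintype.mem_piFinset.2 fun j => Finset.mem_image_of_mem _ hk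
    _ = ∏ j : Fin n, ∑ a ∈ s.image fun k => k j, f a := by
        rw [Finset.prod_univ_sum]
    _ ≤ _ := Finset.prod_le_prod (fun j _ => Finset.sum_nonneg fun a _ => h0 a)
        fun j _ => hf.sum_le_tsum _ fun a _ => h0 a

theorem summable_exp_neg_mul_int_sq {ε : ℝ} (hε : 0 < ε) :
    Summable fun k : ℤ => Real.exp (-(ε * (k : ℝ) ^ 2)) := by
  have hnat : Summable fun k : ℕ => Real.exp (-(ε * (k : ℝ) ^ 2)) := by
    refine Summable.of_nonneg_of_le (fun _ => (Real.exp_pos _).le) (fun k => ?_)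
      (Real.summable_exp_nat_mul_iff.2 (neg_lt_zero.2 hε))
    rw [Real.exp_le_exp]
    have : (k : ℝ) ≤ (k : ℝ) ^ 2 := by
      rcases Nat.eq_zero_or_pos k with rfl | hk
      · simp
      · have : (1 : ℝ) ≤ k := by exact_mod_cast hk
        nlinarith
    nlinarith
  refine Summable.of_nat_of_neg ?_ ?_
  · simpa using hnat
  · simpa using hnat

theorem summable_exp_neg_mul_sq_norm {n : ℕ} {ε : ℝ} (hε : 0 < ε) :
    Summable fun k : Fin n → ℤ => Real.exp (-(ε * ∑ j, (k j : ℝ) ^ 2)) := by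
  have := summable_prod_of_summable (n := n) (summable_exp_neg_mul_int_sq hε)
    fun _ => (Real.exp_pos _).le
  refine this.congr fun k => ?_
  rw [Finset.mul_sum, ← Finset.sum_neg_distrib, Real.exp_sum]

end Lattice

/-! ### Monomials in the generators and their span. -/

section Monomials

/-- The subgroup of scalar unitaries. -/
def scalarUnitaries (A : Type*) [CStarAlgebra A] : Subgroup (unitary A) where
  carrier := {g | ∃ c : ℂ, (g : A) = c • 1}
  one_mem' := ⟨1, by simp⟩
  mul_mem' := by
    rintro g h ⟨c, hc⟩ ⟨d, hd⟩
    exact ⟨c * d, by rw [Submonoid.coe_mul, hc, hd, smul_mul_smul_comm, one_mul]⟩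
  inv_mem' := by
    rintro g ⟨c, hc⟩
    exact ⟨star c, by rw [← Unitary.star_eq_inv, Unitary.coe_star, hc, star_smul, star_one]⟩

instance (A : Type*) [CStarAlgebra A] : (scalarUnitaries A).Normal where
  conj_mem := by
    rintro g ⟨c, hc⟩ h
    refine ⟨c, ?_⟩
    rw [Submonoid.coe_mul, Submonoid.coe_mul, hc, mul_smul_comm, smul_mul_assoc, mul_one,
      ← Submonoid.coe_mul, mul_inv_cancel, Submonoid.coe_one]

theorem mk_scalarUnitaries_eq {A : Type*} [CStarAlgebra A] {g h : unitary A} :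
    (g : unitary A ⧸ scalarUnitaries A) = h ↔ ∃ c : ℂ, (g : A) = c • (h : A) := by
  rw [eq_comm, QuotientGroup.eq]
  constructor
  · rintro ⟨c, hc⟩
    refine ⟨c, ?_⟩
    have : (g : A) = (h : A) * ((h⁻¹ * g : unitary A) : A) := by
      rw [← Submonoid.coe_mul, mul_inv_cancel_left]
    rw [this, hc, mul_smul_comm, mul_one]
  · rintro ⟨c, hc⟩
    refine ⟨c, ?_⟩
    rw [Submonoid.coe_mul, hc, mul_smul_comm, ← Submonoid.coe_mul, inv_mul_cancel,
      Submonoid.coe_one]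

variable {n : ℕ} {Θ : Matrix (Fin n) (Fin n) ℝ}

theorem exists_zpow_family_of_commute {G : Type*} [Group G] (q : Fin n → G)
    (hq : ∀ i j, Commute (q i) (q j)) : ∃ ψ : (Fin n → ℤ) → G, ψ 0 = 1 ∧
      (∀ k l, ψ (k + l) = ψ k * ψ l) ∧ ∀ j, ψ (Pi.single j 1) = q j := by
  have hcomm : Pairwise fun i j => ∀ x y, Commute (zpowersHom G (q i) x) (zpowersHom G (q j) y) :=
    fun i j _ x y => (hq i j).zpow_zpow (Multiplicative.toAdd x) (Multiplicative.toAdd y)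
  refine ⟨fun k => MonoidHom.noncommPiCoprod _ hcomm fun j => .ofAdd (k j), map_one _,
    fun k l => ?_, fun j => ?_⟩
  · rw [← map_mul]
    rfl
  · have e : (fun i => Multiplicative.ofAdd ((Pi.single j 1 : Fin n → ℤ) i)) =
        Pi.mulSingle j (Multiplicative.ofAdd 1) := by
      funext i
      by_cases hi : i = j
      · subst hi; simp
      · simp [hi]
    dsimp only
    rw [e, MonoidHom.noncommPiCoprod_mulSingle, zpowersHom_apply, toAdd_ofAdd, zpow_one]

/-- Modulo scalar unitaries the generators commute, so they define a homomorphism from ℤⁿ; lifting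
it gives monomials up to unspecified phases. No later argument needs these phases, which avoids
fixing an ordering and a cocycle. -/
theorem exists_monomials_of_isTorusFamily {A : Type*} [CStarAlgebra A] {V : Fin n → A}
    (hV : IsTorusFamily Θ V) : ∃ u : (Fin n → ℤ) → unitary A, u 0 = 1 ∧
      (∀ k l, ∃ c : ℂ, (u k * u l : A) = c • (u (k + l) : A)) ∧
      ∀ j, ∃ c : ℂ, (u (Pi.single j 1) : A) = c • V j := by
  classical
  let q : Fin n → unitary A ⧸ scalarUnitaries A := fun j => ((⟨V j, hV.unitary j⟩ : unitary A) :)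
  have hq : ∀ i j, Commute (q i) (q j) := by
    intro i j
    change ((⟨V i, hV.unitary i⟩ * ⟨V j, hV.unitary j⟩ : unitary A) :
      unitary A ⧸ scalarUnitaries A) = ((⟨V j, hV.unitary j⟩ * ⟨V i, hV.unitary i⟩ : unitary A) :)
    rw [mk_scalarUnitaries_eq]
    exact ⟨_, hV.rel i j⟩
  obtain ⟨ψ, hψ0, hψ, hψ1⟩ := exists_zpow_family_of_commute q hq
  -- The representative at 0 is normalised to be exactly 1, so that the trace of the zeroth monomial
  -- is 1.
  let u : (Fin n → ℤ) → unitary A := fun k => if k = 0 then 1 else (ψ k).out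
  have hu : ∀ k, (u k : unitary A ⧸ scalarUnitaries A) = ψ k := by
    intro k
    by_cases hk : k = 0
    · subst hk
      simp only [u, if_true]
      exact hψ0.symm
    · simp only [u, if_neg hk]
      exact Quotient.out_eq _
  refine ⟨u, by simp [u], fun k l => ?_, fun j => ?_⟩
  · have : ((u k * u l : unitary A) : unitary A ⧸ scalarUnitaries A) = u (k + l) := by
      rw [QuotientGroup.mk_mul, hu, hu, hu, hψ]
    exact mk_scalarUnitaries_eq.1 this
  · have : (u (Pi.single j 1) : unitary A ⧸ scalarUnitaries A) =
        ((⟨V j, hV.unitary j⟩ : unitary A) :) := by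
      rw [hu, hψ1]
    exact mk_scalarUnitaries_eq.1 this

theorem addSubgroup_eq_top_of_single_mem {S : AddSubgroup (Fin n → ℤ)}
    (h : ∀ j, Pi.single j 1 ∈ S) : S = ⊤ := by
  rw [eq_top_iff]
  intro k _
  rw [← Finset.univ_sum_single k]
  refine S.sum_mem fun j _ => ?_
  have : (Pi.single j (k j) : Fin n → ℤ) = k j • Pi.single j 1 := by
    rw [← Pi.single_smul]
    simp
  rw [this]
  exact S.zsmul_mem (h j) _

/-- The character `z ↦ z^k` of the torus group. -/
def torusChar (k : Fin n → ℤ) (z : Fin n → Circle) : ℂ := ∏ j, (z j : ℂ) ^ k j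

theorem torusChar_zero (z : Fin n → Circle) : torusChar 0 z = 1 := by simp [torusChar]

theorem torusChar_add (k l : Fin n → ℤ) (z : Fin n → Circle) :
    torusChar (k + l) z = torusChar k z * torusChar l z := by
  rw [torusChar, torusChar, torusChar, ← Finset.prod_mul_distrib]
  exact Finset.prod_congr rfl fun j _ => zpow_add₀ (Circle.coe_ne_zero _) _ _

theorem torusChar_single (j : Fin n) (z : Fin n → Circle) :
    torusChar (Pi.single j 1) z = z j := by
  rw [torusChar, Finset.prod_eq_single j]
  · simp
  · intro i _ hi
    simp [hi]
  · simp

theorem norm_torusChar (k : Fin n → ℤ) (z : Fin n → Circle) : ‖torusChar k z‖ = 1 := by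
  simp [torusChar, norm_prod, norm_zpow, Circle.norm_coe]

theorem star_torusChar (k : Fin n → ℤ) (z : Fin n → Circle) :
    star (torusChar k z) = torusChar (-k) z := by
  have h1 : torusChar k z * torusChar (-k) z = 1 := by
    rw [← torusChar_add, add_neg_cancel, torusChar_zero]
  have h2 : torusChar k z * star (torusChar k z) = 1 := by
    rw [RCLike.star_def, Complex.mul_conj']
    simp [norm_torusChar]
  exact mul_left_cancel₀ (left_ne_zero_of_mul_eq_one h1) (h2.trans h1.symm)

theorem torusChar_mulSingle_exp (k : Fin n → ℤ) (j : Fin n) (s : ℝ) :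
    torusChar k (Pi.mulSingle j (Circle.exp s)) = Complex.exp (Complex.I * k j * s) := by
  rw [torusChar, Finset.prod_eq_single j]
  · rw [Pi.mulSingle_eq_same, Circle.coe_exp, ← Complex.exp_int_mul]
    congr 1
    ring
  · intro i _ hi
    simp [hi]
  · simp

theorem torusChar_exp (k : Fin n → ℤ) (t : Fin n → ℝ) :
    torusChar k (fun j => Circle.exp (t j)) = Complex.exp (∑ j, Complex.I * k j * t j) := by
  rw [torusChar, Complex.exp_sum]
  refine Finset.prod_congr rfl fun j _ => ?_
  rw [Circle.coe_exp, ← Complex.exp_int_mul]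
  congr 1
  ring

variable (Θ) in
/-- A choice of monomials in the generators, one for each exponent. -/
def torusMonomial : (Fin n → ℤ) → unitary (NCTorus Θ) :=
  (exists_monomials_of_isTorusFamily (torusGen_isTorusFamily (Θ := Θ))).choose

theorem torusMonomial_zero : torusMonomial Θ 0 = 1 :=
  (exists_monomials_of_isTorusFamily (torusGen_isTorusFamily (Θ := Θ))).choose_spec.1

theorem torusMonomial_mul (k l : Fin n → ℤ) :
    ∃ c : ℂ, (torusMonomial Θ k * torusMonomial Θ l : NCTorus Θ) =
      c • (torusMonomial Θ (k + l) : NCTorus Θ) :=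
  (exists_monomials_of_isTorusFamily (torusGen_isTorusFamily (Θ := Θ))).choose_spec.2.1 k l

theorem torusMonomial_single (j : Fin n) :
    ∃ c : ℂ, (torusMonomial Θ (Pi.single j 1) : NCTorus Θ) = c • torusGen j :=
  (exists_monomials_of_isTorusFamily (torusGen_isTorusFamily (Θ := Θ))).choose_spec.2.2 j

theorem star_torusMonomial (k : Fin n → ℤ) : ∃ c : ℂ,
    star (torusMonomial Θ k : NCTorus Θ) = c • (torusMonomial Θ (-k) : NCTorus Θ) := by
  obtain ⟨c, hc⟩ := torusMonomial_mul (Θ := Θ) k (-k)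
  rw [add_neg_cancel, torusMonomial_zero, Submonoid.coe_one] at hc
  have h1 := congrArg (fun x => star (torusMonomial Θ k : NCTorus Θ) * x) hc
  simp only [← mul_assoc, Unitary.coe_star_mul_self, one_mul, mul_smul_comm, mul_one] at h1
  have hu : star (torusMonomial Θ k : NCTorus Θ) * torusMonomial Θ k = 1 :=
    Unitary.coe_star_mul_self _
  -- A vanishing phase can occur only in the zero algebra, which is not yet excluded.
  rcases eq_or_ne c 0 with rfl | hc0
  · rw [zero_smul] at h1
    refine ⟨0, ?_⟩
    have h2 : (1 : NCTorus Θ) = 0 := by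
      rw [← Unitary.coe_star_mul_self (torusMonomial Θ (-k)), h1, mul_zero]
    rw [← mul_one (star _), h2, mul_zero, zero_smul]
  · exact ⟨c⁻¹, by rw [h1, smul_smul, inv_mul_cancel₀ hc0, one_smul]⟩

/-- The exponents for which this holds form a subgroup, since the unknown phases are nonzero and
cancel, and it contains the standard basis. -/
theorem torusAction_torusMonomial (z : Fin n → Circle) (k : Fin n → ℤ) :
    torusAction z (torusMonomial Θ k : NCTorus Θ) =
      torusChar k z • (torusMonomial Θ k : NCTorus Θ) := by
  rcases subsingleton_or_nontrivial (NCTorus Θ) with hA | hA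
  · exact Subsingleton.elim _ _
  let S : AddSubgroup (Fin n → ℤ) :=
    { carrier := {k | torusAction z (torusMonomial Θ k : NCTorus Θ) =
        torusChar k z • (torusMonomial Θ k : NCTorus Θ)}
      zero_mem' := by
        simp only [Set.mem_ofPred_eq]
        rw [torusMonomial_zero, Submonoid.coe_one, map_one, torusChar_zero, one_smul]
      add_mem' := by
        intro k l hk hl
        simp only [Set.mem_ofPred_eq] at *
        obtain ⟨c, hc⟩ := torusMonomial_mul (Θ := Θ) k l
        have hc0 : c ≠ 0 := by
          rintro rfl
          rw [zero_smul, ← Submonoid.coe_mul] at hc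
          have := Unitary.coe_star_mul_self (torusMonomial Θ k * torusMonomial Θ l)
          rw [hc, mul_zero] at this
          exact zero_ne_one this
        have h := congrArg (torusAction z) hc
        rw [map_mul, map_smul, hk, hl, smul_mul_smul_comm, hc, smul_smul] at h
        rw [torusChar_add]
        have := congrArg (fun x => c⁻¹ • x) h
        simp only [smul_smul] at this
        rw [inv_mul_cancel₀ hc0, one_smul, mul_left_comm, inv_mul_cancel₀ hc0, mul_one] at this
        exact this.symm
      neg_mem' := by
        intro k hk
        simp only [Set.mem_ofPred_eq] at *
        obtain ⟨c, hc⟩ := star_torusMonomial (Θ := Θ) k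
        have hc0 : c ≠ 0 := by
          rintro rfl
          have := Unitary.coe_star_mul_self (torusMonomial Θ k)
          rw [hc, zero_smul, zero_mul] at this
          exact zero_ne_one this
        have h := congrArg (torusAction z) hc
        rw [map_star, map_smul, hk, star_smul, hc, star_torusChar, smul_smul] at h
        have := congrArg (fun x => c⁻¹ • x) h
        simp only [smul_smul] at this
        rw [inv_mul_cancel₀ hc0, one_smul, mul_left_comm, inv_mul_cancel₀ hc0, mul_one] at this
        exact this.symm }
  have hS : S = ⊤ := by
    refine addSubgroup_eq_top_of_single_mem fun j => ?_
    change torusAction z (torusMonomial Θ _ : NCTorus Θ) = _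
    obtain ⟨c, hc⟩ := torusMonomial_single (Θ := Θ) j
    rw [hc, map_smul, torusAction_gen, torusChar_single, smul_comm]
  have : k ∈ S := hS ▸ AddSubgroup.mem_top k
  exact this

/-- Density in the ambient algebra holds by construction; it is pulled back along the isometric
inclusion. -/
theorem dense_adjoin_torusGen :
    Dense (StarAlgebra.adjoin ℂ (Set.range (torusGen (Θ := Θ))) : Set (NCTorus Θ)) := by
  have hp : ∀ x (hx : x ∈ torusPoly Θ), (⟨x, (torusPoly Θ).le_topologicalClosure hx⟩ : NCTorus Θ) ∈
      StarAlgebra.adjoin ℂ (Set.range (torusGen (Θ := Θ))) := by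
    intro x hx
    have h : torusPoly Θ ≤ (StarAlgebra.adjoin ℂ (Set.range (torusGen (Θ := Θ)))).map
        torusIncl := by
      refine StarAlgebra.adjoin_le ?_
      rintro _ ⟨j, rfl⟩
      exact ⟨torusGen j, StarAlgebra.subset_adjoin ℂ _ ⟨j, rfl⟩, rfl⟩
    obtain ⟨y, hy, hyx⟩ := h hx
    have : y = ⟨x, (torusPoly Θ).le_topologicalClosure hx⟩ := Subtype.ext hyx
    rwa [← this]
  have hd : Dense {y : NCTorus Θ | torusIncl y ∈ torusPoly Θ} := by
    intro y
    have hi : Isometry (torusIncl (Θ := Θ)) :=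
      AddMonoidHomClass.isometry_of_norm _ fun _ => rfl
    rw [hi.isUniformInducing.isInducing.closure_eq_preimage_closure_image]
    have hy : (y.1 : TorusAmbient Θ) ∈ closure (torusPoly Θ : Set (TorusAmbient Θ)) := y.2
    refine closure_mono ?_ hy
    intro x hx
    exact ⟨⟨x, (torusPoly Θ).le_topologicalClosure hx⟩, hx, rfl⟩
  refine hd.mono ?_
  intro y hy
  exact hp y.1 hy

/-- Products and adjoints of monomials are multiples of monomials, so the linear span is already a
star subalgebra containing the generators. -/
theorem dense_span_torusMonomial :
    Dense (Submodule.span ℂ (Set.range fun k => (torusMonomial Θ k : NCTorus Θ)) :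
      Set (NCTorus Θ)) := by
  set S := Submodule.span ℂ (Set.range fun k => (torusMonomial Θ k : NCTorus Θ)) with hS
  have hmem : ∀ k, (torusMonomial Θ k : NCTorus Θ) ∈ S := fun k => Submodule.subset_span ⟨k, rfl⟩
  have h1 : (1 : NCTorus Θ) ∈ S := by
    have := hmem 0
    rwa [torusMonomial_zero] at this
  have hmul : ∀ a ∈ S, ∀ b ∈ S, a * b ∈ S := by
    intro a ha b hb
    have : S * S ≤ S := by
      rw [hS, Submodule.span_mul_span, Submodule.span_le]
      rintro _ ⟨_, ⟨k, rfl⟩, _, ⟨l, rfl⟩, rfl⟩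
      obtain ⟨c, hc⟩ := torusMonomial_mul (Θ := Θ) k l
      dsimp only
      rw [hc]
      exact S.smul_mem _ (hmem _)
    exact this (Submodule.mul_mem_mul ha hb)
  have hstar : ∀ a ∈ S, star a ∈ S := by
    intro a ha
    induction ha using Submodule.span_induction with
    | mem x hx =>
      obtain ⟨k, rfl⟩ := hx
      obtain ⟨c, hc⟩ := star_torusMonomial (Θ := Θ) k
      dsimp only
      rw [hc]
      exact S.smul_mem _ (hmem _)
    | zero => rw [star_zero]; exact S.zero_mem
    | add x y _ _ hx hy => rw [star_add]; exact S.add_mem hx hy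
    | smul c x _ hx => rw [star_smul]; exact S.smul_mem _ hx
  let S' : StarSubalgebra ℂ (NCTorus Θ) :=
    { carrier := S
      mul_mem' := fun ha hb => hmul _ ha _ hb
      add_mem' := fun ha hb => S.add_mem ha hb
      algebraMap_mem' := fun r => by
        rw [Algebra.algebraMap_eq_smul_one]
        exact S.smul_mem _ h1
      star_mem' := fun ha => hstar _ ha }
  refine dense_adjoin_torusGen.mono ?_
  have : StarAlgebra.adjoin ℂ (Set.range (torusGen (Θ := Θ))) ≤ S' := by
    refine StarAlgebra.adjoin_le ?_
    rintro _ ⟨j, rfl⟩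
    obtain ⟨c, hc⟩ := torusMonomial_single (Θ := Θ) j
    have hm := hmem (Pi.single j 1)
    rw [hc] at hm
    rcases eq_or_ne c 0 with rfl | hc0
    · rw [zero_smul] at hc
      have h2 : (1 : NCTorus Θ) = 0 := by
        rw [← Unitary.coe_star_mul_self (torusMonomial Θ (Pi.single j 1)), hc, mul_zero]
      change torusGen j ∈ S
      rw [← mul_one (torusGen j), h2, mul_zero]
      exact S.zero_mem
    · change torusGen j ∈ S
      have := S.smul_mem c⁻¹ hm
      rwa [smul_smul, inv_mul_cancel₀ hc0, one_smul] at this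
  exact this

/-- Two continuous linear maps on the torus that agree on the monomials are equal. -/
theorem torus_clm_ext {B : Type*} [AddCommMonoid B] [Module ℂ B] [TopologicalSpace B] [T2Space B]
    {f g : NCTorus Θ →L[ℂ] B}
    (h : ∀ k, f (torusMonomial Θ k : NCTorus Θ) = g (torusMonomial Θ k : NCTorus Θ)) : f = g := by
  refine ContinuousLinearMap.ext_on dense_span_torusMonomial ?_
  rintro _ ⟨k, rfl⟩
  exact h k

end Monomials

/-! ### The twisted regular representation and nontriviality. -/

section RegularRepresentation

/-- The unitary operator taking the basis vector `b k` to `w k • b (σ k)`. -/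
theorem exists_weighted_shift {E κ : Type*} [NormedAddCommGroup E] [InnerProductSpace ℂ E]
    [CompleteSpace E] (b : HilbertBasis κ ℂ E) (σ : κ ≃ κ) (w : κ → Circle) :
    ∃ V : unitary (E →L[ℂ] E), ∀ k, (V : E →L[ℂ] E) (b k) = (w k : ℂ) • b (σ k) := by
  classical
  have ho : Orthonormal ℂ fun k => (w k : ℂ) • b (σ k) := by
    have h1 := b.orthonormal.comp σ σ.injective
    rw [orthonormal_iff_ite] at h1 ⊢
    intro i j
    have h2 := h1 i j
    simp only [Function.comp] at h2
    rw [inner_smul_left, inner_smul_right, h2]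
    split_ifs with hij
    · subst hij
      rw [mul_one, Complex.conj_mul', Circle.norm_coe]
      norm_num
    · simp
  have hd : ⊤ ≤ (Submodule.span ℂ (Set.range fun k => (w k : ℂ) • b (σ k))).topologicalClosure := by
    rw [← b.dense_span]
    refine Submodule.topologicalClosure_mono (Submodule.span_le.2 ?_)
    rintro _ ⟨k, rfl⟩
    have h1 : (w (σ.symm k) : ℂ) • b (σ (σ.symm k)) ∈
        Submodule.span ℂ (Set.range fun k => (w k : ℂ) • b (σ k)) :=
      Submodule.subset_span ⟨_, rfl⟩
    have h2 := Submodule.smul_mem _ (w (σ.symm k) : ℂ)⁻¹ h1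
    rwa [smul_smul, inv_mul_cancel₀ (Circle.coe_ne_zero _), one_smul,
      Equiv.apply_symm_apply] at h2
  let b' := HilbertBasis.mk ho hd
  refine ⟨Unitary.linearIsometryEquiv.symm (b.repr.trans b'.repr.symm), fun k => ?_⟩
  change b'.repr.symm (b.repr (b k)) = _
  rw [b.repr_self, b'.repr_symm_single, HilbertBasis.coe_mk]

variable {n : ℕ} {Θ : Matrix (Fin n) (Fin n) ℝ}

/-- The phases of the twisted regular representation of `ℤⁿ`. -/
def regularPhase (Θ : Matrix (Fin n) (Fin n) ℝ) (j : Fin n) (k : Fin n → ℤ) : ℝ :=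
  -Real.pi * ∑ m, Θ j m * k m

theorem regularPhase_add_single (j l : Fin n) (k : Fin n → ℤ) :
    regularPhase Θ j (k + Pi.single l 1) = regularPhase Θ j k - Real.pi * Θ j l := by
  have : ∑ m, Θ j m * ((Pi.single l 1 : Fin n → ℤ) m : ℝ) = Θ j l := by
    rw [Finset.sum_eq_single l]
    · simp
    · intro m _ hm
      simp [hm]
    · simp
  simp only [regularPhase, Pi.add_apply, Int.cast_add, mul_add, Finset.sum_add_distrib, this]
  ring

/-- Each V_j shifts the basis by e_j with a phase linear in the position. Exchanging two shifts
produces the phase π(Θ_lj - Θ_jl), which skew-symmetry turns into 2πΘ_lj. -/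
theorem exists_torusFamily (hΘ : Θᵀ = -Θ) :
    ∃ V : Fin n → (lp (fun _ : Fin n → ℤ => ℂ) 2 →L[ℂ] lp (fun _ : Fin n → ℤ => ℂ) 2),
      IsTorusFamily Θ V := by
  let b : HilbertBasis (Fin n → ℤ) ℂ (lp (fun _ : Fin n → ℤ => ℂ) 2) :=
    ⟨LinearIsometryEquiv.refl ℂ _⟩
  choose V hV using fun j : Fin n => exists_weighted_shift b (Equiv.addRight (Pi.single j 1))
    fun k => Circle.exp (regularPhase Θ j k)
  refine ⟨fun j => V j, fun j => (V j).2, fun j l => ?_⟩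
  refine ContinuousLinearMap.ext_on (s := Set.range b) ?_ ?_
  · exact Submodule.dense_iff_topologicalClosure_eq_top.2 b.dense_span
  · rintro _ ⟨k, rfl⟩
    rw [mul_apply_eq_comp, smul_apply, mul_apply_eq_comp, hV, hV, map_smul, map_smul, hV, hV]
    simp only [Equiv.coe_addRight, smul_smul]
    rw [add_right_comm k]
    congr 1
    rw [Circle.coe_exp, Circle.coe_exp, Circle.coe_exp, Circle.coe_exp, ← Complex.exp_add,
      ← Complex.exp_add, ← Complex.exp_add]
    congr 1
    rw [regularPhase_add_single, regularPhase_add_single]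
    have h := congrFun (congrFun hΘ l) j
    simp only [Matrix.transpose_apply, Matrix.neg_apply] at h
    rw [h]
    push_cast
    ring

/-- A universal algebra could collapse to zero; a nonzero representation excludes this, and it is
here that skew-symmetry of Θ enters. -/
theorem nontrivial_NCTorus (hΘ : Θᵀ = -Θ) : Nontrivial (NCTorus Θ) := by
  obtain ⟨V, hV⟩ := exists_torusFamily hΘ
  obtain ⟨φ, -, -⟩ := torus_universal V hV
  have h1 : (1 : lp (fun _ : Fin n → ℤ => ℂ) 2 →L[ℂ] lp (fun _ : Fin n → ℤ => ℂ) 2) ≠ 0 := by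
    intro h
    have := congrArg (fun T => T (lp.single 2 (0 : Fin n → ℤ) (1 : ℂ))) h
    have h2 := congrArg norm this
    simp at h2
  refine ⟨1, 0, fun h => h1 ?_⟩
  rw [← map_one φ, h, map_zero]

end RegularRepresentation

/-! ### The canonical trace as an average over the torus. -/

section Trace

variable {n : ℕ} {Θ : Matrix (Fin n) (Fin n) ℝ}

theorem norm_torusAction_le (z : Fin n → Circle) (a : NCTorus Θ) : ‖torusAction z a‖ ≤ ‖a‖ :=
  NonUnitalStarAlgHom.norm_apply_le (torusAction z) a

theorem torusAction_mul (z w : Fin n → Circle) (a : NCTorus Θ) :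
    torusAction (z * w) a = torusAction z (torusAction w a) := by
  have : torusAction (z * w) = (torusAction z).comp (torusAction (Θ := Θ) w) := by
    refine torus_hom_ext fun j => ?_
    rw [StarAlgHom.comp_apply, torusAction_gen, torusAction_gen, map_smul, torusAction_gen,
      smul_smul, Pi.mul_apply, Circle.coe_mul, mul_comm]
  rw [this]
  rfl

theorem torusAction_one (a : NCTorus Θ) : torusAction 1 a = a := by
  have : torusAction 1 = StarAlgHom.id ℂ (NCTorus Θ) := by
    refine torus_hom_ext fun j => ?_
    rw [torusAction_gen]
    simp
  rw [this]
  rfl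

theorem continuous_torusChar (k : Fin n → ℤ) : Continuous (torusChar k) := by
  refine continuous_finsetProd _ fun j _ => ?_
  exact (continuous_subtype_val.comp (continuous_apply j)).zpow₀ _
    fun z => Or.inl (Circle.coe_ne_zero _)

/-- For spans of monomials the orbit map is a trigonometric polynomial; since the action is
contractive, orbit maps of general elements are uniform limits of these. -/
theorem continuous_torusAction (a : NCTorus Θ) : Continuous fun z => torusAction z a := by
  have hspan : ∀ x ∈ Submodule.span ℂ (Set.range fun k => (torusMonomial Θ k : NCTorus Θ)),
      Continuous fun z => torusAction z x := by
    intro x hx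
    induction hx using Submodule.span_induction with
    | mem x hx =>
      obtain ⟨k, rfl⟩ := hx
      simp only [torusAction_torusMonomial]
      exact (continuous_torusChar k).smul continuous_const
    | zero => simp only [map_zero]; exact continuous_const
    | add x y _ _ hx hy => simp only [map_add]; exact hx.add hy
    | smul c x _ hx => simp only [map_smul]; exact hx.const_smul c
  refine continuous_of_uniform_approx_of_continuous fun u hu => ?_
  obtain ⟨ε, hε, hεu⟩ := Metric.mem_uniformity_dist.1 hu
  obtain ⟨b, hb, hab⟩ := dense_span_torusMonomial.exists_dist_lt a hε
  refine ⟨_, hspan b hb, fun z => hεu ?_⟩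
  rw [dist_eq_norm, ← map_sub]
  rw [dist_eq_norm] at hab
  exact (norm_torusAction_le z _).trans_lt hab

/-- The conditional expectation onto the fixed points of the torus action. -/
theorem exists_torusExpectation : ∃ E : NCTorus Θ →L[ℂ] NCTorus Θ,
    (∀ k, E (torusMonomial Θ k : NCTorus Θ) = if k = 0 then 1 else 0) ∧
    (∀ a, 0 ≤ a → 0 ≤ E a) ∧ ∀ a, 0 ≤ a → E a = 0 → a = 0 := by
  let _ : MeasurableSpace (Fin n → Circle) := borel _
  have : BorelSpace (Fin n → Circle) := ⟨rfl⟩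
  let μ : MeasureTheory.Measure (Fin n → Circle) := MeasureTheory.Measure.haarMeasure ⊤
  have : MeasureTheory.IsProbabilityMeasure μ :=
    ⟨by simpa using MeasureTheory.Measure.haarMeasure_self (K₀ := (⊤ : TopologicalSpace.PositiveCompacts (Fin n → Circle)))⟩
  have hint : ∀ a : NCTorus Θ, MeasureTheory.Integrable (fun z => torusAction z a) μ := fun a =>
    (continuous_torusAction a).integrable_of_hasCompactSupport (HasCompactSupport.of_compactSpace _)
  let E : NCTorus Θ →L[ℂ] NCTorus Θ := LinearMap.mkContinuous
    { toFun := fun a => ∫ z, torusAction z a ∂μ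
      map_add' := fun a b => by
        simp only [map_add]
        exact MeasureTheory.integral_add (hint a) (hint b)
      map_smul' := fun c a => by
        simp only [map_smul]
        exact MeasureTheory.integral_smul c _ } 1 fun a => by
    simpa using MeasureTheory.norm_integral_le_of_norm_le_const (μ := μ) (C := ‖a‖)
      (Filter.Eventually.of_forall fun z => norm_torusAction_le z a)
  have hE : ∀ a, E a = ∫ z, torusAction z a ∂μ := fun _ => rfl
  have hnn : ∀ a : NCTorus Θ, 0 ≤ a → ∀ z, 0 ≤ torusAction z a := fun a ha z => map_nonneg _ ha
  refine ⟨E, fun k => ?_, fun a ha => ?_, fun a ha h0 => ?_⟩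
  · split_ifs with hk
    · subst hk
      rw [hE, torusMonomial_zero]
      simp
    · obtain ⟨j, hj⟩ : ∃ j, k j ≠ 0 := by
        by_contra! h
        exact hk (funext h)
      have hinv : ∀ w, E (torusMonomial Θ k : NCTorus Θ) =
          torusChar k w • E (torusMonomial Θ k : NCTorus Θ) := by
        intro w
        have h1 := MeasureTheory.integral_mul_right_eq_self (μ := μ)
          (fun z => torusAction z (torusMonomial Θ k : NCTorus Θ)) w
        simp only [torusAction_mul] at h1
        simp only [torusAction_torusMonomial w, map_smul, MeasureTheory.integral_smul] at h1
        exact h1.symm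
      -- Rotating the j-th coordinate by π / k_j multiplies the monomial by -1, so its average
      -- equals its own negative.
      have h1 := hinv (Pi.mulSingle j (Circle.exp (Real.pi / k j)))
      have hk' : (k j : ℂ) ≠ 0 := by exact_mod_cast hj
      have h2 : Complex.exp (Complex.I * k j * (Real.pi / k j : ℝ)) = -1 := by
        rw [← Complex.exp_pi_mul_I]
        congr 1
        push_cast
        field_simp
      rw [torusChar_mulSingle_exp, h2, neg_one_smul] at h1
      have h3 : (2 : ℂ) • E (torusMonomial Θ k : NCTorus Θ) = 0 := by
        rw [two_smul]
        nth_rewrite 1 [h1]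
        exact neg_add_cancel _
      exact (smul_eq_zero.1 h3).resolve_left two_ne_zero
  · exact MeasureTheory.integral_nonneg (hnn a ha)
  -- The integrand is positive with total integral zero, so its integral over every measurable set
  -- vanishes. It is then zero almost everywhere, by continuity everywhere, and in particular at the
  -- identity.
  · have hset : ∀ s : Set (Fin n → Circle), MeasurableSet s →
        ∫ z in s, torusAction z a ∂μ = 0 := by
      intro s hs
      have h1 := MeasureTheory.integral_add_compl hs (hint a)
      rw [← hE, h0] at h1
      have h2 : 0 ≤ ∫ z in s, torusAction z a ∂μ := MeasureTheory.integral_nonneg (hnn a ha)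
      have h3 : 0 ≤ ∫ z in sᶜ, torusAction z a ∂μ := MeasureTheory.integral_nonneg (hnn a ha)
      refine le_antisymm ?_ h2
      rw [← h1]
      exact le_add_of_nonneg_right h3
    have hae : (fun z => torusAction z a) =ᵐ[μ] 0 :=
      (hint a).ae_eq_zero_of_forall_setIntegral_eq_zero fun s hs _ => hset s hs
    have := (continuous_torusAction a).ae_eq_iff_eq μ continuous_const |>.1 hae
    exact (torusAction_one a).symm.trans (congrFun this 1)

theorem torus_clm_apply_eq {B : Type*} [AddCommMonoid B] [Module ℂ B] [TopologicalSpace B]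
    [T2Space B] {f g : NCTorus Θ →L[ℂ] B}
    (h : ∀ k, f (torusMonomial Θ k : NCTorus Θ) = g (torusMonomial Θ k : NCTorus Θ))
    (a : NCTorus Θ) : f a = g a := by
  rw [torus_clm_ext h]

namespace IsInvariantTrace

variable {τ : NCTorus Θ →ₚ[ℂ] ℂ}

theorem apply_torusMonomial (hτ : IsInvariantTrace τ) (k : Fin n → ℤ) :
    τ (torusMonomial Θ k : NCTorus Θ) = if k = 0 then 1 else 0 := by
  split_ifs with hk
  · subst hk
    rw [torusMonomial_zero, Submonoid.coe_one, hτ.one]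
  · obtain ⟨j, hj⟩ : ∃ j, k j ≠ 0 := by
      by_contra! h
      exact hk (funext h)
    have h1 := hτ.invariant (Pi.mulSingle j (Circle.exp (Real.pi / k j))) (torusMonomial Θ k)
    have hk' : (k j : ℂ) ≠ 0 := by exact_mod_cast hj
    have h2 : Complex.exp (Complex.I * k j * (Real.pi / k j : ℝ)) = -1 := by
      rw [← Complex.exp_pi_mul_I]
      congr 1
      push_cast
      field_simp
    rw [torusAction_torusMonomial, map_smul, torusChar_mulSingle_exp, h2, neg_one_smul] at h1
    exact self_eq_neg.1 h1.symm

end IsInvariantTrace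

/-- The continuous linear functional underlying a positive functional. -/
def positiveCLM (τ : NCTorus Θ →ₚ[ℂ] ℂ) : NCTorus Θ →L[ℂ] ℂ := ⟨τ.toLinearMap, map_continuous τ⟩

theorem positiveCLM_apply (τ : NCTorus Θ →ₚ[ℂ] ℂ) (a : NCTorus Θ) : positiveCLM τ a = τ a := rfl

theorem torusAction_invariant_of_apply_torusMonomial {g : NCTorus Θ →L[ℂ] ℂ}
    (hg : ∀ k, g (torusMonomial Θ k : NCTorus Θ) = if k = 0 then 1 else 0) (z : Fin n → Circle)
    (a : NCTorus Θ) : g (torusAction z a) = g a := by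
  let αz : NCTorus Θ →L[ℂ] NCTorus Θ :=
    ⟨(torusAction z).toAlgHom.toLinearMap, map_continuous (torusAction z)⟩
  have hα : ∀ b, αz b = torusAction z b := fun _ => rfl
  have h := torus_clm_apply_eq (f := g.comp αz) (g := g) (fun k => by
    rw [ContinuousLinearMap.comp_apply, hα, torusAction_torusMonomial, map_smul, hg]
    split_ifs with hk
    · subst hk
      rw [torusChar_zero, one_smul]
    · rw [smul_zero]) a
  exact h

theorem torusMonomial_mul_comm_apply {g : NCTorus Θ →L[ℂ] ℂ}
    (hg : ∀ k, g (torusMonomial Θ k : NCTorus Θ) = if k = 0 then 1 else 0) (k l : Fin n → ℤ) :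
    g ((torusMonomial Θ k : NCTorus Θ) * torusMonomial Θ l) =
      g ((torusMonomial Θ l : NCTorus Θ) * torusMonomial Θ k) := by
  by_cases hkl : k + l = 0
  · obtain rfl : l = -k := eq_neg_of_add_eq_zero_right hkl
    obtain ⟨c, hc⟩ := star_torusMonomial (Θ := Θ) k
    have hc0 : c ≠ 0 := by
      rintro rfl
      have h1 := Unitary.coe_star_mul_self (torusMonomial Θ k)
      rw [hc, zero_smul, zero_mul] at h1
      have h2 := hg 0
      rw [torusMonomial_zero, Submonoid.coe_one, ← h1, map_zero, if_pos rfl] at h2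
      exact zero_ne_one h2
    have hs : (torusMonomial Θ (-k) : NCTorus Θ) = c⁻¹ • star (torusMonomial Θ k : NCTorus Θ) := by
      rw [hc, smul_smul, inv_mul_cancel₀ hc0, one_smul]
    rw [hs, mul_smul_comm, smul_mul_assoc, Unitary.coe_star_mul_self,
      Unitary.mul_star_self_of_mem (torusMonomial Θ k).2]
  · obtain ⟨c, hc⟩ := torusMonomial_mul (Θ := Θ) k l
    obtain ⟨d, hd⟩ := torusMonomial_mul (Θ := Θ) l k
    rw [hc, hd, map_smul, map_smul, hg, hg, if_neg hkl, add_comm l k, if_neg hkl, smul_zero,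
      smul_zero]

/-- Symmetry on pairs of monomials extends by density, one argument at a time. -/
theorem tracial_of_apply_torusMonomial {g : NCTorus Θ →L[ℂ] ℂ}
    (hg : ∀ k, g (torusMonomial Θ k : NCTorus Θ) = if k = 0 then 1 else 0)
    (a b : NCTorus Θ) : g (a * b) = g (b * a) := by
  have h1 : ∀ (k : Fin n → ℤ) (b : NCTorus Θ),
      g ((torusMonomial Θ k : NCTorus Θ) * b) = g (b * torusMonomial Θ k) := by
    intro k b
    have h := torus_clm_apply_eq
      (f := g.comp (ContinuousLinearMap.mul ℂ (NCTorus Θ) (torusMonomial Θ k : NCTorus Θ)))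
      (g := g.comp ((ContinuousLinearMap.mul ℂ (NCTorus Θ)).flip (torusMonomial Θ k : NCTorus Θ)))
      (fun l => torusMonomial_mul_comm_apply hg k l) b
    exact h
  have h := torus_clm_apply_eq (f := g.comp ((ContinuousLinearMap.mul ℂ (NCTorus Θ)).flip b))
    (g := g.comp (ContinuousLinearMap.mul ℂ (NCTorus Θ) b)) (fun k => h1 k b) a
  exact h

/-- The averaging map kills every monomial but the zeroth, so by density its values are scalars and
it inherits positivity and faithfulness. Invariance fixes a trace on monomials, hence everywhere. -/
theorem existsUnique_invariantTrace (hΘ : Θᵀ = -Θ) :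
    ∃! τ : NCTorus Θ →ₚ[ℂ] ℂ, IsInvariantTrace τ := by
  have := nontrivial_NCTorus hΘ
  refine existsUnique_of_exists_of_unique ?_ fun τ τ' h h' => ?_
  · obtain ⟨E, hEu, hEp, hE0⟩ := exists_torusExpectation (Θ := Θ)
    -- The functional f serves only to read off the scalar; any f with f 1 = 1 would do.
    obtain ⟨f, -, hf⟩ := exists_dual_vector ℂ (1 : NCTorus Θ) (norm_ne_zero_iff.2 one_ne_zero)
    have hf1 : f 1 = 1 := by simpa using hf
    have hEf : ∀ a, E a = f (E a) • (1 : NCTorus Θ) := by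
      refine torus_clm_apply_eq (f := E)
        (g := (ContinuousLinearMap.toSpanSingleton ℂ (1 : NCTorus Θ)).comp (f.comp E)) fun k => ?_
      simp only [ContinuousLinearMap.comp_apply, ContinuousLinearMap.toSpanSingleton_apply, hEu]
      split_ifs
      · rw [hf1, one_smul]
      · rw [map_zero, zero_smul]
    have hpos : ∀ a, 0 ≤ a → 0 ≤ f (E a) := by
      intro a ha
      have h1 := hEp a ha
      rw [hEf, ← Algebra.algebraMap_eq_smul_one] at h1
      -- A scalar multiple of 1 is positive only if the scalar, being its spectrum, is nonnegative.
      refine spectrum_nonneg_of_nonneg h1 ?_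
      rw [spectrum.scalar_eq]
      exact rfl
    let τ : NCTorus Θ →ₚ[ℂ] ℂ := PositiveLinearMap.mk₀ (f.comp E).toLinearMap hpos
    have hτ : ∀ a, τ a = f.comp E a := fun _ => rfl
    have hτu : ∀ k, f.comp E (torusMonomial Θ k : NCTorus Θ) = if k = 0 then 1 else 0 := by
      intro k
      rw [ContinuousLinearMap.comp_apply, hEu]
      split_ifs
      · exact hf1
      · exact map_zero f
    refine ⟨τ, ?_, fun z a => ?_, fun a b => ?_, fun a ha => ?_⟩
    · have := hτu 0
      rwa [torusMonomial_zero, if_pos rfl] at this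
    · exact torusAction_invariant_of_apply_torusMonomial hτu z a
    · exact tracial_of_apply_torusMonomial hτu a b
    · have h1 : E (star a * a) = 0 := by
        rw [hEf]
        have : f (E (star a * a)) = 0 := ha
        rw [this, zero_smul]
      exact CStarRing.star_mul_self_eq_zero_iff a |>.1 (hE0 _ (star_mul_self_nonneg a) h1)
  · have h1 := torus_clm_apply_eq (f := positiveCLM τ) (g := positiveCLM τ') fun k => by
      rw [positiveCLM_apply, positiveCLM_apply, h.apply_torusMonomial, h'.apply_torusMonomial]
    exact DFunLike.ext _ _ h1

end Trace

/-! ### Derivations of the smooth algebra. -/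

section SmoothElements

variable {n : ℕ} {Θ : Matrix (Fin n) (Fin n) ℝ}

/-- The monomials as smooth elements. -/
def smoothMonomial (k : Fin n → ℤ) : smoothTorus Θ :=
  ⟨torusMonomial Θ k, by
    change ContDiff ℝ ∞ fun t : Fin n → ℝ => torusAction (fun j => Circle.exp (t j))
      (torusMonomial Θ k : NCTorus Θ)
    simp only [torusAction_torusMonomial, torusChar_exp]
    have h : ContDiff ℝ ∞ fun t : Fin n → ℝ => Complex.exp (∑ j, Complex.I * k j * t j) := by
      refine ContDiff.cexp (ContDiff.sum fun j _ => ContDiff.mul contDiff_const ?_)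
      exact Complex.ofRealCLM.contDiff.comp (contDiff_apply (𝕜 := ℝ) (E := ℝ) j)
    exact h.smul contDiff_const⟩

theorem hasDerivAt_torusCurve (j : Fin n) (a : smoothTorus Θ) :
    HasDerivAt (torusCurve j (a : NCTorus Θ)) (torusDeriv j a) 0 :=
  (differentiable_torusCurve j a 0).hasDerivAt

theorem torusCurve_zero (j : Fin n) (a : NCTorus Θ) : torusCurve j a 0 = a := by
  rw [torusCurve, Circle.exp_zero, Pi.mulSingle_one, torusAction_one]

theorem hasDerivAt_exp_phase (k : Fin n → ℤ) (j : Fin n) :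
    HasDerivAt (fun s : ℝ => Complex.exp (Complex.I * k j * s)) (Complex.I * k j) 0 := by
  have h : HasDerivAt (fun s : ℝ => Complex.I * k j * s) (Complex.I * k j) 0 := by
    simpa using (Complex.ofRealCLM.hasDerivAt (x := (0 : ℝ))).const_mul (Complex.I * k j)
  simpa using h.cexp

theorem torusDeriv_smoothMonomial (j : Fin n) (k : Fin n → ℤ) :
    torusDeriv j (smoothMonomial (Θ := Θ) k) =
      (Complex.I * k j) • (torusMonomial Θ k : NCTorus Θ) := by
  refine (hasDerivAt_torusCurve j (smoothMonomial k)).unique ?_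
  have : torusCurve j (smoothMonomial (Θ := Θ) k : NCTorus Θ) =
      fun s : ℝ => Complex.exp (Complex.I * k j * s) • (torusMonomial Θ k : NCTorus Θ) := by
    funext s
    rw [torusCurve, ← torusChar_mulSingle_exp]
    exact torusAction_torusMonomial _ k
  rw [this]
  exact (hasDerivAt_exp_phase k j).smul_const _

theorem torusDeriv_mul (j : Fin n) (a b : smoothTorus Θ) :
    torusDeriv j (a * b) = torusDeriv j a * b + a * torusDeriv j b := by
  refine (hasDerivAt_torusCurve j (a * b)).unique ?_
  have : torusCurve j ((a * b : smoothTorus Θ) : NCTorus Θ) =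
      torusCurve j (a : NCTorus Θ) * torusCurve j (b : NCTorus Θ) := by
    funext s
    exact map_mul _ _ _
  rw [this]
  have h := (hasDerivAt_torusCurve j a).mul (hasDerivAt_torusCurve j b)
  rwa [torusCurve_zero, torusCurve_zero] at h

/-- The torus is abelian, so the orbit map of ∂_j a is the j-th partial derivative of the orbit map
of a. Hence derivatives of smooth elements are smooth and can be differentiated again, as the double
commutators require. -/
theorem torusAction_torusDeriv (j : Fin n) (a : smoothTorus Θ) (t : Fin n → ℝ) :
    torusAction (fun i => Circle.exp (t i)) (torusDeriv j a) =
      fderiv ℝ (fun t : Fin n → ℝ => torusAction (fun i => Circle.exp (t i)) (a : NCTorus Θ)) t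
        (Pi.single j 1) := by
  set g := fun t : Fin n → ℝ => torusAction (fun i => Circle.exp (t i)) (a : NCTorus Θ) with hg
  have hgd : Differentiable ℝ g := ContDiff.differentiable (n := ∞) a.2 (by simp)
  let αt : NCTorus Θ →L[ℝ] NCTorus Θ := ContinuousLinearMap.restrictScalars ℝ
    (⟨(torusAction fun i => Circle.exp (t i)).toAlgHom.toLinearMap,
      map_continuous (torusAction fun i => Circle.exp (t i))⟩ : NCTorus Θ →L[ℂ] NCTorus Θ)
  have h1 : HasDerivAt (fun s => αt (torusCurve j (a : NCTorus Θ) s)) (αt (torusDeriv j a)) 0 :=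
    αt.hasFDerivAt.comp_hasDerivAt 0 (hasDerivAt_torusCurve j a)
  have h2 : HasDerivAt (fun s : ℝ => t + s • (Pi.single j 1 : Fin n → ℝ)) (Pi.single j 1) 0 := by
    simpa using ((hasDerivAt_id (0 : ℝ)).smul_const (Pi.single j 1 : Fin n → ℝ)).const_add t
  have h3 : HasDerivAt (fun s : ℝ => g (t + s • (Pi.single j 1 : Fin n → ℝ)))
      (fderiv ℝ g t (Pi.single j 1)) 0 := by
    have h4 : HasFDerivAt g (fderiv ℝ g t) (t + (0 : ℝ) • (Pi.single j 1 : Fin n → ℝ)) := by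
      rw [zero_smul, add_zero]
      exact (hgd t).hasFDerivAt
    exact h4.comp_hasDerivAt 0 h2
  have h5 : (fun s => αt (torusCurve j (a : NCTorus Θ) s)) =
      fun s : ℝ => g (t + s • (Pi.single j 1 : Fin n → ℝ)) := by
    funext s
    change torusAction _ (torusAction _ _) = torusAction _ _
    rw [← torusAction_mul]
    congr 2
    funext i
    by_cases hi : i = j
    · subst hi; simp [Circle.exp_add]
    · simp [hi]
  rw [h5] at h1
  exact h1.unique h3

theorem torusDeriv_mem_smoothTorus (j : Fin n) (a : smoothTorus Θ) :
    torusDeriv j a ∈ smoothTorus Θ := by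
  change ContDiff ℝ ∞ fun t : Fin n → ℝ => torusAction (fun j => Circle.exp (t j)) (torusDeriv j a)
  simp only [torusAction_torusDeriv]
  have h : ContDiff ℝ ∞ fun t : Fin n → ℝ =>
      torusAction (fun i => Circle.exp (t i)) (a : NCTorus Θ) := a.2
  exact (h.fderiv_right (m := ∞) (by simp)).clm_apply contDiff_const

/-- The derivations of the smooth algebra. -/
def smoothDeriv (j : Fin n) (a : smoothTorus Θ) : smoothTorus Θ :=
  ⟨torusDeriv j a, torusDeriv_mem_smoothTorus j a⟩

end SmoothElements

/-! ### Matrices acting on a Hilbert space tensored with ℂ^ι. -/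

section Amplification

variable {E : Type*} [NormedAddCommGroup E] [InnerProductSpace ℂ E]
variable {ι : Type*} [Fintype ι]

theorem matrixOp_apply (M : Matrix ι ι ℂ) (x : PiLp 2 fun _ : ι => E) (s : ι) :
    matrixOp M x s = ∑ t, M s t • x t := by
  simp [matrixOp]

theorem diagOp_apply (b : E →L[ℂ] E) (x : PiLp 2 fun _ : ι => E) (s : ι) :
    diagOp b x s = b (x s) := rfl

theorem matrixOp_mul [DecidableEq ι] (M N : Matrix ι ι ℂ) :
    matrixOp (E := E) (M * N) = matrixOp M * matrixOp N := by
  ext x s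
  simp only [mul_apply_eq_comp, matrixOp_apply, Matrix.mul_apply, Finset.sum_smul,
    Finset.smul_sum, smul_smul]
  rw [Finset.sum_comm]

theorem matrixOp_one [DecidableEq ι] : matrixOp (E := E) (1 : Matrix ι ι ℂ) = 1 := by
  ext x s
  simp [matrixOp_apply, Matrix.one_apply]

theorem matrixOp_add (M N : Matrix ι ι ℂ) :
    matrixOp (E := E) (M + N) = matrixOp M + matrixOp N := by
  ext x s
  simp [matrixOp_apply, add_smul, Finset.sum_add_distrib]

theorem matrixOp_smul (c : ℂ) (M : Matrix ι ι ℂ) :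
    matrixOp (E := E) (c • M) = c • matrixOp M := by
  ext x s
  simp [matrixOp_apply, Finset.smul_sum, smul_smul]

theorem matrixOp_neg (M : Matrix ι ι ℂ) : matrixOp (E := E) (-M) = -matrixOp M := by
  ext x s
  simp [matrixOp_apply]

theorem matrixOp_star [CompleteSpace E] (M : Matrix ι ι ℂ) :
    matrixOp (E := E) Mᴴ = star (matrixOp M) := by
  rw [ContinuousLinearMap.star_eq_adjoint, ContinuousLinearMap.eq_adjoint_iff]
  intro x y
  simp only [PiLp.inner_apply, matrixOp_apply, sum_inner, inner_sum, inner_smul_left,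
    inner_smul_right, Matrix.conjTranspose_apply, RCLike.star_def, RingHomCompTriple.comp_apply,
    RingHom.id_apply]
  rw [Finset.sum_comm]

theorem matrixOp_comm_diagOp (M : Matrix ι ι ℂ) (b : E →L[ℂ] E) :
    matrixOp M * diagOp b = diagOp b * matrixOp M := by
  ext x s
  simp only [mul_apply_eq_comp, matrixOp_apply, diagOp_apply, map_sum, map_smul]

theorem matrixOp_injective [Nontrivial E] [DecidableEq ι] {M N : Matrix ι ι ℂ}
    (h : matrixOp (E := E) M = matrixOp N) : M = N := by
  obtain ⟨v, hv⟩ := exists_ne (0 : E)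
  ext s t
  have h1 := congrArg (fun T => T (WithLp.toLp 2 (Pi.single t v)) s) h
  simp only [matrixOp_apply] at h1
  rw [Finset.sum_eq_single t, Finset.sum_eq_single t] at h1
  · simp only [Pi.single_eq_same] at h1
    exact smul_left_injective ℂ hv h1
  all_goals simp +contextual

/-- The decomposition of `E ⊗ ℂ^ι` along an orthonormal basis of `E`. -/
theorem exists_fiberDecomposition {K : Type*} [CompleteSpace E] (e : HilbertBasis K ℂ E) :
    ∃ F : PiLp 2 (fun _ : ι => E) ≃ₗᵢ[ℂ] lp (fun _ : K => EuclideanSpace ℂ ι) 2,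
      ∀ x k t, F x k t = ⟪e k, x t⟫_ℂ := by
  have hs : ∀ v : E, HasSum (fun k => ‖e.repr v k‖ ^ 2) (‖v‖ ^ 2) := by
    intro v
    have := lp.hasSum_norm (p := 2) (by norm_num) (e.repr v)
    simpa using this
  have hs2 : ∀ x : PiLp 2 fun _ : ι => E, HasSum
      (fun k => ‖(WithLp.toLp 2 fun t => e.repr (x t) k : EuclideanSpace ℂ ι)‖ ^ 2) (‖x‖ ^ 2) := by
    intro x
    simp only [EuclideanSpace.norm_sq_eq, PiLp.norm_sq_eq_of_L2]
    exact hasSum_sum fun t _ => hs (x t)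
  have hmem : ∀ x : PiLp 2 fun _ : ι => E,
      Memℓp (fun k => (WithLp.toLp 2 fun t => e.repr (x t) k : EuclideanSpace ℂ ι)) 2 := by
    intro x
    refine memℓp_gen ?_
    simpa using (hs2 x).summable
  have hmem' : ∀ (y : lp (fun _ : K => EuclideanSpace ℂ ι) 2) (t : ι),
      Memℓp (fun k => y k t) 2 := by
    intro y t
    exact (lp.memℓp y).mono' fun k => PiLp.norm_apply_le (y k) t
  let L : PiLp 2 (fun _ : ι => E) ≃ₗ[ℂ] lp (fun _ : K => EuclideanSpace ℂ ι) 2 :=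
    { toFun := fun x => ⟨fun k => WithLp.toLp 2 fun t => e.repr (x t) k, hmem x⟩
      map_add' := fun x y => by
        ext k t
        simp
        rfl
      map_smul' := fun c x => by
        ext k t
        simp
      invFun := fun y => WithLp.toLp 2 fun t => e.repr.symm ⟨fun k => y k t, hmem' y t⟩
      left_inv := fun x => by
        ext t
        exact e.repr.symm_apply_apply (x t)
      right_inv := fun y => by
        ext k t
        simp }
  refine ⟨⟨L, fun x => ?_⟩, fun x k t => ?_⟩
  · have h1 := lp.norm_rpow_eq_tsum (p := 2) (by norm_num) (L x)
    have h2 := (hs2 x).tsum_eq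
    have h3 : ‖L x‖ ^ 2 = ‖x‖ ^ 2 := by
      rw [← h2]
      simp only [ENNReal.toReal_ofNat, Real.rpow_ofNat] at h1
      exact h1
    exact (sq_eq_sq₀ (norm_nonneg _) (norm_nonneg _)).1 h3
  · exact e.repr_apply_apply (x t) k

theorem isBoundedMultiplier_matrixOp {K : Type*} [DecidableEq ι] [CompleteSpace E]
    {e : HilbertBasis K ℂ E}
    {F : PiLp 2 (fun _ : ι => E) ≃ₗᵢ[ℂ] lp (fun _ : K => EuclideanSpace ℂ ι) 2}
    (hF : ∀ x k t, F x k t = ⟪e k, x t⟫_ℂ) (M : Matrix ι ι ℂ) :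
    IsBoundedMultiplier F (matrixOp M) fun _ => Matrix.toEuclideanCLM (𝕜 := ℂ) M := by
  intro x k
  ext s
  rw [hF, matrixOp_apply, inner_sum, Matrix.ofLp_toEuclideanCLM, Matrix.mulVec, dotProduct]
  simp only [inner_smul_right, hF]

end Amplification

/-! ### The Fourier basis of the GNS space. -/

section GNSBasis

variable {n : ℕ} {Θ : Matrix (Fin n) (Fin n) ℝ} (τ : NCTorus Θ →ₚ[ℂ] ℂ)

/-- The vector of the GNS space represented by an element of the algebra. -/
def gnsVec (a : NCTorus Θ) : τ.GNS := ((τ.toPreGNS a : τ.PreGNS) : τ.GNS)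

theorem gnsStarAlgHom_gnsVec (a b : NCTorus Θ) :
    τ.gnsStarAlgHom a (gnsVec τ b) = gnsVec τ (a * b) := by
  rw [gnsVec, PositiveLinearMap.gnsStarAlgHom_apply]
  exact τ.gnsNonUnitalStarAlgHom_apply_coe

theorem inner_gnsVec (a b : NCTorus Θ) : ⟪gnsVec τ a, gnsVec τ b⟫_ℂ = τ (star a * b) := by
  rw [gnsVec, gnsVec, UniformSpace.Completion.inner_coe, PositiveLinearMap.preGNS_inner_def]
  rfl

/-- The map of the algebra onto a dense subspace of the GNS space. -/
def gnsMap : NCTorus Θ →L[ℂ] τ.GNS :=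
  LinearMap.mkContinuous
    { toFun := gnsVec τ
      map_add' := fun a b => by simp [gnsVec, UniformSpace.Completion.coe_add]
      map_smul' := fun c a => (congrArg _ (map_smul τ.toPreGNS c a)).trans
        (UniformSpace.Completion.coe_smul c _) } ‖gnsVec τ 1‖
    fun a => by
      have h : gnsVec τ a = τ.gnsStarAlgHom a (gnsVec τ 1) := by
        rw [gnsStarAlgHom_gnsVec, mul_one]
      change ‖gnsVec τ a‖ ≤ ‖gnsVec τ 1‖ * ‖a‖
      rw [h, mul_comm]
      exact (ContinuousLinearMap.le_opNorm _ _).trans (mul_le_mul_of_nonneg_right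
        (NonUnitalStarAlgHom.norm_apply_le τ.gnsStarAlgHom a) (norm_nonneg _))

theorem denseRange_gnsMap : DenseRange (gnsMap τ) := by
  have h := UniformSpace.Completion.denseRange_coe (α := τ.PreGNS)
  refine h.mono ?_
  rintro _ ⟨a, rfl⟩
  exact ⟨τ.ofPreGNS a, rfl⟩

variable {τ}

/-- The product of one adjoint monomial with another is a multiple of the monomial of the
difference, whose trace vanishes unless the exponents agree; totality is the density of the span. -/
theorem exists_gnsBasis (hτ : IsInvariantTrace τ) :
    ∃ e : HilbertBasis (Fin n → ℤ) ℂ τ.GNS,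
      ∀ k, e k = gnsVec τ (torusMonomial Θ k : NCTorus Θ) := by
  have ho : Orthonormal ℂ fun k => gnsVec τ (torusMonomial Θ k : NCTorus Θ) := by
    rw [orthonormal_iff_ite]
    intro k l
    rw [inner_gnsVec]
    split_ifs with hkl
    · subst hkl
      rw [Unitary.coe_star_mul_self, hτ.one]
    · obtain ⟨c, hc⟩ := star_torusMonomial (Θ := Θ) k
      obtain ⟨d, hd⟩ := torusMonomial_mul (Θ := Θ) (-k) l
      rw [hc, smul_mul_assoc, hd, map_smul, map_smul, hτ.apply_torusMonomial, if_neg, smul_zero,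
        smul_zero]
      rwa [neg_add_eq_zero]
  have hd : ⊤ ≤ (Submodule.span ℂ (Set.range fun k =>
      gnsVec τ (torusMonomial Θ k : NCTorus Θ))).topologicalClosure := by
    have h1 := (denseRange_gnsMap τ).dense_image (gnsMap τ).continuous
      (dense_span_torusMonomial (Θ := Θ))
    have h2 : Submodule.span ℂ (Set.range fun k => gnsVec τ (torusMonomial Θ k : NCTorus Θ)) =
        (Submodule.span ℂ (Set.range fun k => (torusMonomial Θ k : NCTorus Θ))).map
          (gnsMap τ).toLinearMap := by
      rw [Submodule.map_span, ← Set.range_comp]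
      rfl
    rw [h2, top_le_iff]
    exact Submodule.dense_iff_topologicalClosure_eq_top.1 h1
  exact ⟨HilbertBasis.mk ho hd, fun k => by rw [HilbertBasis.coe_mk]⟩

/-- Integration by parts: by invariance of τ, the Fourier coefficient along the orbit of a is exp(i
k_j s) times its initial value, and one differentiates at s = 0. -/
theorem trace_star_torusMonomial_mul_deriv (hτ : IsInvariantTrace τ) (k : Fin n → ℤ) (j : Fin n)
    (a : smoothTorus Θ) :
    τ (star (torusMonomial Θ k : NCTorus Θ) * torusDeriv j a) =
      Complex.I * k j * τ (star (torusMonomial Θ k : NCTorus Θ) * a) := by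
  let g : NCTorus Θ →L[ℂ] ℂ := (positiveCLM τ).comp
    (ContinuousLinearMap.mul ℂ (NCTorus Θ) (star (torusMonomial Θ k : NCTorus Θ)))
  have hg : ∀ b, g b = τ (star (torusMonomial Θ k : NCTorus Θ) * b) := fun _ => rfl
  have h1 : HasDerivAt (fun s => g (torusCurve j (a : NCTorus Θ) s)) (g (torusDeriv j a)) 0 :=
    (g.restrictScalars ℝ).hasFDerivAt.comp_hasDerivAt 0 (hasDerivAt_torusCurve j a)
  have h2 : (fun s => g (torusCurve j (a : NCTorus Θ) s)) =
      fun s : ℝ => Complex.exp (Complex.I * k j * s) * g a := by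
    funext s
    rw [hg, hg, ← torusChar_mulSingle_exp,
      ← hτ.invariant (Pi.mulSingle j (Circle.exp s)) (star (torusMonomial Θ k : NCTorus Θ) * a),
      map_mul (torusAction _), map_star (torusAction _), torusAction_torusMonomial, star_smul, smul_mul_assoc, map_smul,
      smul_eq_mul, ← mul_assoc, RCLike.star_def, Complex.mul_conj', norm_torusChar]
    simp [torusCurve]
  rw [h2] at h1
  have h3 := h1.unique ((hasDerivAt_exp_phase k j).mul_const (g a))
  rw [← hg, ← hg, h3]

end GNSBasis

/-! ### Constant coefficient operators as multipliers; commutators with the algebra. -/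

section TorusOperators

variable {n : ℕ} {Θ : Matrix (Fin n) (Fin n) ℝ} {τ : NCTorus Θ →ₚ[ℂ] ℂ}
variable {ι : Type} [Fintype ι] [DecidableEq ι]

theorem exists_torusDecomposition (hτ : IsInvariantTrace τ) (ι : Type) [Fintype ι] :
    ∃ F : TorusHilbert τ ι ≃ₗᵢ[ℂ] lp (fun _ : Fin n → ℤ => EuclideanSpace ℂ ι) 2,
      ∀ x k t, F x k t = ⟪gnsVec τ (torusMonomial Θ k : NCTorus Θ), x t⟫_ℂ := by
  obtain ⟨e, he⟩ := exists_gnsBasis hτ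
  obtain ⟨F, hF⟩ := exists_fiberDecomposition (ι := ι) e
  exact ⟨F, fun x k t => by rw [hF, he]⟩

/-- The Fourier decomposition of `L²(𝒜_Θ, τ) ⊗ ℂ^ι`. -/
def torusFourier (hτ : IsInvariantTrace τ) (ι : Type) [Fintype ι] :
    TorusHilbert τ ι ≃ₗᵢ[ℂ] lp (fun _ : Fin n → ℤ => EuclideanSpace ℂ ι) 2 :=
  (exists_torusDecomposition hτ ι).choose

theorem torusFourier_apply (hτ : IsInvariantTrace τ) (x : TorusHilbert τ ι) (k : Fin n → ℤ)
    (t : ι) : torusFourier hτ ι x k t = ⟪gnsVec τ (torusMonomial Θ k : NCTorus Θ), x t⟫_ℂ :=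
  (exists_torusDecomposition hτ ι).choose_spec x k t

theorem torusFourier_torusVec (hτ : IsInvariantTrace τ) (a : ι → NCTorus Θ) (k : Fin n → ℤ)
    (t : ι) : torusFourier hτ ι (torusVec τ a) k t =
      τ (star (torusMonomial Θ k : NCTorus Θ) * a t) := by
  rw [torusFourier_apply, ← inner_gnsVec]
  rfl

theorem isBoundedMultiplier_torus (hτ : IsInvariantTrace τ) (M : Matrix ι ι ℂ) :
    IsBoundedMultiplier (torusFourier hτ ι) (matrixOp M)
      fun _ => Matrix.toEuclideanCLM (𝕜 := ℂ) M := by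
  obtain ⟨e, he⟩ := exists_gnsBasis hτ
  exact isBoundedMultiplier_matrixOp (e := e)
    (fun x k t => by rw [torusFourier_apply, he]) M

/-- The symbol `i ∑ j, k j S j` of the operator `∑ j, ∂ j ⊗ S j`. -/
def torusSymbol (S : Fin n → Matrix ι ι ℂ) (k : Fin n → ℤ) : Matrix ι ι ℂ :=
  ∑ j, (Complex.I * k j) • S j

/-- The value of `∑ j, ∂ j ⊗ S j` on a smooth vector. -/
def torusOpVec (τ : NCTorus Θ →ₚ[ℂ] ℂ) (S : Fin n → Matrix ι ι ℂ) (a : ι → smoothTorus Θ) :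
    TorusHilbert τ ι := ∑ j, matrixOp (S j) (torusVec τ fun t => torusDeriv j (a t))

theorem torusFourier_torusOpVec (hτ : IsInvariantTrace τ) (S : Fin n → Matrix ι ι ℂ)
    (a : ι → smoothTorus Θ) (k : Fin n → ℤ) :
    torusFourier hτ ι (torusOpVec τ S a) k = Matrix.toEuclideanCLM (𝕜 := ℂ) (torusSymbol S k)
      (torusFourier hτ ι (torusVec τ fun t => (a t : NCTorus Θ)) k) := by
  rw [torusOpVec, torusSymbol, map_sum, map_sum, lp.coeFn_sum, Finset.sum_apply, sum_apply]
  refine Finset.sum_congr rfl fun j _ => ?_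
  rw [isBoundedMultiplier_torus hτ, map_smul, smul_apply, ← map_smul]
  congr 1
  ext t
  rw [torusFourier_torusVec, PiLp.smul_apply, torusFourier_torusVec,
    trace_star_torusMonomial_mul_deriv hτ, smul_eq_mul]

/-- The pairs of smooth vectors that span the graph of `∑ j, ∂ j ⊗ S j`. -/
def torusOpCore (τ : NCTorus Θ →ₚ[ℂ] ℂ) (S : Fin n → Matrix ι ι ℂ) :
    Submodule ℂ (TorusHilbert τ ι × TorusHilbert τ ι) :=
  Submodule.span ℂ (Set.range fun a : ι → smoothTorus Θ =>
    (torusVec τ fun t => (a t : NCTorus Θ), torusOpVec τ S a))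

theorem torusOp_eq (S : Fin n → Matrix ι ι ℂ) :
    torusOp τ S = (torusOpCore τ S).toLinearPMap.closure := rfl

theorem torusOpCore_fiber (hτ : IsInvariantTrace τ) (S : Fin n → Matrix ι ι ℂ)
    {p : TorusHilbert τ ι × TorusHilbert τ ι} (hp : p ∈ torusOpCore τ S) (k : Fin n → ℤ) :
    torusFourier hτ ι p.2 k =
      Matrix.toEuclideanCLM (𝕜 := ℂ) (torusSymbol S k) (torusFourier hτ ι p.1 k) := by
  induction hp using Submodule.span_induction with
  | mem x hx =>
    obtain ⟨a, rfl⟩ := hx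
    exact torusFourier_torusOpVec hτ S a k
  | zero => simp
  | add x y _ _ hx hy => simp [hx, hy]
  | smul c x _ hx => simp [hx]

theorem torusOpCore_graph (hτ : IsInvariantTrace τ) (S : Fin n → Matrix ι ι ℂ) :
    (torusOpCore τ S).toLinearPMap.graph = torusOpCore τ S := by
  refine Submodule.toLinearPMap_graph_eq _ fun p hp h0 => ?_
  refine fiber_ext (torusFourier hτ ι) fun k => ?_
  rw [torusOpCore_fiber hτ S hp k, h0]
  simp

theorem fiberVec_torusFourier (hτ : IsInvariantTrace τ) (k : Fin n → ℤ) (w : EuclideanSpace ℂ ι) :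
    fiberVec (torusFourier hτ ι) k w =
      torusVec τ fun t => ((w t • smoothMonomial k : smoothTorus Θ) : NCTorus Θ) := by
  refine fiber_ext (torusFourier hτ ι) fun l => ?_
  ext t
  obtain ⟨e, he⟩ := exists_gnsBasis hτ
  have ho := orthonormal_iff_ite.1 e.orthonormal l k
  rw [he, he, inner_gnsVec] at ho
  rw [torusFourier_torusVec, fiberVec_apply]
  change _ = τ (_ * (w t • (torusMonomial Θ k : NCTorus Θ)))
  rw [mul_smul_comm, map_smul, ho]
  split_ifs <;> simp

/-- Integration by parts shows that the core acts fibrewise by the symbol, and fibre vectors are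
monomials with constant coefficients, hence in the core. The closure is therefore the maximal
multiplier. -/
theorem isMultiplier_torusOp (hτ : IsInvariantTrace τ) (S : Fin n → Matrix ι ι ℂ) :
    IsMultiplier (torusFourier hτ ι) (torusOp τ S)
      fun k => Matrix.toEuclideanCLM (𝕜 := ℂ) (torusSymbol S k) := by
  rw [torusOp_eq]
  refine IsMultiplier.of_closure (fun x y hxy k => ?_) fun k w => ?_
  · rw [torusOpCore_graph hτ] at hxy
    exact torusOpCore_fiber hτ S hxy k
  · rw [torusOpCore_graph hτ]
    have h1 : (torusVec τ fun t => ((w t • smoothMonomial k : smoothTorus Θ) : NCTorus Θ),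
        torusOpVec τ S fun t => w t • smoothMonomial k) ∈ torusOpCore τ S :=
      Submodule.subset_span ⟨_, rfl⟩
    have h2 : torusOpVec τ S (fun t => w t • smoothMonomial k) =
        fiberVec (torusFourier hτ ι) k (Matrix.toEuclideanCLM (𝕜 := ℂ) (torusSymbol S k) w) := by
      refine fiber_ext (torusFourier hτ ι) fun l => ?_
      rw [torusOpCore_fiber hτ S h1 l, ← fiberVec_torusFourier hτ, fiberVec_apply, fiberVec_apply]
      split_ifs with h
      · rw [h]
      · rw [map_zero]
    rwa [h2, ← fiberVec_torusFourier hτ] at h1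

theorem torusOp_mem_graph (hτ : IsInvariantTrace τ) (S : Fin n → Matrix ι ι ℂ)
    (a : ι → smoothTorus Θ) :
    (torusVec τ fun t => (a t : NCTorus Θ), torusOpVec τ S a) ∈ (torusOp τ S).graph := by
  rw [isMultiplier_torusOp hτ]
  exact torusFourier_torusOpVec hτ S a

/-- A bounded operator on pairs of vectors that maps the smooth part of one graph into another
graph maps the whole graph into the other. -/
theorem torusOp_graph_induction (hτ : IsInvariantTrace τ) {S S' : Fin n → Matrix ι ι ℂ}
    (L : TorusHilbert τ ι × TorusHilbert τ ι →L[ℂ] TorusHilbert τ ι × TorusHilbert τ ι)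
    (hL : ∀ a : ι → smoothTorus Θ,
      L (torusVec τ fun t => (a t : NCTorus Θ), torusOpVec τ S a) ∈ (torusOp τ S').graph)
    {p : TorusHilbert τ ι × TorusHilbert τ ι} (hp : p ∈ (torusOp τ S).graph) :
    L p ∈ (torusOp τ S').graph := by
  have hcl : (torusOpCore τ S).toLinearPMap.IsClosable := by
    refine (isMultiplier_torusOp hτ S).isClosed.isClosable.leIsClosable ?_
    rw [torusOp_eq]
    exact LinearPMap.le_closure _
  have h1 : p ∈ (torusOpCore τ S).topologicalClosure := by
    rw [← torusOpCore_graph hτ, hcl.graph_closure_eq_closure_graph]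
    exact hp
  have h2 : torusOpCore τ S ≤ (torusOp τ S').graph.comap L.toLinearMap := by
    refine Submodule.span_le.2 ?_
    rintro _ ⟨a, rfl⟩
    exact hL a
  exact Submodule.topologicalClosure_minimal _ h2
    ((isMultiplier_torusOp hτ S').isClosed.preimage L.continuous) h1

/-- The representation of the `C*`-algebra on `L²(𝒜_Θ, τ) ⊗ ℂ^ι`. -/
def cstarRep (τ : NCTorus Θ →ₚ[ℂ] ℂ) (ι : Type) [Fintype ι] :
    NCTorus Θ →⋆ₐ[ℂ] (TorusHilbert τ ι →L[ℂ] TorusHilbert τ ι) :=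
  (amplify τ.GNS ι).comp τ.gnsStarAlgHom

theorem cstarRep_torusVec (a : NCTorus Θ) (b : ι → NCTorus Θ) :
    cstarRep τ ι a (torusVec τ b) = torusVec τ fun t => a * b t := by
  ext t
  exact gnsStarAlgHom_gnsVec τ a (b t)

theorem matrixOp_comm_cstarRep (M : Matrix ι ι ℂ) (a : NCTorus Θ) :
    matrixOp M * cstarRep τ ι a = cstarRep τ ι a * matrixOp M :=
  matrixOp_comm_diagOp M (τ.gnsStarAlgHom a)

theorem matrixOp_cstarRep_apply (M : Matrix ι ι ℂ) (a : NCTorus Θ) (x : TorusHilbert τ ι) :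
    matrixOp M (cstarRep τ ι a x) = cstarRep τ ι a (matrixOp M x) :=
  congrArg (fun T : TorusHilbert τ ι →L[ℂ] TorusHilbert τ ι => T x) (matrixOp_comm_cstarRep M a)

theorem torusVec_add (a b : ι → NCTorus Θ) :
    torusVec τ (fun t => a t + b t) = torusVec τ a + torusVec τ b := by
  ext t
  exact map_add (gnsMap τ) (a t) (b t)

/-- The bounded operator `∑ j, b j ⊗ S j`. -/
def torusClifford (τ : NCTorus Θ →ₚ[ℂ] ℂ) (b : Fin n → NCTorus Θ) (S : Fin n → Matrix ι ι ℂ) :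
    TorusHilbert τ ι →L[ℂ] TorusHilbert τ ι := ∑ j, cstarRep τ ι (b j) * matrixOp (S j)

theorem torusOpVec_mul (S : Fin n → Matrix ι ι ℂ) (a : smoothTorus Θ) (b : ι → smoothTorus Θ) :
    torusOpVec τ S (fun t => a * b t) = cstarRep τ ι a (torusOpVec τ S b) +
      torusClifford τ (fun j => torusDeriv j a) S (torusVec τ fun t => (b t : NCTorus Θ)) := by
  rw [torusOpVec, torusOpVec, torusClifford, map_sum, sum_apply, ← Finset.sum_add_distrib]
  refine Finset.sum_congr rfl fun j _ => ?_
  simp only [torusDeriv_mul]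
  rw [torusVec_add, map_add, add_comm, ← cstarRep_torusVec, ← cstarRep_torusVec,
    matrixOp_cstarRep_apply, matrixOp_cstarRep_apply]
  rfl

/-- By the Leibniz rule the commutator with a is Clifford multiplication by the derivatives of a,
which is bounded; the identity passes from smooth vectors to the closure by continuity. -/
theorem torusOp_commExtends (hτ : IsInvariantTrace τ) (S : Fin n → Matrix ι ι ℂ)
    (a : smoothTorus Θ) : CommExtends (torusOp τ S) (torusRep τ ι a)
      (torusClifford τ (fun j => torusDeriv j a) S) := by
  intro x y hxy
  let b := cstarRep τ ι (a : NCTorus Θ)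
  let C := torusClifford τ (fun j => torusDeriv j a) S
  refine torusOp_graph_induction hτ
    ((b.comp (ContinuousLinearMap.fst ℂ _ _)).prod
      (b.comp (ContinuousLinearMap.snd ℂ _ _) + C.comp (ContinuousLinearMap.fst ℂ _ _)))
    (fun v => ?_) hxy
  have h := torusOp_mem_graph hτ S fun t => a * v t
  rw [torusOpVec_mul] at h
  change (torusVec τ fun t => (a : NCTorus Θ) * v t, _) ∈ _ at h
  rw [← cstarRep_torusVec] at h
  exact h

theorem torusOpVec_mul_right {S R : Fin n → Matrix ι ι ℂ} {l : Fin n}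
    (hSR : ∀ j l, S j * R l = -(R l * S j)) (v : ι → smoothTorus Θ) :
    torusOpVec τ (fun j => S j * R l) v = -(matrixOp (R l) (torusOpVec τ S v)) := by
  have h : ∀ j, matrixOp (E := τ.GNS) (S j * R l) = -(matrixOp (R l) * matrixOp (S j)) := by
    intro j
    rw [hSR, matrixOp_neg, matrixOp_mul]
  simp only [torusOpVec, h, map_sum]
  rw [← Finset.sum_neg_distrib]
  rfl

/-- Since each S_j anticommutes with each R_l, the terms differentiating the vector cancel. What
remains involves only second derivatives of a and is bounded. -/
theorem torusOp_anticommExtends (hτ : IsInvariantTrace τ) {S R : Fin n → Matrix ι ι ℂ}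
    (hSR : ∀ j l, S j * R l = -(R l * S j)) (a : smoothTorus Θ) :
    ∃ E, AnticommExtends (torusOp τ S) (torusClifford τ (fun j => torusDeriv j a) R) E := by
  let C := torusClifford τ (fun j => torusDeriv j a) R
  let E := ∑ l, torusClifford τ (fun j => torusDeriv j (smoothDeriv l a)) (fun j => S j * R l)
  refine ⟨E, fun x y hxy => ?_⟩
  refine torusOp_graph_induction hτ
    ((C.comp (ContinuousLinearMap.fst ℂ _ _)).prod
      (E.comp (ContinuousLinearMap.fst ℂ _ _) - C.comp (ContinuousLinearMap.snd ℂ _ _)))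
    (fun v => ?_) hxy
  -- This is the contribution of the single term ∂_l a ⊗ R_l. Its graph condition is that of the
  -- operator with coefficients S_j R_l, applied to the vector ∂_l a · v.
  have key : ∀ l, (matrixOp (R l) (cstarRep τ ι (smoothDeriv l a : NCTorus Θ)
      (torusVec τ fun t => (v t : NCTorus Θ))),
      torusClifford τ (fun j => torusDeriv j (smoothDeriv l a)) (fun j => S j * R l)
        (torusVec τ fun t => (v t : NCTorus Θ)) -
      cstarRep τ ι (smoothDeriv l a : NCTorus Θ) (matrixOp (R l) (torusOpVec τ S v))) ∈
      (torusOp τ S).graph := by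
    intro l
    rw [isMultiplier_torusOp hτ]
    intro k
    have h1 := (isMultiplier_torusOp hτ (fun j => S j * R l) _ _).1
      (torusOp_mem_graph hτ (fun j => S j * R l) fun t => smoothDeriv l a * v t) k
    rw [isBoundedMultiplier_torus hτ]
    have h2 : torusSymbol S k * R l = torusSymbol (fun j => S j * R l) k := by
      simp only [torusSymbol, Finset.sum_mul, smul_mul_assoc]
    have h3 : ∀ w, Matrix.toEuclideanCLM (𝕜 := ℂ) (torusSymbol S k)
        (Matrix.toEuclideanCLM (𝕜 := ℂ) (R l) w) =
        Matrix.toEuclideanCLM (𝕜 := ℂ) (torusSymbol (fun j => S j * R l) k) w := by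
      intro w
      rw [← h2, map_mul]
      rfl
    rw [cstarRep_torusVec]
    refine Eq.trans ?_ (h1.trans (h3 _).symm)
    have h4 := torusOpVec_mul (τ := τ) (fun j => S j * R l) (smoothDeriv l a) v
    rw [torusOpVec_mul_right hSR v, map_neg (cstarRep τ ι (smoothDeriv l a : NCTorus Θ)), add_comm,
      ← sub_eq_add_neg] at h4
    rw [h4]
  have hsum := (torusOp τ S).graph.sum_mem (t := Finset.univ) fun l _ => key l
  convert hsum using 1
  refine Prod.ext ?_ ?_
  · rw [Prod.fst_sum]
    change C _ = _
    simp only [C, torusClifford, sum_apply]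
    refine Finset.sum_congr rfl fun l _ => ?_
    rw [matrixOp_cstarRep_apply]
    rfl
  · rw [Prod.snd_sum]
    change E _ - C _ = _
    simp only [Finset.sum_sub_distrib]
    congr 1
    · simp only [E, sum_apply]
      rfl
    · simp only [C, torusClifford, sum_apply]
      rfl

/-- Acting on the vector with constant component 1 recovers the GNS vector of a, whose squared norm
τ(a*a) vanishes only for a = 0. -/
theorem torusRep_injective [Nonempty ι] (hτ : IsInvariantTrace τ) :
    Function.Injective (torusRep τ ι) := by
  rw [injective_iff_map_eq_zero]
  intro a ha
  obtain ⟨t⟩ := ‹Nonempty ι›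
  have h1 := congrArg (fun T : TorusHilbert τ ι →L[ℂ] TorusHilbert τ ι =>
    T (torusVec τ fun _ => 1) t) ha
  have h2 : gnsVec τ ((a : NCTorus Θ) * 1) = 0 := by
    rw [← gnsStarAlgHom_gnsVec]
    exact h1
  rw [mul_one] at h2
  have h3 := inner_gnsVec τ (a : NCTorus Θ) a
  rw [h2, inner_zero_left] at h3
  exact Subtype.ext (hτ.faithful _ h3.symm)

theorem separable_torusHilbert (hτ : IsInvariantTrace τ) :
    TopologicalSpace.SeparableSpace (TorusHilbert τ ι) := by
  obtain ⟨b, -⟩ := exists_fiber_hilbertBasis (torusFourier hτ ι)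
  have h1 : (TopologicalSpace.IsSeparable (Set.univ : Set (TorusHilbert τ ι))) := by
    have h2 := ((Set.countable_range b).isSeparable.span (R := ℂ)).closure
    have h3 := b.dense_span
    rw [← Submodule.dense_iff_topologicalClosure_eq_top, dense_iff_closure_eq] at h3
    rwa [h3] at h2
  exact TopologicalSpace.isSeparable_univ_iff.1 h1

end TorusOperators

/-! ### Canonical anticommutation relations and second quantization. -/

theorem sum_smul_anticomm {α R : Type*} [Fintype α] [Ring R] [Algebra ℂ R] (a b : α → ℂ)
    (X Y : α → R) : (∑ j, a j • X j) * (∑ k, b k • Y k) + (∑ k, b k • Y k) * (∑ j, a j • X j) =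
      ∑ j, ∑ k, (a j * b k) • (X j * Y k + Y k * X j) := by
  simp only [Finset.sum_mul, Finset.mul_sum, smul_mul_smul_comm, smul_add, Finset.sum_add_distrib]
  congr 1
  · exact Finset.sum_comm
  · exact Finset.sum_congr rfl fun j _ => Finset.sum_congr rfl fun k _ => by rw [mul_comm (b k)]

namespace CliffordRep

variable {n : ℕ} (c : CliffordRep n)

theorem dSymbol_eq (j : Fin n) :
    c.dSymbol j = (1 / 2 : ℂ) • ((1 ⊗ₖ c.γ j) + Complex.I • (c.γ j ⊗ₖ c.σ)) := by
  rw [dSymbol, smul_neg, sub_neg_eq_add]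

theorem γ_anticomm' (j k : Fin n) :
    c.γ j * c.γ k + c.γ k * c.γ j = (if j = k then -2 else 0 : ℂ) • 1 := by
  rw [c.γ_anticomm]
  split_ifs
  · rw [neg_smul, ofNat_smul_eq_nsmul]
    norm_num
  · rw [zero_smul]

theorem kron_anticomm_one (j k : Fin n) :
    ((1 : Matrix _ _ ℂ) ⊗ₖ c.γ j) * (1 ⊗ₖ c.γ k) + (1 ⊗ₖ c.γ k) * (1 ⊗ₖ c.γ j) =
      (if j = k then -2 else 0 : ℂ) • (1 : Matrix c.Idx c.Idx ℂ) := by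
  rw [← Matrix.mul_kronecker_mul, ← Matrix.mul_kronecker_mul, ← Matrix.kronecker_add,
    c.γ_anticomm', Matrix.kronecker_smul, one_mul, Matrix.one_kronecker_one]

theorem kron_anticomm_σ (j k : Fin n) :
    (c.γ j ⊗ₖ c.σ) * (c.γ k ⊗ₖ c.σ) + (c.γ k ⊗ₖ c.σ) * (c.γ j ⊗ₖ c.σ) =
      (if j = k then -2 else 0 : ℂ) • (1 : Matrix c.Idx c.Idx ℂ) := by
  rw [← Matrix.mul_kronecker_mul, ← Matrix.mul_kronecker_mul, ← Matrix.add_kronecker,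
    c.γ_anticomm', Matrix.smul_kronecker, c.σ_sq, Matrix.one_kronecker_one]

/-- The factor σ makes the families X_j = 1 ⊗ γ_j and Y_j = γ_j ⊗ σ anticommute with each other, so
together they are 2n Clifford generators and A_j = (X_j + iY_j)/2. -/
theorem kron_anticomm_mixed (j k : Fin n) :
    ((1 : Matrix _ _ ℂ) ⊗ₖ c.γ j) * (c.γ k ⊗ₖ c.σ) + (c.γ k ⊗ₖ c.σ) * (1 ⊗ₖ c.γ j) = 0 := by
  rw [← Matrix.mul_kronecker_mul, ← Matrix.mul_kronecker_mul, one_mul, mul_one,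
    ← Matrix.kronecker_add, c.σ_anticomm, add_neg_cancel, Matrix.kronecker_zero]

theorem dSymbol_adj (j : Fin n) :
    (c.dSymbol j)ᴴ = (1 / 2 : ℂ) • (-(1 ⊗ₖ c.γ j) + Complex.I • (c.γ j ⊗ₖ c.σ)) := by
  rw [dSymbol_eq, Matrix.conjTranspose_smul, Matrix.conjTranspose_add, Matrix.conjTranspose_smul,
    Matrix.conjTranspose_kronecker, Matrix.conjTranspose_kronecker, c.γ_skew, c.σ_adj,
    Matrix.conjTranspose_one]
  have h1 : (1 : Matrix (Fin (2 ^ (n / 2))) (Fin (2 ^ (n / 2))) ℂ) ⊗ₖ (-c.γ j) =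
      -(1 ⊗ₖ c.γ j) := by
    rw [← neg_one_smul ℂ, Matrix.kronecker_smul, neg_one_smul]
  have h2 : (-c.γ j) ⊗ₖ c.σ = -(c.γ j ⊗ₖ c.σ) := by
    rw [← neg_one_smul ℂ, Matrix.smul_kronecker, neg_one_smul]
  rw [h1, h2]
  simp

/-- The squares contribute with opposite signs because i² = -1, and the mixed terms vanish. -/
theorem dSymbol_anticomm (j k : Fin n) :
    c.dSymbol j * c.dSymbol k + c.dSymbol k * c.dSymbol j = 0 := by
  have h1 := c.kron_anticomm_one j k
  have h2 := c.kron_anticomm_σ j k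
  have h3 := c.kron_anticomm_mixed j k
  have h4 := c.kron_anticomm_mixed k j
  simp only [dSymbol_eq, mul_add, add_mul, smul_mul_assoc, mul_smul_comm,
    smul_add, smul_smul]
  have hI := Complex.I_mul_I
  set X := fun j => (1 : Matrix (Fin (2 ^ (n / 2))) (Fin (2 ^ (n / 2))) ℂ) ⊗ₖ c.γ j
  set Y := fun j => c.γ j ⊗ₖ c.σ
  calc _ = (1 / 4 : ℂ) • (X j * X k + X k * X j) +
        (1 / 4 * (Complex.I * Complex.I) : ℂ) • (Y j * Y k + Y k * Y j) +
        (1 / 4 * Complex.I : ℂ) • (X j * Y k + Y k * X j) +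
        (1 / 4 * Complex.I : ℂ) • (X k * Y j + Y j * X k) := by module
    _ = 0 := by
      rw [h1, h2, h3, h4, hI]
      module

/-- Taking the adjoint flips the sign of X_k only, so the contributions that cancelled before now
add up, each giving one half. -/
theorem dSymbol_anticomm_adj (j k : Fin n) :
    c.dSymbol j * (c.dSymbol k)ᴴ + (c.dSymbol k)ᴴ * c.dSymbol j =
      (if j = k then 1 else 0 : ℂ) • 1 := by
  have h1 := c.kron_anticomm_one j k
  have h2 := c.kron_anticomm_σ j k
  have h3 := c.kron_anticomm_mixed j k
  have h4 := c.kron_anticomm_mixed k j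
  rw [dSymbol_adj]
  simp only [dSymbol_eq, mul_add, add_mul, smul_mul_assoc, mul_smul_comm,
    smul_add, smul_smul, mul_neg, neg_mul, smul_neg]
  have hI := Complex.I_mul_I
  set X := fun j => (1 : Matrix (Fin (2 ^ (n / 2))) (Fin (2 ^ (n / 2))) ℂ) ⊗ₖ c.γ j
  set Y := fun j => c.γ j ⊗ₖ c.σ
  calc _ = (-(1 / 4) : ℂ) • (X j * X k + X k * X j) +
        (1 / 4 * (Complex.I * Complex.I) : ℂ) • (Y j * Y k + Y k * Y j) +
        (1 / 4 * Complex.I : ℂ) • (X j * Y k + Y k * X j) -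
        (1 / 4 * Complex.I : ℂ) • (X k * Y j + Y j * X k) := by module
    _ = _ := by
      rw [h1, h2, h3, h4, hI]
      split_ifs <;> module

/-- The matrix of the grading operator. -/
def gradingMatrix : Matrix c.Idx c.Idx ℂ := c.σ ⊗ₖ c.σ

/-- The matrix of the Hodge operator. -/
def hodgeMatrix : Matrix c.Idx c.Idx ℂ := 1 ⊗ₖ c.σ

theorem gradingMatrix_adj : c.gradingMatrixᴴ = c.gradingMatrix := by
  rw [gradingMatrix, Matrix.conjTranspose_kronecker, c.σ_adj]

theorem gradingMatrix_sq : c.gradingMatrix * c.gradingMatrix = 1 := by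
  rw [gradingMatrix, ← Matrix.mul_kronecker_mul, c.σ_sq, Matrix.one_kronecker_one]

theorem hodgeMatrix_adj : c.hodgeMatrixᴴ = c.hodgeMatrix := by
  rw [hodgeMatrix, Matrix.conjTranspose_kronecker, c.σ_adj, Matrix.conjTranspose_one]

theorem hodgeMatrix_sq : c.hodgeMatrix * c.hodgeMatrix = 1 := by
  rw [hodgeMatrix, ← Matrix.mul_kronecker_mul, c.σ_sq, one_mul, Matrix.one_kronecker_one]

theorem neg_kronecker' {α β : Type*} (M : Matrix α α ℂ) (N : Matrix β β ℂ) :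
    (-M) ⊗ₖ N = -(M ⊗ₖ N) := by
  rw [← neg_one_smul ℂ, Matrix.smul_kronecker, neg_one_smul]

theorem kronecker_neg' {α β : Type*} (M : Matrix α α ℂ) (N : Matrix β β ℂ) :
    M ⊗ₖ (-N) = -(M ⊗ₖ N) := by
  rw [← neg_one_smul ℂ, Matrix.kronecker_smul, neg_one_smul]

theorem gradingMatrix_mul_dSymbol (j : Fin n) :
    c.gradingMatrix * c.dSymbol j = -(c.dSymbol j * c.gradingMatrix) := by
  have h1 : c.gradingMatrix * (1 ⊗ₖ c.γ j) = -((1 ⊗ₖ c.γ j) * c.gradingMatrix) := by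
    rw [gradingMatrix, ← Matrix.mul_kronecker_mul, ← Matrix.mul_kronecker_mul, c.σ_anticomm,
      kronecker_neg', one_mul, mul_one]
  have h2 : c.gradingMatrix * (c.γ j ⊗ₖ c.σ) = -((c.γ j ⊗ₖ c.σ) * c.gradingMatrix) := by
    rw [gradingMatrix, ← Matrix.mul_kronecker_mul, ← Matrix.mul_kronecker_mul, c.σ_anticomm,
      neg_kronecker']
  rw [dSymbol_eq, mul_smul_comm, mul_add, mul_smul_comm, h1, h2, smul_mul_assoc, add_mul,
    smul_mul_assoc]
  module

/-- Conjugation by 1 ⊗ σ negates X_j and fixes Y_j, exactly as the adjoint does to the combination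
X_j + iY_j. -/
theorem hodgeMatrix_mul_dSymbol (j : Fin n) :
    c.hodgeMatrix * c.dSymbol j = (c.dSymbol j)ᴴ * c.hodgeMatrix := by
  have h1 : c.hodgeMatrix * (1 ⊗ₖ c.γ j) = -((1 ⊗ₖ c.γ j) * c.hodgeMatrix) := by
    rw [hodgeMatrix, ← Matrix.mul_kronecker_mul, ← Matrix.mul_kronecker_mul, c.σ_anticomm,
      kronecker_neg']
  have h2 : c.hodgeMatrix * (c.γ j ⊗ₖ c.σ) = (c.γ j ⊗ₖ c.σ) * c.hodgeMatrix := by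
    rw [hodgeMatrix, ← Matrix.mul_kronecker_mul, ← Matrix.mul_kronecker_mul, one_mul, mul_one]
  rw [dSymbol_adj, dSymbol_eq, mul_smul_comm, mul_add, mul_smul_comm, h1, h2, smul_mul_assoc,
    add_mul, smul_mul_assoc, neg_mul]

/-- The creation operator `∑ j, v j A j`, for the coefficients `A j` of the differential. -/
def creation (v : Fin n → ℂ) : Matrix c.Idx c.Idx ℂ := ∑ j, v j • c.dSymbol j

theorem creation_add (u v : Fin n → ℂ) : c.creation (u + v) = c.creation u + c.creation v := by
  simp [creation, add_smul, Finset.sum_add_distrib]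

theorem creation_neg (v : Fin n → ℂ) : c.creation (-v) = -c.creation v := by
  simp [creation]

theorem creation_anticomm (u v : Fin n → ℂ) :
    c.creation u * c.creation v + c.creation v * c.creation u = 0 := by
  rw [creation, creation, sum_smul_anticomm]
  simp [dSymbol_anticomm]

theorem creation_sq (v : Fin n → ℂ) : c.creation v * c.creation v = 0 := by
  have h := c.creation_anticomm v v
  rw [← two_smul ℂ] at h
  exact (smul_eq_zero.1 h).resolve_left two_ne_zero

theorem creation_adj (v : Fin n → ℂ) : (c.creation v)ᴴ = ∑ j, star (v j) • (c.dSymbol j)ᴴ := by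
  simp [creation, Matrix.conjTranspose_sum]

theorem creation_anticomm_adj (u v : Fin n → ℂ) :
    c.creation u * (c.creation v)ᴴ + (c.creation v)ᴴ * c.creation u = (u ⬝ᵥ star v) • 1 := by
  rw [creation_adj, creation, sum_smul_anticomm]
  simp only [dSymbol_anticomm_adj, smul_smul, mul_ite, mul_one, mul_zero, ← Finset.sum_smul,
    Finset.sum_ite_eq, Finset.mem_univ, if_true]
  rfl

theorem gradingMatrix_mul_creation (v : Fin n → ℂ) :
    c.gradingMatrix * c.creation v = -(c.creation v * c.gradingMatrix) := by
  rw [creation, Finset.mul_sum, Finset.sum_mul, ← Finset.sum_neg_distrib]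
  refine Finset.sum_congr rfl fun j _ => ?_
  rw [mul_smul_comm, gradingMatrix_mul_dSymbol, smul_mul_assoc, smul_neg]

theorem hodgeMatrix_mul_creation (v : Fin n → ℂ) :
    c.hodgeMatrix * c.creation v = (c.creation (star v))ᴴ * c.hodgeMatrix := by
  rw [creation_adj, creation, Finset.mul_sum, Finset.sum_mul]
  refine Finset.sum_congr rfl fun j _ => ?_
  rw [mul_smul_comm, hodgeMatrix_mul_dSymbol, smul_mul_assoc, Pi.star_apply, star_star]

/-- The second quantization `∑ j k, P j k A j (A k)*` of a matrix. -/
def secondQuant (P : Matrix (Fin n) (Fin n) ℂ) : Matrix c.Idx c.Idx ℂ :=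
  ∑ j, ∑ k, P j k • (c.dSymbol j * (c.dSymbol k)ᴴ)

theorem secondQuant_sub (P Q : Matrix (Fin n) (Fin n) ℂ) :
    c.secondQuant (P - Q) = c.secondQuant P - c.secondQuant Q := by
  simp [secondQuant, sub_smul, Finset.sum_sub_distrib]

theorem secondQuant_adj (P : Matrix (Fin n) (Fin n) ℂ) :
    (c.secondQuant P)ᴴ = c.secondQuant Pᴴ := by
  simp only [secondQuant, Matrix.conjTranspose_sum, Matrix.conjTranspose_smul,
    Matrix.conjTranspose_mul, Matrix.conjTranspose_conjTranspose, Matrix.conjTranspose_apply]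
  rw [Finset.sum_comm]

theorem dSymbol_mul_adj_mul_creation (j k : Fin n) (v : Fin n → ℂ) :
    c.dSymbol j * (c.dSymbol k)ᴴ * c.creation v =
      c.creation v * (c.dSymbol j * (c.dSymbol k)ᴴ) + v k • c.dSymbol j := by
  have hj : c.dSymbol j = c.creation (Pi.single j 1) := by
    simp [creation, Pi.single_apply]
  have hk : c.dSymbol k = c.creation (Pi.single k 1) := by
    simp [creation, Pi.single_apply]
  have h1 := c.creation_anticomm_adj v (Pi.single k 1)
  have h2 := c.creation_anticomm (Pi.single j 1) v
  rw [← hk] at h1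
  rw [← hj] at h2
  have h3 : v ⬝ᵥ star (Pi.single k 1 : Fin n → ℂ) = v k := by
    simp
  rw [h3] at h1
  calc c.dSymbol j * (c.dSymbol k)ᴴ * c.creation v
      = c.dSymbol j * (c.creation v * (c.dSymbol k)ᴴ + (c.dSymbol k)ᴴ * c.creation v) -
        (c.dSymbol j * c.creation v + c.creation v * c.dSymbol j) * (c.dSymbol k)ᴴ +
        c.creation v * (c.dSymbol j * (c.dSymbol k)ᴴ) := by noncomm_ring
    _ = _ := by
      rw [h1, h2, zero_mul, sub_zero, mul_smul_comm, mul_one, add_comm]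

/-- This is the Fock space relation [dΓ(P), a(v)] = a(Pv). For an idempotent P it makes dΓ(P) raise
the degree by one along the range of P and by zero along the kernel. -/
theorem secondQuant_mul_creation (P : Matrix (Fin n) (Fin n) ℂ) (v : Fin n → ℂ) :
    c.secondQuant P * c.creation v = c.creation v * c.secondQuant P + c.creation (P *ᵥ v) := by
  have h : c.creation (P *ᵥ v) = ∑ j, ∑ k, P j k • v k • c.dSymbol j := by
    rw [creation]
    refine Finset.sum_congr rfl fun j _ => ?_
    rw [Matrix.mulVec, dotProduct, Finset.sum_smul]
    refine Finset.sum_congr rfl fun k _ => ?_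
    rw [mul_smul]
  rw [h, secondQuant]
  simp only [Finset.sum_mul, Finset.mul_sum, smul_mul_assoc, mul_smul_comm,
    dSymbol_mul_adj_mul_creation, smul_add, Finset.sum_add_distrib]

/-- The number operator dΓ(1) commutes with anything preserving the degree, such as a product of one
creation and one annihilation operator. As dΓ(1 - P) = dΓ(1) - dΓ(P), this yields [T, T̄] = 0. -/
theorem secondQuant_comm_one (P : Matrix (Fin n) (Fin n) ℂ) :
    c.secondQuant 1 * c.secondQuant P = c.secondQuant P * c.secondQuant 1 := by
  have h1 : ∀ j, c.secondQuant 1 * c.dSymbol j = c.dSymbol j * c.secondQuant 1 + c.dSymbol j := by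
    intro j
    have hj : c.dSymbol j = c.creation (Pi.single j 1) := by
      simp [creation, Pi.single_apply]
    have := c.secondQuant_mul_creation 1 (Pi.single j 1)
    rwa [Matrix.one_mulVec, ← hj] at this
  have h2 : ∀ j, c.secondQuant 1 * (c.dSymbol j)ᴴ =
      (c.dSymbol j)ᴴ * c.secondQuant 1 - (c.dSymbol j)ᴴ := by
    intro j
    have := congrArg Matrix.conjTranspose (h1 j)
    rw [Matrix.conjTranspose_mul, Matrix.conjTranspose_add, Matrix.conjTranspose_mul,
      secondQuant_adj, Matrix.conjTranspose_one] at this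
    rw [this, add_sub_cancel_right]
  have h3 : ∀ j k, c.secondQuant 1 * (c.dSymbol j * (c.dSymbol k)ᴴ) =
      c.dSymbol j * (c.dSymbol k)ᴴ * c.secondQuant 1 := by
    intro j k
    rw [← mul_assoc, h1, add_mul, mul_assoc, h2]
    noncomm_ring
  have h4 : c.secondQuant P = ∑ j, ∑ k, P j k • (c.dSymbol j * (c.dSymbol k)ᴴ) := rfl
  rw [h4]
  simp only [Finset.sum_mul, Finset.mul_sum, smul_mul_assoc, mul_smul_comm, h3]

theorem gradingMatrix_comm_secondQuant (P : Matrix (Fin n) (Fin n) ℂ) :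
    c.gradingMatrix * c.secondQuant P = c.secondQuant P * c.gradingMatrix := by
  have h2 : ∀ j, c.gradingMatrix * (c.dSymbol j)ᴴ = -((c.dSymbol j)ᴴ * c.gradingMatrix) := by
    intro j
    have := congrArg Matrix.conjTranspose (c.gradingMatrix_mul_dSymbol j)
    rw [Matrix.conjTranspose_mul, Matrix.conjTranspose_neg, Matrix.conjTranspose_mul,
      gradingMatrix_adj] at this
    rw [this, neg_neg]
  have h3 : ∀ j k, c.gradingMatrix * (c.dSymbol j * (c.dSymbol k)ᴴ) =
      c.dSymbol j * (c.dSymbol k)ᴴ * c.gradingMatrix := by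
    intro j k
    rw [← mul_assoc, gradingMatrix_mul_dSymbol, neg_mul, mul_assoc, h2, mul_neg, neg_neg, mul_assoc]
  simp only [secondQuant, Finset.sum_mul, Finset.mul_sum, smul_mul_assoc, mul_smul_comm, h3]

/-- Anticommuting with the adjoint of A_k extracts the k-th coefficient. -/
theorem creation_injective {u v : Fin n → ℂ} (h : c.creation u = c.creation v) : u = v := by
  funext k
  have h0 : c.creation (u - v) = 0 := by
    rw [sub_eq_add_neg, creation_add, creation_neg, h, add_neg_cancel]
  have h1 := c.creation_anticomm_adj (u - v) (Pi.single k 1)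
  rw [h0, zero_mul, mul_zero, add_zero] at h1
  have h3 : (u - v) ⬝ᵥ star (Pi.single k 1 : Fin n → ℂ) = u k - v k := by
    simp
  rw [h3] at h1
  have h4 := (smul_eq_zero.1 h1.symm).resolve_right one_ne_zero
  exact sub_eq_zero.1 h4

end CliffordRep

/-! ### Construction of Clifford matrices. -/

section Existence

/-- Skew-adjoint Clifford generators indexed by `κ`, with a grading, in matrices indexed by `ι`. -/
def HasCliffordMatrices (κ ι : Type) [Fintype ι] [DecidableEq ι] [DecidableEq κ] : Prop :=
  ∃ (γ : κ → Matrix ι ι ℂ) (σ : Matrix ι ι ℂ), (∀ j, (γ j)ᴴ = -γ j) ∧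
    (∀ j k, γ j * γ k + γ k * γ j = if j = k then -2 else 0) ∧ σᴴ = σ ∧ σ * σ = 1 ∧
    ∀ j, σ * γ j = -(γ j * σ)

theorem HasCliffordMatrices.congr {κ κ' ι ι' : Type} [Fintype ι] [DecidableEq ι] [DecidableEq κ]
    [Fintype ι'] [DecidableEq ι'] [DecidableEq κ'] (h : HasCliffordMatrices κ ι) (e : κ' ≃ κ)
    (f : ι ≃ ι') : HasCliffordMatrices κ' ι' := by
  obtain ⟨γ, σ, h1, h2, h3, h4, h5⟩ := h
  let φ := Matrix.reindexAlgEquiv ℂ ℂ f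
  have hφ : ∀ M : Matrix ι ι ℂ, (φ M)ᴴ = φ Mᴴ := fun M => rfl
  refine ⟨fun j => φ (γ (e j)), φ σ, fun j => ?_, fun j k => ?_, ?_, ?_, fun j => ?_⟩
  · rw [hφ, h1, map_neg]
  · rw [← map_mul, ← map_mul, ← map_add, h2]
    simp only [e.injective.eq_iff]
    split_ifs
    · rw [map_neg, map_ofNat]
    · rw [map_zero]
  · rw [hφ, h3]
  · rw [← map_mul, h4, map_one]
  · rw [← map_mul, h5, map_neg, map_mul]

theorem hasCliffordMatrices_empty : HasCliffordMatrices (Fin 0) (Fin 1) :=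
  ⟨fun j => j.elim0, 1, fun j => j.elim0, fun j => j.elim0, Matrix.conjTranspose_one, one_mul 1,
    fun j => j.elim0⟩

theorem matrix_neg_two {α : Type} [Fintype α] [DecidableEq α] :
    (-2 : Matrix α α ℂ) = (-2 : ℂ) • 1 := by
  rw [neg_smul, ofNat_smul_eq_nsmul]
  norm_num

/-- The skew-adjoint Pauli matrices. -/
def skewPauli : Fin 2 → Matrix (Fin 2) (Fin 2) ℂ :=
  ![!![0, Complex.I; Complex.I, 0], !![0, 1; -1, 0]]

/-- The diagonal Pauli matrix. -/
def pauliZ : Matrix (Fin 2) (Fin 2) ℂ := !![1, 0; 0, -1]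

/-- Old generators are tensored with 1; the two new ones are Pauli matrices tensored with the old
grading, which makes them anticommute with the old. The dimension doubles for every two generators.
-/
theorem HasCliffordMatrices.step {κ ι : Type} [Fintype ι] [DecidableEq ι] [DecidableEq κ]
    (h : HasCliffordMatrices κ ι) : HasCliffordMatrices (κ ⊕ Fin 2) (ι × Fin 2) := by
  obtain ⟨γ, σ, h1, h2, h3, h4, h5⟩ := h
  have p1 : ∀ a, (skewPauli a)ᴴ = -skewPauli a := by
    intro a
    fin_cases a <;> ext i j <;> fin_cases i <;> fin_cases j <;> simp [skewPauli]
  have p2 : ∀ a b, skewPauli a * skewPauli b + skewPauli b * skewPauli a =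
      if a = b then -2 else 0 := by
    intro a b
    rw [matrix_neg_two]
    fin_cases a <;> fin_cases b <;> ext i j <;> fin_cases i <;> fin_cases j <;>
      norm_num [skewPauli]
  have p3 : pauliZᴴ = pauliZ := by
    ext i j
    fin_cases i <;> fin_cases j <;> simp [pauliZ]
  have p4 : pauliZ * pauliZ = 1 := by
    ext i j
    fin_cases i <;> fin_cases j <;> simp [pauliZ]
  have p5 : ∀ a, pauliZ * skewPauli a = -(skewPauli a * pauliZ) := by
    intro a
    fin_cases a <;> ext i j <;> fin_cases i <;> fin_cases j <;>
      simp [skewPauli, pauliZ, Matrix.mul_apply, Fin.sum_univ_two]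
  have hγσ : ∀ j, γ j * σ = -(σ * γ j) := fun j => by rw [h5, neg_neg]
  refine ⟨Sum.elim (fun j => γ j ⊗ₖ 1) (fun a => σ ⊗ₖ skewPauli a), σ ⊗ₖ pauliZ, ?_, ?_, ?_, ?_, ?_⟩
  · rintro (j | a)
    · rw [Sum.elim_inl, Matrix.conjTranspose_kronecker, h1, Matrix.conjTranspose_one,
        CliffordRep.neg_kronecker']
    · rw [Sum.elim_inr, Matrix.conjTranspose_kronecker, h3, p1, CliffordRep.kronecker_neg']
  · have two : ∀ {α β : Type} [Fintype α] [Fintype β] [DecidableEq α] [DecidableEq β],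
        (-2 : Matrix (α × β) (α × β) ℂ) = (1 : Matrix α α ℂ) ⊗ₖ (-2 : Matrix β β ℂ) ∧
        (-2 : Matrix (α × β) (α × β) ℂ) = (-2 : Matrix α α ℂ) ⊗ₖ (1 : Matrix β β ℂ) := by
      intro α β _ _ _ _
      rw [matrix_neg_two, matrix_neg_two, matrix_neg_two, Matrix.kronecker_smul, Matrix.smul_kronecker, Matrix.one_kronecker_one]
      exact ⟨rfl, rfl⟩
    rintro (j | a) (k | b)
    · simp only [Sum.elim_inl, Sum.inl.injEq]
      rw [← Matrix.mul_kronecker_mul, ← Matrix.mul_kronecker_mul, ← Matrix.add_kronecker, h2,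
        one_mul]
      split_ifs
      · exact two.2.symm
      · exact Matrix.zero_kronecker _
    · simp only [Sum.elim_inl, Sum.elim_inr, reduceCtorEq, if_false]
      rw [← Matrix.mul_kronecker_mul, ← Matrix.mul_kronecker_mul, hγσ, one_mul, mul_one,
        CliffordRep.neg_kronecker', neg_add_cancel]
    · simp only [Sum.elim_inl, Sum.elim_inr, reduceCtorEq, if_false]
      rw [← Matrix.mul_kronecker_mul, ← Matrix.mul_kronecker_mul, hγσ, one_mul, mul_one,
        CliffordRep.neg_kronecker', add_neg_cancel]
    · simp only [Sum.elim_inr, Sum.inr.injEq]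
      rw [← Matrix.mul_kronecker_mul, ← Matrix.mul_kronecker_mul, ← Matrix.kronecker_add, p2, h4]
      split_ifs
      · exact two.1.symm
      · exact Matrix.kronecker_zero _
  · rw [Matrix.conjTranspose_kronecker, h3, p3]
  · rw [← Matrix.mul_kronecker_mul, h4, p4, Matrix.one_kronecker_one]
  · rintro (j | a)
    · rw [Sum.elim_inl, ← Matrix.mul_kronecker_mul, ← Matrix.mul_kronecker_mul, h5, one_mul,
        mul_one, CliffordRep.neg_kronecker']
    · rw [Sum.elim_inr, ← Matrix.mul_kronecker_mul, ← Matrix.mul_kronecker_mul, p5,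
        CliffordRep.kronecker_neg']

theorem hasCliffordMatrices (m : ℕ) : HasCliffordMatrices (Fin (2 * m)) (Fin (2 ^ m)) := by
  induction m with
  | zero => exact hasCliffordMatrices_empty
  | succ m ih =>
    exact ih.step.congr finSumFinEquiv.symm finProdFinEquiv

theorem nonempty_cliffordRep {n : ℕ} (hn : Even n) : Nonempty (CliffordRep n) := by
  obtain ⟨m, hm⟩ := hn
  have h := hasCliffordMatrices m
  have h2 : HasCliffordMatrices (Fin n) (Fin (2 ^ (n / 2))) :=
    h.congr (finCongr (by omega)) (finCongr (by congr 1; omega))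
  obtain ⟨γ, σ, h1, h2, h3, h4, h5⟩ := h2
  exact ⟨⟨γ, σ, h1, h2, h3, h4, h5⟩⟩

end Existence

/-! ### Polarizations and the splitting of frequencies. -/

section Frequencies

variable {n : ℕ}

/-- The symbol `i k` of the gradient. -/
def freq (k : Fin n → ℤ) : Fin n → ℂ := fun l => Complex.I * k l

theorem star_freq (k : Fin n → ℤ) : star (freq k) = -freq k := by
  funext l
  simp [freq]

theorem freq_dotProduct_self (k : Fin n → ℤ) :
    freq k ⬝ᵥ freq k = -((∑ j, (k j : ℝ) ^ 2 : ℝ) : ℂ) := by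
  simp only [freq, dotProduct]
  push_cast
  rw [← Finset.sum_neg_distrib]
  refine Finset.sum_congr rfl fun j _ => ?_
  linear_combination (k j : ℂ) ^ 2 * Complex.I_mul_I

/-- The projection `P` onto the holomorphic part of `ℂⁿ` for an orthogonal complex structure on
`ℝⁿ`: a self-adjoint idempotent whose complex conjugate is the complementary idempotent. -/
structure IsPolarization {κ : Type*} [Fintype κ] [DecidableEq κ] (P : Matrix κ κ ℂ) : Prop where
  herm : Pᴴ = P
  idem : P * P = P
  conj : P.map star = 1 - P

namespace IsPolarization

variable {P : Matrix (Fin n) (Fin n) ℂ}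

theorem compl (hP : IsPolarization P) : IsPolarization (1 - P) where
  herm := by rw [Matrix.conjTranspose_sub, Matrix.conjTranspose_one, hP.herm]
  idem := by rw [mul_sub, sub_mul, sub_mul, hP.idem]; simp
  conj := by
    have h : (1 - P).map star = (1 : Matrix (Fin n) (Fin n) ℂ).map star - P.map star :=
      Matrix.map_sub _ (fun a b => star_sub a b) 1 P
    rw [h, hP.conj, Matrix.map_one _ (star_zero ℂ) (star_one ℂ)]

/-- For a Hermitian matrix the transpose is the complex conjugate. Hence the bilinear form pairs the
range of P only with that of 1 - P, that is, both ranges are isotropic. -/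
theorem transpose (hP : IsPolarization P) : Pᵀ = 1 - P := by
  rw [← hP.conj]
  nth_rewrite 1 [← hP.herm]
  rfl

theorem star_mulVec_freq (hP : IsPolarization P) (k : Fin n → ℤ) :
    star (P *ᵥ freq k) = -((1 - P) *ᵥ freq k) := by
  rw [Matrix.star_mulVec, hP.herm, ← Matrix.mulVec_transpose, hP.transpose, star_freq,
    Matrix.mulVec_neg]

theorem mulVec_dotProduct (hP : IsPolarization P) (u v : Fin n → ℂ) :
    (P *ᵥ u) ⬝ᵥ v = u ⬝ᵥ ((1 - P) *ᵥ v) := by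
  rw [← hP.transpose, Matrix.dotProduct_mulVec, Matrix.vecMul_transpose]

/-- Moving P across the bilinear form shows that P and 1 - P contribute equally to ik · ik = -|k|²,
so each part has squared length |k|²/2. This balance makes the two Laplacians coincide. -/
theorem dotProduct_star_self (hP : IsPolarization P) (k : Fin n → ℤ) :
    (P *ᵥ freq k) ⬝ᵥ star (P *ᵥ freq k) = ((1 / 2 * ∑ j, (k j : ℝ) ^ 2 : ℝ) : ℂ) := by
  have h1 : (P *ᵥ freq k) ⬝ᵥ freq k + ((1 - P) *ᵥ freq k) ⬝ᵥ freq k = freq k ⬝ᵥ freq k := by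
    rw [← add_dotProduct, ← Matrix.add_mulVec, add_sub_cancel, Matrix.one_mulVec]
  have h2 : ((1 - P) *ᵥ freq k) ⬝ᵥ freq k = (P *ᵥ freq k) ⬝ᵥ freq k := by
    rw [hP.compl.mulVec_dotProduct, sub_sub_cancel, dotProduct_comm]
  rw [h2, freq_dotProduct_self] at h1
  rw [hP.star_mulVec_freq, dotProduct_neg, hP.mulVec_dotProduct, Matrix.mulVec_mulVec,
    hP.compl.idem, ← hP.mulVec_dotProduct]
  push_cast at h1 ⊢
  linear_combination (-1 / 2 : ℂ) * h1

theorem dotProduct_star_compl (hP : IsPolarization P) (k : Fin n → ℤ) :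
    (P *ᵥ freq k) ⬝ᵥ star ((1 - P) *ᵥ freq k) = 0 := by
  rw [hP.compl.star_mulVec_freq, sub_sub_cancel, dotProduct_neg, hP.mulVec_dotProduct,
    Matrix.mulVec_mulVec, sub_mul, one_mul, hP.idem, sub_self, Matrix.zero_mulVec,
    dotProduct_zero, neg_zero]

end IsPolarization

end Frequencies

/-! ### Verification of the spectral data and Kähler axioms. -/

namespace CliffordRep

variable {n : ℕ} {Θ : Matrix (Fin n) (Fin n) ℝ} {τ : NCTorus Θ →ₚ[ℂ] ℂ} (c : CliffordRep n)

instance : Nonempty c.Idx := ⟨(⟨0, by positivity⟩, ⟨0, by positivity⟩)⟩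

/-- Matrices as operators on the fibers of the Fourier decomposition. -/
abbrev fiberOp : Matrix c.Idx c.Idx ℂ → EuclideanSpace ℂ c.Idx →L[ℂ] EuclideanSpace ℂ c.Idx :=
  Matrix.toEuclideanCLM (n := c.Idx) (𝕜 := ℂ)

theorem fiberOp_adjoint (M : Matrix c.Idx c.Idx ℂ) :
    (c.fiberOp M).adjoint = c.fiberOp Mᴴ := by
  rw [← ContinuousLinearMap.star_eq_adjoint, ← map_star, Matrix.star_eq_conjTranspose]

/-- The coefficients of the holomorphic part of the differential. -/
def holSymbol (P : Matrix (Fin n) (Fin n) ℂ) (l : Fin n) : Matrix c.Idx c.Idx ℂ :=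
  c.creation fun j => P j l

theorem torusSymbol_holSymbol (P : Matrix (Fin n) (Fin n) ℂ) (k : Fin n → ℤ) :
    torusSymbol (c.holSymbol P) k = c.creation (P *ᵥ freq k) := by
  simp only [torusSymbol, holSymbol, creation, Finset.smul_sum]
  rw [Finset.sum_comm]
  refine Finset.sum_congr rfl fun j _ => ?_
  rw [Matrix.mulVec, dotProduct, Finset.sum_smul]
  refine Finset.sum_congr rfl fun l _ => ?_
  rw [smul_smul, mul_comm]
  rfl

theorem isMultiplier_d (hτ : IsInvariantTrace τ) : IsMultiplier (torusFourier hτ c.Idx) (c.d τ)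
    fun k => c.fiberOp (c.creation (freq k)) :=
  isMultiplier_torusOp hτ c.dSymbol

theorem isMultiplier_hol (hτ : IsInvariantTrace τ) (P : Matrix (Fin n) (Fin n) ℂ) :
    IsMultiplier (torusFourier hτ c.Idx) (torusOp τ (c.holSymbol P))
      fun k => c.fiberOp (c.creation (P *ᵥ freq k)) :=
  (isMultiplier_torusOp hτ (c.holSymbol P)).congr fun k => by rw [torusSymbol_holSymbol]

theorem fiberOp_creation_sq (v : Fin n → ℂ) :
    c.fiberOp (c.creation v) * c.fiberOp (c.creation v) = 0 := by
  rw [← map_mul, creation_sq, map_zero]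

theorem fiberOp_creation_anticomm_adjoint {u v : Fin n → ℂ} {r : ℂ} (h : u ⬝ᵥ star v = r) :
    c.fiberOp (c.creation u) * (c.fiberOp (c.creation v)).adjoint +
      (c.fiberOp (c.creation v)).adjoint * c.fiberOp (c.creation u) = r • 1 := by
  rw [fiberOp_adjoint, ← map_mul, ← map_mul, ← map_add, creation_anticomm_adj, h, map_smul, map_one]

theorem isBoundedMultiplier_matrixOp (hτ : IsInvariantTrace τ) (M : Matrix c.Idx c.Idx ℂ) :
    IsBoundedMultiplier (torusFourier hτ c.Idx) (matrixOp M) fun _ => c.fiberOp M :=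
  isBoundedMultiplier_torus hτ M

theorem hodgeMatrix_injective :
    Function.Injective (c.fiberOp c.hodgeMatrix) := by
  intro x y h
  have h1 := congrArg (c.fiberOp c.hodgeMatrix) h
  rw [← mul_apply_eq_comp, ← mul_apply_eq_comp, ← map_mul, hodgeMatrix_sq, map_one] at h1
  exact h1

/-- Operators with symbols `A (v k)` and `A (u k)` are intertwined by the Hodge operator if
`star (v k) = - u k`. -/
theorem hodgeRel (hτ : IsInvariantTrace τ) {A B : TorusHilbert τ c.Idx →ₗ.[ℂ] TorusHilbert τ c.Idx}
    {v u : (Fin n → ℤ) → Fin n → ℂ}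
    (hA : IsMultiplier (torusFourier hτ c.Idx) A fun k => c.fiberOp (c.creation (v k)))
    (hB : IsMultiplier (torusFourier hτ c.Idx) B fun k => c.fiberOp (c.creation (u k)))
    (h : ∀ k, star (v k) = -u k) : HodgeRel (c.hodge τ) (-1) A B.adjoint := by
  refine hA.hodgeRel hB.adjoint (c.isBoundedMultiplier_matrixOp hτ c.hodgeMatrix)
    (fun _ => c.hodgeMatrix_injective) (by norm_num) fun k => ?_
  rw [fiberOp_adjoint, ← map_mul, ← map_mul, hodgeMatrix_mul_creation, h k, creation_neg,
    Matrix.conjTranspose_neg, neg_mul, map_neg, neg_one_smul]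

theorem bddAnticommZero_grading (hτ : IsInvariantTrace τ)
    {A : TorusHilbert τ c.Idx →ₗ.[ℂ] TorusHilbert τ c.Idx} {v : (Fin n → ℤ) → Fin n → ℂ}
    (hA : IsMultiplier (torusFourier hτ c.Idx) A fun k => c.fiberOp (c.creation (v k))) :
    BddAnticommZero (c.grading τ) A := by
  refine hA.bddAnticommZero (c.isBoundedMultiplier_matrixOp hτ c.gradingMatrix) fun k => ?_
  rw [← map_mul, ← map_mul, gradingMatrix_mul_creation, map_neg]

theorem matrixOp_comm_rep (M : Matrix c.Idx c.Idx ℂ) (a : smoothTorus Θ) :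
    matrixOp M * c.rep τ a = c.rep τ a * matrixOp M :=
  matrixOp_comm_cstarRep M (a : NCTorus Θ)

/-- With symbol a(ik), every axiom on d other than the commutator bound is a fibre identity; the
Laplacian multiplies by |k|², whose exponentials are summable over ℤⁿ. -/
theorem isN11SpectralData (hτ : IsInvariantTrace τ) :
    IsN11SpectralData (c.rep τ) (c.d τ) (c.grading τ) (c.hodge τ) where
  separable := separable_torusHilbert hτ
  faithful := torusRep_injective hτ
  dense_d := (c.isMultiplier_d hτ).dense
  closed_d := (c.isMultiplier_d hτ).isClosed
  sq_d := (c.isMultiplier_d hτ).sqZero fun k => c.fiberOp_creation_sq _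
  comm_d a := ⟨_, torusOp_commExtends hτ c.dSymbol a⟩
  trace := by
    have h := (c.isMultiplier_d hτ).anticomm_adjoint (fun k => c.fiberOp_creation_sq _)
      (lam := fun k => ∑ j, (k j : ℝ) ^ 2) fun k => c.fiberOp_creation_anticomm_adjoint (by
        rw [star_freq, dotProduct_neg, freq_dotProduct_self, neg_neg])
    exact h.expTraceClass (fun k => Finset.sum_nonneg fun j _ => sq_nonneg _)
      fun ε hε => summable_exp_neg_mul_sq_norm hε
  grading := by
    constructor
    · rw [IsSelfAdjoint]
      change star (matrixOp c.gradingMatrix) = matrixOp c.gradingMatrix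
      rw [← matrixOp_star, gradingMatrix_adj]
    · change matrixOp c.gradingMatrix * matrixOp c.gradingMatrix = _
      rw [← matrixOp_mul, gradingMatrix_sq, matrixOp_one]
  grading_comm a := c.matrixOp_comm_rep _ a
  grading_d := c.bddAnticommZero_grading hτ (c.isMultiplier_d hτ)
  hodge_unitary := by
    have h1 : star (matrixOp (E := τ.GNS) c.hodgeMatrix) = matrixOp c.hodgeMatrix := by
      rw [← matrixOp_star, hodgeMatrix_adj]
    have h2 : matrixOp (E := τ.GNS) c.hodgeMatrix * matrixOp c.hodgeMatrix = 1 := by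
      rw [← matrixOp_mul, hodgeMatrix_sq, matrixOp_one]
    refine Unitary.mem_iff.2 ⟨?_, ?_⟩
    · change star (matrixOp c.hodgeMatrix) * matrixOp c.hodgeMatrix = 1
      rw [h1, h2]
    · change matrixOp c.hodgeMatrix * star (matrixOp c.hodgeMatrix) = 1
      rw [h1, h2]
  hodge_d := ⟨-1, by norm_num, c.hodgeRel hτ (c.isMultiplier_d hτ) (c.isMultiplier_d hτ)
    fun k => star_freq k⟩
  hodge_comm a := c.matrixOp_comm_rep _ a

theorem holSymbol_anticomm (P Q : Matrix (Fin n) (Fin n) ℂ) (j l : Fin n) :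
    c.holSymbol P j * c.holSymbol Q l = -(c.holSymbol Q l * c.holSymbol P j) :=
  eq_neg_of_add_eq_zero_left (c.creation_anticomm _ _)

theorem isSelfAdjoint_secondQuant {P : Matrix (Fin n) (Fin n) ℂ} (hP : Pᴴ = P) :
    IsSelfAdjoint (matrixOp (E := τ.GNS) (c.secondQuant P)) := by
  rw [IsSelfAdjoint, ← matrixOp_star, secondQuant_adj, hP]

theorem sum_closure_eq_d (hτ : IsInvariantTrace τ) (P : Matrix (Fin n) (Fin n) ℂ) :
    (torusOp τ (c.holSymbol P) + torusOp τ (c.holSymbol (1 - P))).closure = c.d τ := by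
  refine ((c.isMultiplier_hol hτ P).add_closure (c.isMultiplier_hol hτ (1 - P))).eq
    ((c.isMultiplier_d hτ).congr fun k => ?_)
  rw [← map_add, ← creation_add, ← Matrix.add_mulVec, add_sub_cancel, Matrix.one_mulVec]

theorem commEqSelf_secondQuant (hτ : IsInvariantTrace τ) {P : Matrix (Fin n) (Fin n) ℂ}
    (hP : P * P = P) :
    CommEqSelf (matrixOp (c.secondQuant P)) (torusOp τ (c.holSymbol P)) := by
  refine (c.isMultiplier_hol hτ P).commEqSelf (c.isBoundedMultiplier_matrixOp hτ _) fun k => ?_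
  rw [← map_mul, ← map_mul, secondQuant_mul_creation, Matrix.mulVec_mulVec, hP, map_add]

theorem commZero_secondQuant (hτ : IsInvariantTrace τ) {P Q : Matrix (Fin n) (Fin n) ℂ}
    (hPQ : P * Q = 0) :
    CommZero (matrixOp (c.secondQuant P)) (torusOp τ (c.holSymbol Q)) := by
  refine (c.isMultiplier_hol hτ Q).commZero (c.isBoundedMultiplier_matrixOp hτ _) fun k => ?_
  rw [← map_mul, ← map_mul, secondQuant_mul_creation, Matrix.mulVec_mulVec, hPQ,
    Matrix.zero_mulVec]
  simp [creation]

theorem anticommZero_hol_adjoint (hτ : IsInvariantTrace τ) {P : Matrix (Fin n) (Fin n) ℂ}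
    (hP : IsPolarization P) :
    AnticommZero (torusOp τ (c.holSymbol P)) (torusOp τ (c.holSymbol (1 - P))).adjoint := by
  refine (c.isMultiplier_hol hτ P).anticommZero (c.isMultiplier_hol hτ (1 - P)).adjoint fun k => ?_
  rw [c.fiberOp_creation_anticomm_adjoint (hP.dotProduct_star_compl k)]
  exact zero_smul ℂ _

theorem isMultiplier_hol_laplacian (hτ : IsInvariantTrace τ) {P : Matrix (Fin n) (Fin n) ℂ}
    (hP : IsPolarization P) : IsMultiplier (torusFourier hτ c.Idx)
      (anticomm (torusOp τ (c.holSymbol P)) (torusOp τ (c.holSymbol P)).adjoint)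
      fun k => ((1 / 2 * ∑ j, (k j : ℝ) ^ 2 : ℝ) : ℂ) • 1 :=
  (c.isMultiplier_hol hτ P).anticomm_adjoint (fun _ => c.fiberOp_creation_sq _)
    fun k => c.fiberOp_creation_anticomm_adjoint (hP.dotProduct_star_self k)

theorem isKahlerSpectralData (hτ : IsInvariantTrace τ) {P : Matrix (Fin n) (Fin n) ℂ}
    (hP : IsPolarization P) :
    IsKahlerSpectralData (c.rep τ) (torusOp τ (c.holSymbol P)) (torusOp τ (c.holSymbol (1 - P)))
      (matrixOp (c.secondQuant P)) (matrixOp (c.secondQuant (1 - P))) (c.grading τ)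
      (c.hodge τ) where
  n11 := by
    rw [c.sum_closure_eq_d hτ]
    exact c.isN11SpectralData hτ
  selfAdjoint_T := c.isSelfAdjoint_secondQuant hP.herm
  selfAdjoint_T' := c.isSelfAdjoint_secondQuant hP.compl.herm
  dense_δ := (c.isMultiplier_hol hτ P).dense
  dense_δ' := (c.isMultiplier_hol hτ (1 - P)).dense
  closed_δ := (c.isMultiplier_hol hτ P).isClosed
  closed_δ' := (c.isMultiplier_hol hτ (1 - P)).isClosed
  sq_δ := (c.isMultiplier_hol hτ P).sqZero fun k => c.fiberOp_creation_sq _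
  sq_δ' := (c.isMultiplier_hol hτ (1 - P)).sqZero fun k => c.fiberOp_creation_sq _
  anticomm_δ_δ' := (c.isMultiplier_hol hτ P).anticommZero (c.isMultiplier_hol hτ (1 - P))
    fun k => by rw [← map_mul, ← map_mul, ← map_add, creation_anticomm, map_zero]
  comm_T_T' := by
    rw [← matrixOp_mul, ← matrixOp_mul, secondQuant_sub, mul_sub, sub_mul, secondQuant_comm_one]
  comm_T_δ := c.commEqSelf_secondQuant hτ hP.idem
  comm_T_δ' := c.commZero_secondQuant hτ (by rw [mul_sub, mul_one, hP.idem, sub_self])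
  comm_T'_δ := c.commZero_secondQuant hτ (by rw [sub_mul, one_mul, hP.idem, sub_self])
  comm_T'_δ' := c.commEqSelf_secondQuant hτ hP.compl.idem
  comm_T a := c.matrixOp_comm_rep _ a
  comm_T' a := c.matrixOp_comm_rep _ a
  comm_δ a := ⟨_, torusOp_commExtends hτ (c.holSymbol P) a⟩
  comm_δ' a := ⟨_, torusOp_commExtends hτ (c.holSymbol (1 - P)) a,
    torusOp_anticommExtends hτ (c.holSymbol_anticomm P (1 - P)) a⟩
  grading_δ := c.bddAnticommZero_grading hτ (c.isMultiplier_hol hτ P)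
  grading_δ' := c.bddAnticommZero_grading hτ (c.isMultiplier_hol hτ (1 - P))
  grading_T := by
    change matrixOp c.gradingMatrix * _ = _ * matrixOp c.gradingMatrix
    rw [← matrixOp_mul, ← matrixOp_mul, gradingMatrix_comm_secondQuant]
  grading_T' := by
    change matrixOp c.gradingMatrix * _ = _ * matrixOp c.gradingMatrix
    rw [← matrixOp_mul, ← matrixOp_mul, gradingMatrix_comm_secondQuant]
  hodge_rel := by
    refine ⟨-1, by norm_num, ?_, ?_⟩
    · exact c.hodgeRel hτ (c.isMultiplier_hol hτ P) (c.isMultiplier_hol hτ (1 - P))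
        fun k => hP.star_mulVec_freq k
    · refine c.hodgeRel hτ (c.isMultiplier_hol hτ (1 - P)) (c.isMultiplier_hol hτ P) fun k => ?_
      rw [hP.compl.star_mulVec_freq, sub_sub_cancel]
  kahler_δ_δ' := c.anticommZero_hol_adjoint hτ hP
  kahler_δ'_δ := by
    -- Complex conjugation exchanges P and 1 - P, so the second Kähler identity is the first one for
    -- the complementary polarization.
    have h := c.anticommZero_hol_adjoint hτ hP.compl
    rwa [sub_sub_cancel] at h
  kahler_laplacian :=
    (c.isMultiplier_hol_laplacian hτ hP).eq (c.isMultiplier_hol_laplacian hτ hP.compl)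

/-- The Kähler structure given by a polarization. -/
def kahlerStructure (hτ : IsInvariantTrace τ) {P : Matrix (Fin n) (Fin n) ℂ}
    (hP : IsPolarization P) :
    KahlerStructure (c.rep τ) (c.d τ) (c.grading τ) (c.hodge τ) where
  δ := torusOp τ (c.holSymbol P)
  δ' := torusOp τ (c.holSymbol (1 - P))
  T := matrixOp (c.secondQuant P)
  T' := matrixOp (c.secondQuant (1 - P))
  isKahler := c.isKahlerSpectralData hτ hP
  sum_eq := c.sum_closure_eq_d hτ P

end CliffordRep

/-! ### Unitary equivalence forces equal polarizations. -/

section Inequivalence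

variable {n : ℕ} {Θ : Matrix (Fin n) (Fin n) ℝ} {τ : NCTorus Θ →ₚ[ℂ] ℂ}
variable {ι : Type} [Fintype ι] [DecidableEq ι]

/-- A unitary operator that commutes with the algebra and conjugates `∑ j, ∂ j ⊗ S j` into
`∑ j, ∂ j ⊗ S' j` conjugates `1 ⊗ S j` into `1 ⊗ S' j`. -/
theorem matrixOp_intertwine (hτ : IsInvariantTrace τ) {S S' : Fin n → Matrix ι ι ℂ}
    (V : TorusHilbert τ ι ≃ₗᵢ[ℂ] TorusHilbert τ ι)
    (hV : ∀ a x, V (torusRep τ ι a x) = torusRep τ ι a (V x))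
    (hS : ∀ x y, (x, y) ∈ (torusOp τ S).graph ↔ (V x, V y) ∈ (torusOp τ S').graph)
    (j : Fin n) (x : TorusHilbert τ ι) : V (matrixOp (S j) x) = matrixOp (S' j) (V x) := by
  -- For this monomial only ∂_j a is nonzero and it equals i a, so the commutator isolates the
  -- single matrix S_j, up to a factor that can be inverted.
  let a : smoothTorus Θ := smoothMonomial (Pi.single j 1)
  have hC : ∀ (R : Fin n → Matrix ι ι ℂ) (x : TorusHilbert τ ι),
      torusClifford τ (fun l => torusDeriv l a) R x =
        Complex.I • torusRep τ ι a (matrixOp (R j) x) := by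
    intro R x
    rw [torusClifford, sum_apply, Finset.sum_eq_single j]
    · rw [torusDeriv_smoothMonomial, map_smul]
      simp only [Pi.single_eq_same, Int.cast_one, mul_one]
      rfl
    · intro l _ hl
      rw [torusDeriv_smoothMonomial, Pi.single_eq_of_ne hl]
      simp
    · simp
  have hinj : Function.Injective (torusRep τ ι a) := by
    intro x y h
    have h1 := congrArg (cstarRep τ ι (star (torusMonomial Θ (Pi.single j 1) : NCTorus Θ))) h
    have h2 : ∀ z, cstarRep τ ι (star (torusMonomial Θ (Pi.single j 1) : NCTorus Θ))
        (torusRep τ ι a z) = z := by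
      intro z
      change (cstarRep τ ι (star (torusMonomial Θ (Pi.single j 1) : NCTorus Θ)) *
        cstarRep τ ι (torusMonomial Θ (Pi.single j 1) : NCTorus Θ)) z = z
      rw [← map_mul, Unitary.coe_star_mul_self, map_one]
      rfl
    rwa [h2, h2] at h1
  have hdom : ∀ x ∈ (torusOp τ S).domain, V (matrixOp (S j) x) = matrixOp (S' j) (V x) := by
    intro x hx
    obtain ⟨y, hxy⟩ := LinearPMap.mem_domain_iff.1 hx
    have h1 := (hS _ _).1 (torusOp_commExtends hτ S a x y hxy)
    have h2 := torusOp_commExtends hτ S' a _ _ ((hS _ _).1 hxy)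
    rw [hV, map_add, hV] at h1
    have h3 := add_left_cancel (LinearPMap.mem_graph_snd_inj _ h1 h2 rfl)
    rw [hC, hC, map_smul, hV] at h3
    exact hinj (smul_right_injective _ Complex.I_ne_zero h3)
  -- Both sides are bounded operators, so agreement on the dense domain suffices.
  have hd := (isMultiplier_torusOp hτ S).dense
  exact congrFun (Continuous.ext_on hd (V.continuous.comp (matrixOp (S j)).continuous)
    ((matrixOp (S' j)).continuous.comp V.continuous) hdom) x

end Inequivalence

namespace CliffordRep

variable {n : ℕ} {Θ : Matrix (Fin n) (Fin n) ℝ} {τ : NCTorus Θ →ₚ[ℂ] ℂ} (c : CliffordRep n)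

/-- The unitary intertwines the coefficients of ∂ and of ∂̄. Their sums are the A_j for both
structures, so it commutes with all A_j and with their linear combinations, among them the
coefficients of ∂. These therefore coincide and determine the columns of P. -/
theorem eq_of_unitarilyEquiv (hτ : IsInvariantTrace τ) {P Q : Matrix (Fin n) (Fin n) ℂ}
    (hP : IsPolarization P) (hQ : IsPolarization Q)
    (h : (c.kahlerStructure hτ hP).UnitarilyEquiv (c.kahlerStructure hτ hQ)) : P = Q := by
  obtain ⟨V, hV, h1, h2⟩ := h
  have e1 := matrixOp_intertwine hτ V hV h1
  have e2 := matrixOp_intertwine hτ V hV h2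
  have hsum : ∀ (R : Matrix (Fin n) (Fin n) ℂ) (j : Fin n),
      c.dSymbol j = c.holSymbol R j + c.holSymbol (1 - R) j := by
    intro R j
    rw [holSymbol, holSymbol, ← creation_add]
    have : (fun i => R i j) + (fun i => (1 - R) i j) = Pi.single j 1 := by
      funext i
      simp [Matrix.one_apply, Pi.single_apply]
    rw [this]
    simp [creation, Pi.single_apply]
  have hd : ∀ j x, V (matrixOp (c.dSymbol j) x) = matrixOp (c.dSymbol j) (V x) := by
    intro j x
    nth_rewrite 1 [hsum P j]
    rw [hsum Q j, matrixOp_add, matrixOp_add, add_apply, add_apply, map_add, e1, e2]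
  have hc : ∀ v x, V (matrixOp (c.creation v) x) = matrixOp (c.creation v) (V x) := by
    intro v x
    have hm : ∀ y : TorusHilbert τ c.Idx, matrixOp (c.creation v) y =
        ∑ j, v j • matrixOp (c.dSymbol j) y := by
      intro y
      let φ : Matrix c.Idx c.Idx ℂ →ₗ[ℂ] TorusHilbert τ c.Idx :=
        { toFun := fun M => matrixOp M y
          map_add' := fun M N => by rw [matrixOp_add, add_apply]
          map_smul' := fun r M => by rw [matrixOp_smul, smul_apply, RingHom.id_apply] }
      change φ _ = ∑ j, v j • φ _
      rw [creation, map_sum]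
      simp only [map_smul]
    rw [hm, hm, map_sum]
    simp only [map_smul, hd]
  have hnt : Nontrivial τ.GNS := by
    obtain ⟨e, -⟩ := exists_gnsBasis hτ
    exact ⟨e 0, 0, e.orthonormal.ne_zero 0⟩
  ext i j
  have hop : matrixOp (E := τ.GNS) (c.holSymbol P j) = matrixOp (c.holSymbol Q j) := by
    ext1 y
    obtain ⟨x, rfl⟩ := V.surjective y
    rw [← e1 j x]
    exact (hc _ x).symm
  exact congrFun (c.creation_injective (matrixOp_injective hop)) i

end CliffordRep

/-! ### Orthogonal complex structures and the count. -/

section ComplexStructures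

variable {κ : Type*} [Fintype κ] [DecidableEq κ]

/-- The projection onto the `i`-eigenspace of an orthogonal complex structure. -/
def holProj (J : Matrix κ κ ℝ) : Matrix κ κ ℂ :=
  (1 / 2 : ℂ) • (1 - Complex.I • J.map Complex.ofReal)

theorem holProj_injective : Function.Injective (holProj (κ := κ)) := by
  intro J J' h
  ext a b
  have := congrFun (congrFun h a) b
  simpa [holProj] using this

theorem isPolarization_holProj {J : Matrix κ κ ℝ} (hT : Jᵀ = -J) (hJ : J * J = -1) :
    IsPolarization (holProj J) where
  herm := by
    ext a b
    have h : J b a = -J a b := congrFun (congrFun hT a) b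
    simp [holProj, Matrix.one_apply, h, eq_comm, apply_ite]
    exact (sub_eq_add_neg _ _).symm
  idem := by
    have h : J.map Complex.ofReal * J.map Complex.ofReal = -1 := by
      have := congrArg (fun M : Matrix κ κ ℝ => M.map Complex.ofRealHom) hJ
      simp only [Matrix.map_mul] at this
      refine this.trans ?_
      ext a b
      simp [Matrix.one_apply, apply_ite]
    rw [holProj, smul_mul_smul_comm, sub_mul, mul_sub, mul_sub, smul_mul_smul_comm, h,
      Complex.I_mul_I]
    simp only [mul_one, one_mul]
    module
  conj := by
    ext a b
    have h2 : (starRingEnd ℂ) 2 = 2 := Complex.conj_ofNat 2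
    simp only [holProj, one_div, Matrix.map_apply, Matrix.smul_apply, Matrix.sub_apply,
      Matrix.one_apply, smul_eq_mul, RCLike.star_def, map_mul, map_inv₀, h2, map_sub, apply_ite,
      map_one, map_zero, Complex.conj_I, Complex.conj_ofReal]
    split_ifs <;> ring

theorem IsPolarization.submatrix {ι : Type*} [Fintype ι] [DecidableEq ι] {P : Matrix κ κ ℂ}
    (hP : IsPolarization P) (e : ι ≃ κ) : IsPolarization (P.submatrix e e) where
  herm := by rw [Matrix.conjTranspose_submatrix, hP.herm]
  idem := by rw [Matrix.submatrix_mul_equiv, hP.idem]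
  conj := by
    have h := congrArg (fun M : Matrix κ κ ℂ => M.submatrix e e) hP.conj
    rw [← Matrix.submatrix_one_equiv e]
    exact h

/-- The unit imaginary quaternions `a i + b j` acting on `ℝ⁴`. -/
def quaternionUnit (a b : ℝ) : Matrix (Fin 4) (Fin 4) ℝ :=
  !![0, -a, -b, 0; a, 0, 0, b; b, 0, 0, -a; 0, -b, a, 0]

theorem quaternionUnit_transpose (a b : ℝ) : (quaternionUnit a b)ᵀ = -quaternionUnit a b := by
  ext i j
  fin_cases i <;> fin_cases j <;> simp [quaternionUnit]

theorem quaternionUnit_mul_self {a b : ℝ} (h : a ^ 2 + b ^ 2 = 1) :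
    quaternionUnit a b * quaternionUnit a b = -1 := by
  ext i j
  fin_cases i <;> fin_cases j <;>
    simp [quaternionUnit, Matrix.mul_apply, Fin.sum_univ_four] <;> linarith

/-- Infinitely many orthogonal complex structures on `ℝ⁴ ⊕ ℝᵐ ⊕ ℝᵐ`. -/
theorem exists_injective_complexStructure (m : ℕ) :
    ∃ J : ℕ → Matrix (Fin 4 ⊕ (Fin m ⊕ Fin m)) (Fin 4 ⊕ (Fin m ⊕ Fin m)) ℝ,
      Function.Injective J ∧ ∀ k, (J k)ᵀ = -J k ∧ J k * J k = -1 := by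
  -- Distinct values in (0, 1], completed to points (a, b) of the unit circle by b = √(1 - a²).
  let a : ℕ → ℝ := fun k => 1 / (k + 1)
  have ha : ∀ k, a k ^ 2 + √(1 - a k ^ 2) ^ 2 = 1 := by
    intro k
    have h0 : 0 ≤ a k := by positivity
    have h1 : a k ≤ 1 := by
      rw [div_le_one (by positivity)]
      linarith [Nat.cast_nonneg (α := ℝ) k]
    rw [Real.sq_sqrt (by nlinarith)]
    ring
  refine ⟨fun k => Matrix.fromBlocks (quaternionUnit (a k) √(1 - a k ^ 2)) 0 0
    (Matrix.J (Fin m) ℝ), fun k l h => ?_, fun k => ⟨?_, ?_⟩⟩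
  -- The entry in row 1, column 0 of the quaternion block is a, so the matrix determines k.
  · have h' := congrFun (congrFun (Matrix.fromBlocks_inj.1 h).1 1) 0
    simpa [quaternionUnit, a] using h'
  · rw [Matrix.fromBlocks_transpose, quaternionUnit_transpose, Matrix.J_transpose,
      Matrix.fromBlocks_neg]
    simp
  · rw [Matrix.fromBlocks_multiply, quaternionUnit_mul_self (ha k), Matrix.J_squared]
    simp only [Matrix.mul_zero, Matrix.zero_mul, add_zero, zero_add]
    rw [← Matrix.fromBlocks_one (l := Fin 4) (m := Fin m ⊕ Fin m), Matrix.fromBlocks_neg, neg_zero,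
      neg_zero]

theorem exists_isPolarization {n : ℕ} (hn : Even n) :
    ∃ P : Matrix (Fin n) (Fin n) ℂ, IsPolarization P := by
  obtain ⟨m, rfl⟩ := hn
  exact ⟨_, (isPolarization_holProj (Matrix.J_transpose (Fin m) ℝ)
    (Matrix.J_squared (Fin m) ℝ)).submatrix finSumFinEquiv.symm⟩

theorem exists_injective_isPolarization {n : ℕ} (hn : Even n) (h4 : 4 ≤ n) :
    ∃ P : ℕ → Matrix (Fin n) (Fin n) ℂ, Function.Injective P ∧ ∀ k, IsPolarization (P k) := by
  obtain ⟨m, rfl⟩ : ∃ m, n = 4 + (m + m) := by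
    obtain ⟨r, rfl⟩ := hn
    exact ⟨r - 2, by omega⟩
  obtain ⟨J, hinj, hJ⟩ := exists_injective_complexStructure m
  let e : Fin (4 + (m + m)) ≃ Fin 4 ⊕ (Fin m ⊕ Fin m) :=
    finSumFinEquiv.symm.trans ((Equiv.refl _).sumCongr finSumFinEquiv.symm)
  refine ⟨fun k => (holProj (J k)).submatrix e e, fun k l h => hinj (holProj_injective ?_),
    fun k => (isPolarization_holProj (hJ k).1 (hJ k).2).submatrix e⟩
  exact (Matrix.reindex e.symm e.symm).injective h

/-- A family of distinct polarizations indexed by a set of `∏_{j odd} (n - j)` elements. -/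
theorem exists_family_isPolarization {n : ℕ} (hn : Even n) :
    ∃ P : Fin (∏ j ∈ (Finset.Icc 1 n).filter Odd, (n - j)) → Matrix (Fin n) (Fin n) ℂ,
      Function.Injective P ∧ ∀ p, IsPolarization (P p) := by
  rcases le_or_gt 4 n with h4 | h4
  -- An infinite family contains any prescribed finite number of members, so the value of the
  -- product is irrelevant here.
  · obtain ⟨P, hinj, hP⟩ := exists_injective_isPolarization hn h4
    exact ⟨fun p => P p, hinj.comp Fin.val_injective, fun p => hP p⟩
  · obtain ⟨P, hP⟩ := exists_isPolarization hn
    -- Only n = 0, with an empty product, and n = 2, with the single factor 2 - 1, remain, so one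
    -- polarization is enough.
    have h1 : ∏ j ∈ (Finset.Icc 1 n).filter Odd, (n - j) = 1 := by
      interval_cases n
      · decide
      · exact absurd hn (by decide)
      · decide
      · exact absurd hn (by decide)
    have : Subsingleton (Fin (∏ j ∈ (Finset.Icc 1 n).filter Odd, (n - j))) := by
      rw [h1]
      infer_instance
    exact ⟨fun _ => P, Function.injective_of_subsingleton _, fun _ => hP⟩

end ComplexStructures

end

theorem mainTheorem6 (n : ℕ) (hn : Even n) (Θ : Matrix (Fin n) (Fin n) ℝ) (hΘ : Θᵀ = -Θ) :
    (∃! τ : NCTorus Θ →ₚ[ℂ] ℂ, IsInvariantTrace τ) ∧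
    Nonempty (CliffordRep n) ∧
    ∀ (τ : NCTorus Θ →ₚ[ℂ] ℂ), IsInvariantTrace τ → ∀ c : CliffordRep n,
      IsN11SpectralData (c.rep τ) (c.d τ) (c.grading τ) (c.hodge τ) ∧
      Nonempty (KahlerStructure (c.rep τ) (c.d τ) (c.grading τ) (c.hodge τ)) ∧
      ∃ K : Fin (∏ j ∈ (Finset.Icc 1 n).filter Odd, (n - j)) →
          KahlerStructure (c.rep τ) (c.d τ) (c.grading τ) (c.hodge τ),
        Pairwise fun p q => ¬ (K p).UnitarilyEquiv (K q) := by
  refine ⟨existsUnique_invariantTrace hΘ, nonempty_cliffordRep hn, fun τ hτ c => ?_⟩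
  obtain ⟨P₀, hP₀⟩ := exists_isPolarization hn
  obtain ⟨P, hinj, hP⟩ := exists_family_isPolarization hn
  exact ⟨c.isN11SpectralData hτ, ⟨c.kahlerStructure hτ hP₀⟩,
    fun p => c.kahlerStructure hτ (hP p),
    fun p q hpq h => hpq (hinj (c.eq_of_unitarilyEquiv hτ (hP p) (hP q) h))⟩
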